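/- **Proposition 4.2 (Variational formulation).** *Setting.* Let $\Omega_-\subset\mathbb R^d$ be bounded, open and connected with Lipschitz boundary $\Gamma$, exterior unit normal $\boldsymbol\nu$, $\Omega_+=\mathbb R^d\setminus\overline{\Omega_-}$, and $\Gamma=\overline{\Gamma_D}\cup\overline{\Gamma_N}$ with $\Gamma_D\ne\varnothing$, $\Gamma_N$ disjoint and relatively open. Let $c,\rho_f>0$ and $\operatorname{Re}s>0$. Let $\mathbf C,\mathbf e,\boldsymbol\epsilon$ be real tensor fields with entries in $L^\infty(\Omega_-)$ and symmetries $\mathbf C_{ijkl}=\mathbf C_{jikl}=\mathbf C_{klij}$, $\mathbf e_{lij}=\mathbf e_{lji}$, $\boldsymbol\epsilon_{il}=\boldsymbol\epsilon_{li}$, with $\mathbf C$ (on symmetric matrices) and $\boldsymbol\epsilon$ uniformly positive definite a.e., and let $0<\rho_\Sigma\in L^\infty(\Omega_-)$. All function spaces are complex and all brackets bilinear: $(a,b)_\Omega=\int_\Omega ab$, and $\langle\cdot,\cdot\rangle_\Gamma$ extends $\int_\Gamma ab$ to the duality of $H^{-1/2}(\Gamma)=H^{1/2}(\Gamma)'$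 with the trace space $H^{1/2}(\Gamma)$. Let $\gamma$ be the trace on $\Gamma$ of functions on $\Omega_-$, $\gamma_D=\gamma(\cdot)|_{\Gamma_D}$, $H^1_D(\Omega_-)=\{\psi\in H^1(\Omega_-):\gamma_D\psi=0\}$, and $H^{-1/2}(\Gamma_N)$ the dual of $\{\gamma\varphi|_{\Gamma_N}:\varphi\in H^1_D(\Omega_-)\}$, with pairing $\langle\cdot,\cdot\rangle_{\Gamma_N}$. For $v\in H^1(\mathbb R^d\setminus\Gamma)$ let $\gamma^\pm v$ be the traces from $\Omega_\pm$, $\partial_\nu^\pm v\in H^{-1/2}(\Gamma)$ the weak normal derivatives (if $\Delta v\in L^2(\mathbb R^d\setminus\Gamma)$), $[\![\gamma v]\!]=\gamma^-v-\gamma^+v$ and $[\![\partial_\nu v]\!]=\partial_\nu^-v-\partial_\nu^+v$. With $\boldsymbol\varepsilon(\mathbf u)=\frac12(\nabla\mathbf u+\nabla\mathbf u^\top)$ put $$\mathcal B((\mathbf u,\psi),(\mathbf w,\varphi);s)=(\mathbf C\boldsymbol\varepsilon(\mathbf u),\boldsymbol\varepsilon(\mathbf w))_{\Omega_-}+s^2(\rho_\Sigma\mathbf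 u,\mathbf w)_{\Omega_-}+(\mathbf e\nabla\psi,\boldsymbol\varepsilon(\mathbf w))_{\Omega_-}-(\boldsymbol\varepsilon(\mathbf u),\mathbf e\nabla\varphi)_{\Omega_-}+(\boldsymbol\epsilon\nabla\psi,\nabla\varphi)_{\Omega_-},$$ where $(\mathbf e\mathbf d)_{ij}=\sum_k\mathbf e_{kij}\mathbf d_k$. Let $\mathbf V_h\subseteq H^1(\Omega_-)^d$, $V_h\subseteq H^1(\Omega_-)$, $X_h\subseteq H^{-1/2}(\Gamma)$, $Y_h\subseteq H^{1/2}(\Gamma)$ be closed (for instance finite-dimensional) subspaces, $V_{h,D}=V_h\cap H^1_D(\Omega_-)$, let $X_h^\circ\subseteq H^{1/2}(\Gamma)$ and $Y_h^\circ\subseteq H^{-1/2}(\Gamma)$ be the annihilators of $X_h$ and $Y_h$, and $$V_h^*=\{w\in H^1(\mathbb R^d\setminus\Gamma):[\![\gamma w]\!]\in Y_h,\ \gamma^-w\in X_h^\circ\}.$$ The data are $\alpha_d,\lambda_d\in H^{-1/2}(\Gamma)$, $\beta_d,\phi_d\in H^{1/2}(\Gamma)$, $\eta_d\in H^{-1/2}(\Gamma_N)$,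 $\mu_d^h\in\gamma_DV_h$, $\boldsymbol\theta_d\in H^1(\Omega_-)^d$, $\theta_d\in L^2(\Gamma)$. *Transmission problem.* Find $(v,\mathbf u,\psi)\in H^1(\mathbb R^d\setminus\Gamma)\times\mathbf V_h\times V_h$ such that, for all $(\mathbf w,\varphi)\in\mathbf V_h\times V_{h,D}$, $$\begin{aligned} -\Delta v+(s/c)^2v&=0\quad\text{in }\mathbb R^d\setminus\Gamma,\qquad \gamma_D\psi=\mu_d^h,\\ \mathcal B((\mathbf u,\psi),(\mathbf w,\varphi);s)-\rho_fs\langle[\![\gamma v]\!],\gamma\mathbf w\cdot\boldsymbol\nu\rangle_\Gamma&=-\rho_fs\langle\beta_d,\gamma\mathbf w\cdot\boldsymbol\nu\rangle_\Gamma+\langle\eta_d,\gamma\varphi\rangle_{\Gamma_N}+s^2(\rho_\Sigma\boldsymbol\theta_d,\mathbf w)_{\Omega_-},\\ -(0,s\gamma\mathbf u\cdot\boldsymbol\nu)-(\gamma^-v,\partial_\nu^+v)-(0,\alpha_d+s\theta_d)&\in X_h^\circ\times Y_h^\circ,\\ ([\![\partial_\nu v]\!]+\lambda_d,[\![\gamma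 v]\!]+\phi_d)&\in X_h\times Y_h. \end{aligned}$$ *Variational problem.* Find $(v,\mathbf u,\psi)\in H^1(\mathbb R^d\setminus\Gamma)\times\mathbf V_h\times V_h$ such that $\gamma_D\psi=\mu_d^h$, $([\![\gamma v]\!]+\phi_d,\gamma^-v)\in Y_h\times X_h^\circ$ and $$\mathcal A((v,\mathbf u,\psi),(w,\mathbf w,\varphi);s)=\ell((w,\mathbf w,\varphi);s)\qquad\forall(w,\mathbf w,\varphi)\in V_h^*\times\mathbf V_h\times V_{h,D},$$ where $$\begin{aligned} \mathcal A((v,\mathbf u,\psi),(w,\mathbf w,\varphi);s)={}&\rho_f(\nabla v,\nabla w)_{\mathbb R^d\setminus\Gamma}+\rho_f(s/c)^2(v,w)_{\mathbb R^d\setminus\Gamma}+\mathcal B((\mathbf u,\psi),(\mathbf w,\varphi);s)\\ &+\rho_fs\langle\gamma\mathbf u\cdot\boldsymbol\nu,[\![\gamma w]\!]\rangle_\Gamma-\rho_fs\langle[\![\gamma v]\!],\gamma\mathbf w\cdot\boldsymbol\nu\rangle_\Gamma,\\ \ell((w,\mathbf w,\varphi);s)={}&-\rho_f\langle\lambda_d,\gamma^-w\rangle_\Gamma-\rho_f\langle\alpha_d+s\theta_d,[\![\gamma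 w]\!]\rangle_\Gamma+s^2(\rho_\Sigma\boldsymbol\theta_d,\mathbf w)_{\Omega_-}\\ &-\rho_fs\langle\beta_d,\gamma\mathbf w\cdot\boldsymbol\nu\rangle_\Gamma+\langle\eta_d,\gamma\varphi\rangle_{\Gamma_N}. \end{aligned}$$ *Claim.* The two problems are equivalent: a triplet $(v,\mathbf u,\psi)\in H^1(\mathbb R^d\setminus\Gamma)\times\mathbf V_h\times V_h$ solves the transmission problem if and only if it solves the variational problem. -/

import Mathlib

open MeasureTheory Set Topology
open scoped ENNReal NNReal ContDiff

namespace PiezoScattering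

noncomputable section

/-! ## Sobolev spaces on open sets -/

/-- The ambient space `ℝ^d` with its Euclidean norm. -/
abbrev Rd (d : ℕ) : Type := EuclideanSpace ℝ (Fin d)

/-- `L²(U)`, complex valued, for Lebesgue measure. -/
abbrev L2 {d : ℕ} (U : Set (Rd d)) : Type := Lp ℂ 2 (volume.restrict U)

/-- `C_c^∞(U)`, complex valued. -/
structure IsTestFunction {d : ℕ} (U : Set (Rd d)) (η : Rd d → ℂ) : Prop where
  smooth : ContDiff ℝ ∞ η
  compact : HasCompactSupport η
  support : tsupport η ⊆ U

/-- The classical partial derivative `∂η/∂x_i`. -/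
def pderiv {d : ℕ} (η : Rd d → ℂ) (i : Fin d) (x : Rd d) : ℂ :=
  fderiv ℝ η x (EuclideanSpace.single i 1)

theorem IsTestFunction.memLp {d : ℕ} {U : Set (Rd d)} {η : Rd d → ℂ}
    (h : IsTestFunction U η) (μ : Measure (Rd d)) [IsFiniteMeasureOnCompacts μ] :
    MemLp η 2 μ :=
  h.smooth.continuous.memLp_of_hasCompactSupport h.compact

theorem IsTestFunction.hasCompactSupport_pderiv {d : ℕ} {U : Set (Rd d)} {η : Rd d → ℂ}
    (h : IsTestFunction U η) (i : Fin d) : HasCompactSupport (pderiv η i) :=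
  h.compact.fderiv_apply ℝ (EuclideanSpace.single i (1 : ℝ))

theorem IsTestFunction.memLp_pderiv {d : ℕ} {U : Set (Rd d)} {η : Rd d → ℂ}
    (h : IsTestFunction U η) (i : Fin d) (μ : Measure (Rd d)) [IsFiniteMeasureOnCompacts μ] :
    MemLp (pderiv η i) 2 μ := by
  refine Continuous.memLp_of_hasCompactSupport ?_ (h.hasCompactSupport_pderiv i)
  exact (h.smooth.continuous_fderiv (by simp)).clm_apply continuous_const

theorem IsTestFunction.pderiv_eq_zero {d : ℕ} {U : Set (Rd d)} {η : Rd d → ℂ}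
    (h : IsTestFunction U η) (i : Fin d) {x : Rd d} (hx : x ∉ U) : pderiv η i x = 0 := by
  have : x ∉ tsupport η := fun hx' => hx (h.support hx')
  simp [pderiv, fderiv_of_notMem_tsupport (𝕜 := ℝ) this]

theorem IsTestFunction.eq_zero {d : ℕ} {U : Set (Rd d)} {η : Rd d → ℂ}
    (h : IsTestFunction U η) {x : Rd d} (hx : x ∉ U) : η x = 0 :=
  image_eq_zero_of_notMem_tsupport fun hx' => hx (h.support hx')

/-- `H¹(U)`: families `f` whose component `f none ∈ L²(U)` is the function and whose components
`f (some i) ∈ L²(U)` are its weak partial derivatives on `U`.  The norm inherited from the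
`ℓ²`-product is the usual `‖f‖² = ‖f‖²_{L²} + ∑ i, ‖∂_i f‖²_{L²}`. -/
def H1 {d : ℕ} (U : Set (Rd d)) : Submodule ℂ (PiLp 2 fun _ : Option (Fin d) => L2 U) where
  carrier := {f | ∀ (i : Fin d) (η : Rd d → ℂ), IsTestFunction U η →
    ∫ x in U, f none x * pderiv η i x = -(∫ x in U, f (some i) x * η x)}
  zero_mem' := by
    intro i η _
    have h : ∀ k : Option (Fin d), ∀ ζ : Rd d → ℂ,
        ∫ x in U, (0 : PiLp 2 fun _ : Option (Fin d) => L2 U) k x * ζ x = 0 := by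
      intro k ζ
      refine integral_eq_zero_of_ae ?_
      filter_upwards [Lp.coeFn_zero ℂ 2 (volume.restrict U)] with x hx
      have : ((0 : PiLp 2 fun _ : Option (Fin d) => L2 U) k) = (0 : L2 U) := rfl
      rw [this, hx]
      simp
    rw [h, h, neg_zero]
  add_mem' := by
    intro f g hf hg i η hη
    have h : ∀ k : Option (Fin d), ∀ ζ : Rd d → ℂ, MemLp ζ 2 (volume.restrict U) →
        ∫ x in U, (f + g) k x * ζ x =
          (∫ x in U, f k x * ζ x) + (∫ x in U, g k x * ζ x) := by
      intro k ζ hζ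
      have hfk : Integrable (fun x => f k x * ζ x) (volume.restrict U) :=
        (Lp.memLp (f k)).integrable_mul hζ
      have hgk : Integrable (fun x => g k x * ζ x) (volume.restrict U) :=
        (Lp.memLp (g k)).integrable_mul hζ
      rw [← integral_add hfk hgk]
      refine integral_congr_ae ?_
      filter_upwards [Lp.coeFn_add (f k) (g k)] with x hx
      have : (f + g) k = f k + g k := rfl
      rw [this, hx, Pi.add_apply, add_mul]
    rw [h none _ (hη.memLp_pderiv i _), h (some i) _ (hη.memLp _), hf i η hη, hg i η hη]
    ring
  smul_mem' := by
    intro c f hf i η hη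
    have h : ∀ k : Option (Fin d), ∀ ζ : Rd d → ℂ,
        ∫ x in U, (c • f) k x * ζ x = c * ∫ x in U, f k x * ζ x := by
      intro k ζ
      rw [← integral_const_mul]
      refine integral_congr_ae ?_
      filter_upwards [Lp.coeFn_smul c (f k)] with x hx
      have : (c • f) k = c • f k := rfl
      rw [this, hx, Pi.smul_apply, smul_eq_mul, mul_assoc]
    rw [h, h, hf i η hη, mul_neg]

/-- The function underlying an element of `H¹(U)`. -/
def valH1 {d : ℕ} {U : Set (Rd d)} (u : H1 U) : L2 U := u.1 none

/-- The weak partial derivative `∂_i u` of an element of `H¹(U)`. -/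
def gradH1 {d : ℕ} {U : Set (Rd d)} (u : H1 U) (i : Fin d) : L2 U := u.1 (some i)

/-- Restriction `L²(ν) → L²(μ)` for `μ ≤ ν`. -/
def restrictLp {α : Type*} [MeasurableSpace α] {μ ν : Measure α} (h : μ ≤ ν) :
    Lp ℂ 2 ν →L[ℂ] Lp ℂ 2 μ :=
  LinearMap.mkContinuous
    { toFun := fun f => ((Lp.memLp f).mono_measure h).toLp f
      map_add' := by
        intro f g
        rw [← MemLp.toLp_add]
        exact MemLp.toLp_congr _ _ (ae_mono h (Lp.coeFn_add f g))
      map_smul' := by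
        intro c f
        rw [RingHom.id_apply, ← MemLp.toLp_const_smul]
        exact MemLp.toLp_congr _ _ (ae_mono h (Lp.coeFn_smul c f)) }
    1 (by
      intro f
      rw [one_mul]
      change ‖((Lp.memLp f).mono_measure h).toLp f‖ ≤ ‖f‖
      rw [Lp.norm_toLp, Lp.norm_def]
      exact ENNReal.toReal_mono (Lp.eLpNorm_ne_top f) (eLpNorm_mono_measure _ h))

theorem restrictLp_coeFn {α : Type*} [MeasurableSpace α] {μ ν : Measure α} (h : μ ≤ ν)
    (f : Lp ℂ 2 ν) : restrictLp h f =ᵐ[μ] f :=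
  MemLp.coeFn_toLp ((Lp.memLp f).mono_measure h)

/-- Restriction of functions and weak derivatives from `U` to a subset `V`. -/
def restrictFamily {d : ℕ} {U V : Set (Rd d)} (h : V ⊆ U) :
    (PiLp 2 fun _ : Option (Fin d) => L2 U) →L[ℂ] (PiLp 2 fun _ : Option (Fin d) => L2 V) :=
  ((PiLp.continuousLinearEquiv 2 ℂ (fun _ : Option (Fin d) => L2 V)).symm :
      (∀ _ : Option (Fin d), L2 V) →L[ℂ] _).comp
    (ContinuousLinearMap.pi fun k =>
      (restrictLp (Measure.restrict_mono h le_rfl)).comp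
        (PiLp.proj 2 (fun _ : Option (Fin d) => L2 U) k))

theorem restrictFamily_mem {d : ℕ} {U V : Set (Rd d)} (h : V ⊆ U) (u : H1 U) :
    restrictFamily h u.1 ∈ H1 V := by
  intro i η hη
  have hη' : IsTestFunction U η := ⟨hη.smooth, hη.compact, hη.support.trans h⟩
  have key : ∀ k : Option (Fin d), ∀ ζ : Rd d → ℂ, (∀ x, x ∉ V → ζ x = 0) →
      ∫ x in V, restrictFamily h u.1 k x * ζ x = ∫ x in U, u.1 k x * ζ x := by
    intro k ζ hζ
    have h1 : ∫ x in V, restrictFamily h u.1 k x * ζ x = ∫ x in V, u.1 k x * ζ x := by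
      refine integral_congr_ae ?_
      filter_upwards [restrictLp_coeFn (Measure.restrict_mono h (le_refl volume)) (u.1 k)]
        with x hx
      exact congrArg (· * ζ x) hx
    rw [h1, setIntegral_eq_integral_of_forall_compl_eq_zero
        (fun x hx => by rw [hζ x hx, mul_zero]),
      setIntegral_eq_integral_of_forall_compl_eq_zero
        (fun x hx => by rw [hζ x (fun hV => hx (h hV)), mul_zero])]
  rw [key none _ (fun x hx => hη.pderiv_eq_zero i hx), key (some i) _ (fun x hx => hη.eq_zero hx)]
  exact u.2 i η hη'

/-- The restriction map `H¹(U) → H¹(V)` for `V ⊆ U`. -/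
def restrictH1 {d : ℕ} {U V : Set (Rd d)} (h : V ⊆ U) : H1 U →L[ℂ] H1 V :=
  ((restrictFamily h).comp (H1 U).subtypeL).codRestrict (H1 V) (restrictFamily_mem h)

/-- The bilinear bracket `(∇u, ∇w)_U` (no complex conjugation). -/
def gradForm {d : ℕ} {U : Set (Rd d)} (u w : H1 U) : ℂ :=
  ∑ i, ∫ x in U, gradH1 u i x * gradH1 w i x

/-- The bilinear bracket `(u, w)_U` (no complex conjugation). -/
def massForm {d : ℕ} {U : Set (Rd d)} (u w : L2 U) : ℂ := ∫ x in U, u x * w x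

/-- `Δ v = f` in the sense of distributions on `U`. -/
def HasWeakLaplacian {d : ℕ} {U : Set (Rd d)} (v : H1 U) (f : L2 U) : Prop :=
  ∀ η : Rd d → ℂ, IsTestFunction U η →
    -(∑ i, ∫ x in U, gradH1 v i x * pderiv η i x) = ∫ x in U, f x * η x

open Classical in
/-- The distributional Laplacian of `v ∈ H¹(U)`, for `v` with `Δ v ∈ L²(U)`. -/
def weakLaplacian {d : ℕ} {U : Set (Rd d)} (v : H1 U) : L2 U :=
  if h : ∃ f, HasWeakLaplacian v f then h.choose else 0

/-! ## Lipschitz boundaries, surface measure, normal vector, traces -/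

/-- Near each of its boundary points `Ω` is, in some orthonormal coordinates with last
direction `e`, the region strictly above the graph of a Lipschitz function of the other
coordinates. -/
def HasLipschitzBoundary {d : ℕ} (Ω : Set (Rd d)) : Prop :=
  ∀ x ∈ frontier Ω, ∃ (e : Rd d) (g : Rd d → ℝ) (K : ℝ≥0) (r : ℝ),
    ‖e‖ = 1 ∧ LipschitzWith K g ∧ (∀ (y : Rd d) (t : ℝ), g (y + t • e) = g y) ∧ 0 < r ∧
    ∀ y ∈ Metric.ball x r, (y ∈ Ω ↔ g y < inner ℝ e y)

/-- The `(d-1)`-dimensional surface measure on `Γ ⊆ ℝ^d`. -/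
def surf {d : ℕ} (Γ : Set (Rd d)) : Measure (Rd d) := μHE[d - 1].restrict Γ

/-- `L²(Γ)`, complex valued, for surface measure. -/
abbrev L2Surf {d : ℕ} (Γ : Set (Rd d)) : Type := Lp ℂ 2 (surf Γ)

/-- `n` is the unit normal vector exterior to `Ω` at the boundary point `x`: up to a first-order
error, `Ω` is near `x` the half-space `{y | ⟪y - x, n⟫ < 0}`.  Such an `n` is unique; for a
Lipschitz boundary it exists where the graph is differentiable, hence almost everywhere. -/
def IsOuterNormal {d : ℕ} (Ω : Set (Rd d)) (x n : Rd d) : Prop :=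
  ‖n‖ = 1 ∧ ∀ ε > 0, ∀ᶠ y in 𝓝 x,
    (inner ℝ (y - x) n < -ε * ‖y - x‖ → y ∈ Ω) ∧ (ε * ‖y - x‖ < inner ℝ (y - x) n → y ∉ Ω)

open Classical in
/-- The unit normal vector field `ν` exterior to `Ω`. -/
def outerNormal {d : ℕ} (Ω : Set (Rd d)) (x : Rd d) : Rd d :=
  if h : ∃ n, IsOuterNormal Ω x n then h.choose else 0

/-- A bounded operator `H¹(Ω) → L²(Γ)` that sends the restriction to `Ω` of each
`φ ∈ C_c^∞(ℝ^d)` to the restriction of `φ` to `Γ`. -/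
def IsTraceOperator {d : ℕ} (Ω Γ : Set (Rd d)) (T : H1 Ω →L[ℂ] L2Surf Γ) : Prop :=
  ∀ (φ : Rd d → ℂ) (u : H1 Ω), IsTestFunction univ φ →
    valH1 u =ᵐ[volume.restrict Ω] φ → T u =ᵐ[surf Γ] φ

open Classical in
/-- The trace operator `H¹(Ω) → L²(Γ)`, `Γ = ∂Ω`. -/
def trace {d : ℕ} (Ω Γ : Set (Rd d)) : H1 Ω →L[ℂ] L2Surf Γ :=
  if h : ∃ T, IsTraceOperator Ω Γ T then h.choose else 0

/-- The geometry: a bounded, open, connected region `Ω₋` with Lipschitz boundary `Γ`, which is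
partitioned in a non-empty Dirichlet part and a Neumann part. -/
structure Geometry (d : ℕ) where
  Om : Set (Rd d)
  isOpen_Om : IsOpen Om
  isConnected_Om : IsConnected Om
  isBounded_Om : Bornology.IsBounded Om
  lipschitz : HasLipschitzBoundary Om
  GD : Set (Rd d)
  GN : Set (Rd d)
  GD_subset : GD ⊆ frontier Om
  GN_subset : GN ⊆ frontier Om
  GD_open : ∃ O, IsOpen O ∧ GD = O ∩ frontier Om
  GN_open : ∃ O, IsOpen O ∧ GN = O ∩ frontier Om
  disjoint : Disjoint GD GN
  cover : frontier Om = closure GD ∪ closure GN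
  GD_nonempty : GD.Nonempty

namespace Geometry

variable {d : ℕ} (𝒢 : Geometry d)

/-- The interface `Γ = ∂Ω₋`. -/
def Γ : Set (Rd d) := frontier 𝒢.Om

/-- The exterior domain `Ω₊ = ℝ^d \ closure Ω₋`. -/
def Op : Set (Rd d) := (closure 𝒢.Om)ᶜ

theorem Om_subset : 𝒢.Om ⊆ 𝒢.Γᶜ := by
  intro x hx hΓ
  rw [Γ, 𝒢.isOpen_Om.frontier_eq] at hΓ
  exact hΓ.2 hx

theorem Op_subset : 𝒢.Op ⊆ 𝒢.Γᶜ := fun _ hx hΓ => hx (frontier_subset_closure hΓ)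

/-- The interior trace `γ : H¹(Ω₋) → L²(Γ)`. -/
def trIn : H1 𝒢.Om →L[ℂ] L2Surf 𝒢.Γ := trace 𝒢.Om 𝒢.Γ

/-- The restriction of `v ∈ H¹(ℝ^d \ Γ)` to `Ω₋`. -/
def resIn : H1 (𝒢.Γᶜ) →L[ℂ] H1 𝒢.Om := restrictH1 𝒢.Om_subset

/-- The restriction of `v ∈ H¹(ℝ^d \ Γ)` to `Ω₊`. -/
def resOut : H1 (𝒢.Γᶜ) →L[ℂ] H1 𝒢.Op := restrictH1 𝒢.Op_subset

/-- The interior trace `γ⁻ v` of `v ∈ H¹(ℝ^d \ Γ)`. -/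
def trMinus : H1 (𝒢.Γᶜ) →L[ℂ] L2Surf 𝒢.Γ := 𝒢.trIn.comp 𝒢.resIn

/-- The exterior trace `γ⁺ v` of `v ∈ H¹(ℝ^d \ Γ)`. -/
def trPlus : H1 (𝒢.Γᶜ) →L[ℂ] L2Surf 𝒢.Γ := (trace 𝒢.Op 𝒢.Γ).comp 𝒢.resOut

/-- The jump `⟦γ v⟧ = γ⁻ v - γ⁺ v`. -/
def trJump : H1 (𝒢.Γᶜ) →L[ℂ] L2Surf 𝒢.Γ := 𝒢.trMinus - 𝒢.trPlus

/-- The restriction of `G ∈ H¹(ℝ^d)` to `Ω₋`. -/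
def globIn : H1 (univ : Set (Rd d)) →L[ℂ] H1 𝒢.Om := restrictH1 (subset_univ _)

/-- The restriction of `G ∈ H¹(ℝ^d)` to `Ω₊`. -/
def globOut : H1 (univ : Set (Rd d)) →L[ℂ] H1 𝒢.Op := restrictH1 (subset_univ _)

/-- The trace on `Γ` of functions in `H¹(ℝ^d)`. -/
def trGlob : H1 (univ : Set (Rd d)) →L[ℂ] L2Surf 𝒢.Γ := 𝒢.trIn.comp 𝒢.globIn

/-- The trace space `H^{1/2}(Γ)`: traces on `Γ` of functions in `H¹(ℝ^d)`, that is `H¹(ℝ^d)`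
modulo the functions with vanishing trace, with the quotient norm
`‖g‖_{1/2} = inf {‖G‖₁ | γ G = g}`.  (Since `Γ` is Lipschitz, traces on `Γ` of functions in
`H¹(Ω₋)` or in `H¹(Ω₊)` give the same space with an equivalent norm.) -/
abbrev HHalf : Type := H1 (univ : Set (Rd d)) ⧸ (LinearMap.ker 𝒢.trGlob.toLinearMap)

instance : IsClosed ((LinearMap.ker 𝒢.trGlob.toLinearMap : Submodule ℂ _) :
    Set (H1 (univ : Set (Rd d)))) :=
  𝒢.trGlob.isClosed_ker

/-- The class in `H^{1/2}(Γ)` of the trace of `G ∈ H¹(ℝ^d)`. -/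
def mkHalf (G : H1 (univ : Set (Rd d))) : 𝒢.HHalf := Submodule.Quotient.mk G

/-- The injection `H^{1/2}(Γ) ⊆ L²(Γ)`. -/
def halfToL2 : 𝒢.HHalf →ₗ[ℂ] L2Surf 𝒢.Γ :=
  (LinearMap.ker 𝒢.trGlob.toLinearMap).liftQ 𝒢.trGlob.toLinearMap le_rfl

/-- The function `g ∈ L²(Γ)` belongs to the subset `S` of `H^{1/2}(Γ)`. -/
def MemHalf (g : L2Surf 𝒢.Γ) (S : Set 𝒢.HHalf) : Prop := ∃ q ∈ S, 𝒢.halfToL2 q = g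

/-- `H^{-1/2}(Γ)`, the dual of `H^{1/2}(Γ)` with `L²(Γ)` as pivot space. -/
abbrev HMinusHalf : Type := StrongDual ℂ 𝒢.HHalf

open Classical in
/-- The bracket `⟨ξ, g⟩_Γ` of `ξ ∈ H^{-1/2}(Γ)` and of a function `g ∈ L²(Γ)` that lies in
`H^{1/2}(Γ)` (traces `γ^± w` and jumps `⟦γ w⟧` always do). -/
def dualPair (ξ : 𝒢.HMinusHalf) (g : L2Surf 𝒢.Γ) : ℂ :=
  if h : ∃ q : 𝒢.HHalf, 𝒢.halfToL2 q = g then ξ h.choose else 0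

/-- The bracket `⟨f, g⟩_Γ = ∫_Γ f g` for functions on `Γ`. -/
def surfPair (f g : Rd d → ℂ) : ℂ := ∫ x, f x * g x ∂(surf 𝒢.Γ)

/-- The polar set `X° ⊆ H^{1/2}(Γ)` of `X ⊆ H^{-1/2}(Γ)`. -/
def polar (X : Submodule ℂ 𝒢.HMinusHalf) : Set 𝒢.HHalf := {q | ∀ ξ ∈ X, ξ q = 0}

/-- The function `γ u · ν` on `Γ`. -/
def normalTrace (u : Fin d → H1 𝒢.Om) (x : Rd d) : ℂ :=
  ∑ i, 𝒢.trIn (u i) x * (outerNormal 𝒢.Om x i : ℂ)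

/-- `ξ = ∂_ν⁻ v`: the weak interior normal derivative, given by Green's formula
`⟨∂_ν⁻ v, γ G⟩_Γ = (∇v, ∇G)_{Ω₋} + (Δv, G)_{Ω₋}`. -/
def IsNormalDerivMinus (v : H1 (𝒢.Γᶜ)) (ξ : 𝒢.HMinusHalf) : Prop :=
  ∀ G : H1 (univ : Set (Rd d)), ξ (𝒢.mkHalf G) =
    gradForm (𝒢.resIn v) (𝒢.globIn G) + ∫ x in 𝒢.Om, weakLaplacian v x * valH1 G x

/-- `ξ = ∂_ν⁺ v`: the weak exterior normal derivative; the normal vector points into `Ω₊`, so that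
`⟨∂_ν⁺ v, γ G⟩_Γ = -(∇v, ∇G)_{Ω₊} - (Δv, G)_{Ω₊}`. -/
def IsNormalDerivPlus (v : H1 (𝒢.Γᶜ)) (ξ : 𝒢.HMinusHalf) : Prop :=
  ∀ G : H1 (univ : Set (Rd d)), ξ (𝒢.mkHalf G) =
    -gradForm (𝒢.resOut v) (𝒢.globOut G) - ∫ x in 𝒢.Op, weakLaplacian v x * valH1 G x

open Classical in
/-- `∂_ν⁻ v ∈ H^{-1/2}(Γ)`, for `v ∈ H¹(ℝ^d \ Γ)` with `Δ v ∈ L²(ℝ^d \ Γ)`. -/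
def dnMinus (v : H1 (𝒢.Γᶜ)) : 𝒢.HMinusHalf :=
  if h : ∃ ξ, 𝒢.IsNormalDerivMinus v ξ then h.choose else 0

open Classical in
/-- `∂_ν⁺ v ∈ H^{-1/2}(Γ)`, for `v ∈ H¹(ℝ^d \ Γ)` with `Δ v ∈ L²(ℝ^d \ Γ)`. -/
def dnPlus (v : H1 (𝒢.Γᶜ)) : 𝒢.HMinusHalf :=
  if h : ∃ ξ, 𝒢.IsNormalDerivPlus v ξ then h.choose else 0

/-- The jump `⟦∂_ν v⟧ = ∂_ν⁻ v - ∂_ν⁺ v`. -/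
def dnJump (v : H1 (𝒢.Γᶜ)) : 𝒢.HMinusHalf := 𝒢.dnMinus v - 𝒢.dnPlus v

/-! ### Dirichlet and Neumann parts of the boundary -/

theorem surf_mono {A B : Set (Rd d)} (h : A ⊆ B) : surf A ≤ surf B :=
  Measure.restrict_mono h le_rfl

/-- `γ_D u = γ u |_{Γ_D}`. -/
def trD : H1 𝒢.Om →L[ℂ] L2Surf 𝒢.GD := (restrictLp (surf_mono 𝒢.GD_subset)).comp 𝒢.trIn

/-- `γ u |_{Γ_N}`. -/
def trN : H1 𝒢.Om →L[ℂ] L2Surf 𝒢.GN := (restrictLp (surf_mono 𝒢.GN_subset)).comp 𝒢.trIn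

/-- `H¹_D(Ω₋) = {u ∈ H¹(Ω₋) | γ_D u = 0}`. -/
def H1D : Submodule ℂ (H1 𝒢.Om) := LinearMap.ker 𝒢.trD.toLinearMap

/-- The map `H¹_D(Ω₋) → L²(Γ_N)`, `u ↦ γ u |_{Γ_N}`. -/
def trND : 𝒢.H1D →L[ℂ] L2Surf 𝒢.GN := 𝒢.trN.comp 𝒢.H1D.subtypeL

/-- `H̃^{1/2}(Γ_N) = {γ u |_{Γ_N} | u ∈ H¹_D(Ω₋)}`, with the quotient norm. -/
abbrev HTilde : Type := 𝒢.H1D ⧸ (LinearMap.ker 𝒢.trND.toLinearMap)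

instance : IsClosed ((LinearMap.ker 𝒢.trND.toLinearMap : Submodule ℂ _) : Set 𝒢.H1D) :=
  𝒢.trND.isClosed_ker

/-- `H^{-1/2}(Γ_N)`, the dual of `H̃^{1/2}(Γ_N)`. -/
abbrev HMinusHalfN : Type := StrongDual ℂ 𝒢.HTilde

/-- `⟨η, γ φ⟩_{Γ_N}` for `η ∈ H^{-1/2}(Γ_N)` and `φ ∈ H¹_D(Ω₋)`. -/
def pairN (η : 𝒢.HMinusHalfN) (φ : 𝒢.H1D) : ℂ := η (Submodule.Quotient.mk φ)

end Geometry

/-! ## The piezoelectric material -/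

/-- The elastic, piezoelectric and dielectric tensors and the density of the solid. -/
structure Material {d : ℕ} (Ω : Set (Rd d)) where
  /-- `C_{ijkl}(x)` -/
  C : Fin d → Fin d → Fin d → Fin d → Rd d → ℝ
  /-- `e_{kij}(x)` -/
  e : Fin d → Fin d → Fin d → Rd d → ℝ
  /-- `ϵ_{ij}(x)` -/
  eps : Fin d → Fin d → Rd d → ℝ
  /-- `ρ_Σ(x)` -/
  rho : Rd d → ℝ
  C_bdd : ∀ i j k l, MemLp (C i j k l) ∞ (volume.restrict Ω)
  e_bdd : ∀ k i j, MemLp (e k i j) ∞ (volume.restrict Ω)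
  eps_bdd : ∀ i j, MemLp (eps i j) ∞ (volume.restrict Ω)
  rho_bdd : MemLp rho ∞ (volume.restrict Ω)
  C_symm : ∀ᵐ x ∂(volume.restrict Ω), ∀ i j k l,
    C i j k l x = C j i k l x ∧ C i j k l x = C k l i j x
  e_symm : ∀ᵐ x ∂(volume.restrict Ω), ∀ l i j, e l i j x = e l j i x
  eps_symm : ∀ᵐ x ∂(volume.restrict Ω), ∀ i l, eps i l x = eps l i x
  C_pos : ∃ c₀ > 0, ∀ᵐ x ∂(volume.restrict Ω), ∀ M : Fin d → Fin d → ℝ,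
    (∀ i j, M i j = M j i) →
      c₀ * ∑ i, ∑ j, M i j ^ 2 ≤ ∑ i, ∑ j, ∑ k, ∑ l, C i j k l x * M k l * M i j
  eps_pos : ∃ d₀ > 0, ∀ᵐ x ∂(volume.restrict Ω), ∀ q : Fin d → ℝ,
    d₀ * ∑ i, q i ^ 2 ≤ ∑ i, ∑ j, eps i j x * q j * q i
  rho_pos : ∀ᵐ x ∂(volume.restrict Ω), 0 < rho x

/-- The linear strain `ε(u)_{ij} = (∂_j u_i + ∂_i u_j) / 2`. -/
def strain {d : ℕ} {Ω : Set (Rd d)} (u : Fin d → H1 Ω) (i j : Fin d) (x : Rd d) : ℂ :=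
  (gradH1 (u i) j x + gradH1 (u j) i x) / 2

namespace Material

variable {d : ℕ} {Ω : Set (Rd d)} (P : Material Ω)

/-- `(C ε(u), ε(w))_Ω`. -/
def elasticForm (u w : Fin d → H1 Ω) : ℂ :=
  ∫ x in Ω, ∑ i, ∑ j, (∑ k, ∑ l, (P.C i j k l x : ℂ) * strain u k l x) * strain w i j x

/-- `(ρ_Σ u, w)_Ω`. -/
def densityForm (u w : Fin d → H1 Ω) : ℂ :=
  ∫ x in Ω, ∑ i, (P.rho x : ℂ) * valH1 (u i) x * valH1 (w i) x

/-- `(e ∇ψ, ε(w))_Ω`. -/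
def piezoForm (ψ : H1 Ω) (w : Fin d → H1 Ω) : ℂ :=
  ∫ x in Ω, ∑ i, ∑ j, (∑ k, (P.e k i j x : ℂ) * gradH1 ψ k x) * strain w i j x

/-- `(ϵ ∇ψ, ∇φ)_Ω`. -/
def dielectricForm (ψ φ : H1 Ω) : ℂ :=
  ∫ x in Ω, ∑ i, (∑ j, (P.eps i j x : ℂ) * gradH1 ψ j x) * gradH1 φ i x

/-- The elastodynamic form `b(u, w; s)`. -/
def b (s : ℂ) (u w : Fin d → H1 Ω) : ℂ := P.elasticForm u w + s ^ 2 * P.densityForm u w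

/-- The coupled elastic-electric form `ℬ((u, ψ), (w, φ); s)`. -/
def B (s : ℂ) (u : Fin d → H1 Ω) (ψ : H1 Ω) (w : Fin d → H1 Ω) (φ : H1 Ω) : ℂ :=
  P.b s u w + P.piezoForm ψ w - P.piezoForm φ u + P.dielectricForm ψ φ

end Material

/-! ## The two problems -/

/-- The spaces `𝐕_h ⊆ 𝐇¹(Ω₋)`, `V_h ⊆ H¹(Ω₋)`, `X_h ⊆ H^{-1/2}(Γ)`, `Y_h ⊆ H^{1/2}(Γ)`: closed
subspaces, in particular any finite dimensional ones. -/
structure DiscreteSpaces {d : ℕ} (𝒢 : Geometry d) where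
  Vvec : Submodule ℂ (Fin d → H1 𝒢.Om)
  V : Submodule ℂ (H1 𝒢.Om)
  X : Submodule ℂ 𝒢.HMinusHalf
  Y : Submodule ℂ 𝒢.HHalf
  isClosed_Vvec : IsClosed (Vvec : Set (Fin d → H1 𝒢.Om))
  isClosed_V : IsClosed (V : Set (H1 𝒢.Om))
  isClosed_X : IsClosed (X : Set 𝒢.HMinusHalf)
  isClosed_Y : IsClosed (Y : Set 𝒢.HHalf)

/-- `V_{h,D} = V_h ∩ H¹_D(Ω₋)`, as a subspace of `H¹_D(Ω₋)`. -/
def DiscreteSpaces.VD {d : ℕ} {𝒢 : Geometry d} (𝒟 : DiscreteSpaces 𝒢) : Submodule ℂ 𝒢.H1D :=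
  𝒟.V.comap 𝒢.H1D.subtype

/-- `V_h^* = {w ∈ H¹(ℝ^d \ Γ) | ⟦γ w⟧ ∈ Y_h, γ⁻ w ∈ X_h°}`. -/
def DiscreteSpaces.VStar {d : ℕ} {𝒢 : Geometry d} (𝒟 : DiscreteSpaces 𝒢) : Set (H1 (𝒢.Γᶜ)) :=
  {w | 𝒢.MemHalf (𝒢.trJump w) 𝒟.Y ∧ 𝒢.MemHalf (𝒢.trMinus w) (𝒢.polar 𝒟.X)}

/-- The problem data. -/
structure Data {d : ℕ} {𝒢 : Geometry d} (𝒟 : DiscreteSpaces 𝒢) where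
  α : 𝒢.HMinusHalf
  β : 𝒢.HHalf
  η : 𝒢.HMinusHalfN
  /-- Dirichlet datum `μ_d^h ∈ γ_D V_h` -/
  μ : L2Surf 𝒢.GD
  μ_mem : ∃ ψ ∈ 𝒟.V, 𝒢.trD ψ = μ
  /-- `𝛉_d ∈ 𝐇¹(Ω₋)` -/
  Θ : Fin d → H1 𝒢.Om
  /-- `θ_d ∈ L²(Γ)` -/
  θ : L2Surf 𝒢.Γ
  lam : 𝒢.HMinusHalf
  ϕ : 𝒢.HHalf

variable {d : ℕ} {𝒢 : Geometry d}

/-- The transmission problem, for `(v, u, ψ) ∈ H¹(ℝ^d \ Γ) × 𝐕_h × V_h`. -/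
structure IsTransmissionSolution (P : Material 𝒢.Om) (𝒟 : DiscreteSpaces 𝒢) (D : Data 𝒟)
    (c ρf : ℝ) (s : ℂ) (v : H1 (𝒢.Γᶜ)) (u : Fin d → H1 𝒢.Om) (ψ : H1 𝒢.Om) : Prop where
  u_mem : u ∈ 𝒟.Vvec
  ψ_mem : ψ ∈ 𝒟.V
  /-- `-Δ v + (s/c)² v = 0` in `ℝ^d \ Γ` -/
  helmholtz : HasWeakLaplacian v ((s / c) ^ 2 • valH1 v)
  /-- `γ_D ψ = μ_d^h` -/
  dirichlet : 𝒢.trD ψ = D.μ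
  /-- the Galerkin equations in the solid -/
  solid : ∀ w ∈ 𝒟.Vvec, ∀ φ ∈ 𝒟.VD,
    P.B s u ψ w (φ : H1 𝒢.Om) - ρf * s * 𝒢.surfPair (𝒢.trJump v) (𝒢.normalTrace w) =
      -(ρf * s * 𝒢.surfPair (𝒢.halfToL2 D.β) (𝒢.normalTrace w)) + 𝒢.pairN D.η φ
        + s ^ 2 * P.densityForm D.Θ w
  /-- `-γ⁻ v ∈ X_h°` -/
  polar_X : 𝒢.MemHalf (-𝒢.trMinus v) (𝒢.polar 𝒟.X)
  /-- `-s γu·ν - ∂_ν⁺ v - (α_d + s θ_d) ∈ Y_h°` -/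
  polar_Y : ∀ χ ∈ 𝒟.Y,
    -(s * 𝒢.surfPair (𝒢.normalTrace u) (𝒢.halfToL2 χ)) - 𝒢.dnPlus v χ
      - (D.α χ + s * 𝒢.surfPair D.θ (𝒢.halfToL2 χ)) = 0
  /-- `⟦∂_ν v⟧ + λ_d ∈ X_h` -/
  jump_dn : 𝒢.dnJump v + D.lam ∈ 𝒟.X
  /-- `⟦γ v⟧ + φ_d ∈ Y_h` -/
  jump_tr : 𝒢.MemHalf (𝒢.trJump v + 𝒢.halfToL2 D.ϕ) 𝒟.Y

/-- The bilinear form `𝒜((v, u, ψ), (w, 𝐰, φ); s)`. -/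
def formA (P : Material 𝒢.Om) (c ρf : ℝ) (s : ℂ)
    (v : H1 (𝒢.Γᶜ)) (u : Fin d → H1 𝒢.Om) (ψ : H1 𝒢.Om)
    (w : H1 (𝒢.Γᶜ)) (ww : Fin d → H1 𝒢.Om) (φ : H1 𝒢.Om) : ℂ :=
  ρf * gradForm v w + ρf * (s / c) ^ 2 * massForm (valH1 v) (valH1 w) + P.B s u ψ ww φ
    + ρf * s * 𝒢.surfPair (𝒢.normalTrace u) (𝒢.trJump w)
    - ρf * s * 𝒢.surfPair (𝒢.trJump v) (𝒢.normalTrace ww)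

/-- The linear form `ℓ((w, 𝐰, φ); s)`. -/
def formL (P : Material 𝒢.Om) {𝒟 : DiscreteSpaces 𝒢} (D : Data 𝒟) (ρf : ℝ) (s : ℂ)
    (w : H1 (𝒢.Γᶜ)) (ww : Fin d → H1 𝒢.Om) (φ : 𝒢.H1D) : ℂ :=
  -(ρf * 𝒢.dualPair D.lam (𝒢.trMinus w))
    - ρf * (𝒢.dualPair D.α (𝒢.trJump w) + s * 𝒢.surfPair D.θ (𝒢.trJump w))
    + s ^ 2 * P.densityForm D.Θ ww
    - ρf * s * 𝒢.surfPair (𝒢.halfToL2 D.β) (𝒢.normalTrace ww)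
    + 𝒢.pairN D.η φ

/-- The variational problem, for `(v, u, ψ) ∈ H¹(ℝ^d \ Γ) × 𝐕_h × V_h`. -/
structure IsVariationalSolution (P : Material 𝒢.Om) (𝒟 : DiscreteSpaces 𝒢) (D : Data 𝒟)
    (c ρf : ℝ) (s : ℂ) (v : H1 (𝒢.Γᶜ)) (u : Fin d → H1 𝒢.Om) (ψ : H1 𝒢.Om) : Prop where
  u_mem : u ∈ 𝒟.Vvec
  ψ_mem : ψ ∈ 𝒟.V
  /-- `γ_D ψ = μ_d^h` -/
  dirichlet : 𝒢.trD ψ = D.μ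
  /-- `⟦γ v⟧ + φ_d ∈ Y_h` -/
  jump_tr : 𝒢.MemHalf (𝒢.trJump v + 𝒢.halfToL2 D.ϕ) 𝒟.Y
  /-- `γ⁻ v ∈ X_h°` -/
  polar_X : 𝒢.MemHalf (𝒢.trMinus v) (𝒢.polar 𝒟.X)
  /-- `𝒜 = ℓ` on `V_h^* × 𝐕_h × V_{h,D}` -/
  equation : ∀ w ∈ 𝒟.VStar, ∀ ww ∈ 𝒟.Vvec, ∀ φ ∈ 𝒟.VD,
    formA P c ρf s v u ψ w ww (φ : H1 𝒢.Om) = formL P D ρf s w ww φ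

end

end PiezoScattering

open MeasureTheory Set Topology
open scoped ENNReal NNReal ContDiff

namespace PiezoScattering

noncomputable section

/-! ## Square-integral estimates and mollification in `L²` -/

/-! The equivalence rests on Green's formula across the interface (`Geometry.green_formula`): if `Δ
v = f` in `ℝ^d \ Γ`, then `(∇v, ∇w) + (f, w) = ⟨⟦∂_ν v⟧, γ⁻w⟩ + ⟨∂_ν⁺ v, ⟦γw⟧⟩` whenever `γ⁻w` and
`⟦γw⟧` lie in `H^{1/2}(Γ)`. The boundary terms are thus sorted by the two quantities that the space
`V_h^*` constrains. With `f = (s/c)² v` and `w ∈ V_h^*`, the term in `γ⁻w ∈ X_h°` does not see `⟦∂_ν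
v⟧ + λ_d ∈ X_h`, and the term in `⟦γw⟧ ∈ Y_h` is given by the polar condition on `Y_h`. Adding the
Galerkin equations of the solid yields `𝒜 = ℓ`.

Conversely, the variational equation is taken apart by four families of tests: `w = 0` gives the
solid equations; `w ∈ C_c^∞(ℝ^d \ Γ)` has no traces and gives the Helmholtz equation; `w` vanishing
in `Ω₋` with prescribed jump in `Y_h` gives the polar condition on `Y_h`; and restrictions to `ℝ^d \
Γ` of functions in `H¹(ℝ^d)` with trace in `X_h°` show that `⟦∂_ν v⟧ + λ_d` annihilates `X_h°`. The
last fact gives membership in `X_h` because `X_h` is closed and `H^{1/2}(Γ)` is a quotient of a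
Hilbert space (`mem_of_forall_annihilator`).

The analytic content lies in the traces and normal derivatives, which are defined by choice with
default value zero, so their existence has to be proved. A weak normal derivative exists because
Green's functional `z ↦ (∇v, ∇z) + (Δv, z)` on one side of `Γ` vanishes on functions with zero
trace, and this holds because such functions are limits of test functions supported in that side
(`IsLipschitzPair.mem_closure_of_trace_eq_zero`). Three ingredients lead there. Restrictions of
`C_c^∞(ℝ^d)` are dense in `H¹`, by mollifying after a small shift into the domain. Integration along
vertical segments over the Lipschitz graph gives the trace inequality, and also shows that a
function of zero trace has squared `L²` norm of order `ε²` times that of its gradient in a boundary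
layer of width `ε`. That factor absorbs the squared gradient, of order `ε⁻²`, of a cutoff near `Γ`.

No extension theorem from `H¹(Ω₋)` to `H¹(ℝ^d)` is needed: membership in `Y_h` and `X_h°` already
provides lifts to `H¹(ℝ^d)`. It suffices to know that the traces of such a lift from the two sides
coincide (`Geometry.trace_globOut`). -/

theorem sq_lintegral_mul_le {α : Type*} [MeasurableSpace α] (μ : Measure α) {f g : α → ℝ≥0∞}
    (hf : AEMeasurable f μ) (hg : AEMeasurable g μ) :
    (∫⁻ a, f a * g a ∂μ) ^ 2 ≤ (∫⁻ a, f a ^ 2 ∂μ) * ∫⁻ a, g a ^ 2 ∂μ := by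
  have h := ENNReal.lintegral_mul_le_Lp_mul_Lq μ Real.HolderConjugate.two_two hf hg
  have h2 := ENNReal.rpow_le_rpow h (z := 2) (by norm_num)
  rw [ENNReal.mul_rpow_of_nonneg _ _ (by norm_num), ← ENNReal.rpow_mul, ← ENNReal.rpow_mul] at h2
  norm_num at h2
  simpa using h2

theorem enorm_add_sq_le (a b : ℂ) : ‖a + b‖ₑ ^ 2 ≤ 2 * ‖a‖ₑ ^ 2 + 2 * ‖b‖ₑ ^ 2 := by
  have h := ENNReal.rpow_add_le_mul_rpow_add_rpow ‖a‖ₑ ‖b‖ₑ (p := 2) (by norm_num)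
  have h3 : (2 : ℝ≥0∞) ^ ((2 : ℝ) - 1) = 2 := by norm_num
  rw [h3, mul_add] at h
  calc ‖a + b‖ₑ ^ 2 ≤ (‖a‖ₑ + ‖b‖ₑ) ^ 2 := by gcongr; exact enorm_add_le a b
    _ ≤ _ := by exact_mod_cast h

theorem lintegral_enorm_sq_eq {α : Type*} [MeasurableSpace α] {μ : Measure α} (f : Lp ℂ 2 μ) :
    ∫⁻ x, ‖f x‖ₑ ^ 2 ∂μ = ‖f‖ₑ ^ 2 := by
  rw [Lp.enorm_def, eLpNorm_eq_lintegral_rpow_enorm_toReal (by norm_num) (by norm_num)]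
  simp only [ENNReal.toReal_ofNat]
  rw [← ENNReal.rpow_natCast, ← ENNReal.rpow_mul]
  norm_num

theorem eLpNorm_two_sq {α : Type*} [MeasurableSpace α] {μ : Measure α} (f : α → ℂ) :
    eLpNorm f 2 μ ^ 2 = ∫⁻ x, ‖f x‖ₑ ^ 2 ∂μ := by
  rw [eLpNorm_eq_lintegral_rpow_enorm_toReal (by norm_num) (by norm_num)]
  simp only [ENNReal.toReal_ofNat]
  rw [← ENNReal.rpow_natCast, ← ENNReal.rpow_mul]
  norm_num

theorem memLp_two_of_lintegral {α : Type*} [MeasurableSpace α] {μ : Measure α} {f : α → ℂ}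
    (hf : AEStronglyMeasurable f μ) (h : ∫⁻ x, ‖f x‖ₑ ^ 2 ∂μ < ⊤) : MemLp f 2 μ := by
  refine ⟨hf, ?_⟩
  rw [← eLpNorm_two_sq] at h
  by_contra hc
  rw [not_lt, top_le_iff] at hc
  rw [hc] at h
  simp at h

/-- Translations are continuous in `L²`. -/
theorem exists_lintegral_translate_sub_le {d : ℕ} {f : Rd d → ℂ} (hf : MemLp f 2 volume)
    {ε : ℝ≥0∞} (hε : ε ≠ 0) :
    ∃ δ > 0, ∀ y : Rd d, ‖y‖ < δ → ∫⁻ x, ‖f (x - y) - f x‖ₑ ^ 2 ≤ ε := by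
  -- Translations form a continuous family of measure-preserving maps, and composition with such a
  -- family is continuous in `L²`.
  let G : C(Rd d, C(Rd d, Rd d)) :=
    (ContinuousMap.mk (fun p : Rd d × Rd d => p.2 - p.1) (by fun_prop)).curry
  have hmp : ∀ y : Rd d, MeasurePreserving (G y) (volume : Measure (Rd d)) volume :=
    fun y => measurePreserving_sub_right volume y
  have hc : Continuous fun y => Lp.compMeasurePreserving (G y) (hmp y) (hf.toLp f) :=
    Continuous.compMeasurePreservingLp continuous_const G.continuous hmp (by norm_num)
  have h0 : Lp.compMeasurePreserving (G 0) (hmp 0) (hf.toLp f) = hf.toLp f := by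
    rw [Lp.toLp_compMeasurePreserving]
    refine MemLp.toLp_congr _ _ (Filter.Eventually.of_forall fun x => ?_)
    simp [G]
  have hc2 : Continuous fun y =>
      ‖Lp.compMeasurePreserving (G y) (hmp y) (hf.toLp f) - hf.toLp f‖ₑ ^ 2 := by fun_prop
  have hev : ∀ᶠ y in 𝓝 (0 : Rd d),
      ‖Lp.compMeasurePreserving (G y) (hmp y) (hf.toLp f) - hf.toLp f‖ₑ ^ 2 < ε := by
    refine hc2.continuousAt.eventually (p := fun t => t < ε) ?_
    simp only [h0, sub_self, enorm_zero]
    exact Iio_mem_nhds (by simpa using pos_iff_ne_zero.mpr hε)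
  obtain ⟨δ, hδ, h⟩ := Metric.eventually_nhds_iff.mp hev
  refine ⟨δ, hδ, fun y hy => ?_⟩
  refine le_trans (le_of_eq ?_) (h (y := y) (by simpa using hy)).le
  rw [← lintegral_enorm_sq_eq, Lp.toLp_compMeasurePreserving, ← MemLp.toLp_sub]
  refine lintegral_congr_ae ?_
  filter_upwards [MemLp.coeFn_toLp ((hf.comp_measurePreserving (hmp y)).sub hf)] with x hx
  rw [hx]
  rfl

/-- A mollifying kernel: smooth, non-negative, of integral one, supported in a small ball. -/
structure IsKernel {d : ℕ} (κ : Rd d → ℝ) (δ : ℝ) : Prop where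
  smooth : ContDiff ℝ ∞ κ
  compact : HasCompactSupport κ
  nonneg : ∀ y, 0 ≤ κ y
  integral : ∫ y, κ y = 1
  small : ∀ y, κ y ≠ 0 → ‖y‖ < δ

/-- The convolution `κ ⋆ f` for scalar kernels. -/
def moll {d : ℕ} (κ : Rd d → ℝ) (f : Rd d → ℂ) (x : Rd d) : ℂ := ∫ y, (κ y : ℂ) * f (x - y)

theorem IsKernel.lintegral {d : ℕ} {κ : Rd d → ℝ} {δ : ℝ} (h : IsKernel κ δ) :
    ∫⁻ y, ‖κ y‖ₑ = 1 := by
  have h1 : Integrable κ := h.smooth.continuous.integrable_of_hasCompactSupport h.compact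
  have h2 := ofReal_integral_eq_lintegral_ofReal h1 (Filter.Eventually.of_forall h.nonneg)
  rw [h.integral, ENNReal.ofReal_one] at h2
  rw [h2]
  refine lintegral_congr fun y => ?_
  rw [Real.enorm_eq_ofReal (h.nonneg y)]

theorem IsKernel.integrable_mul {d : ℕ} {κ : Rd d → ℝ} {δ : ℝ} (h : IsKernel κ δ) {f : Rd d → ℂ}
    (hf : LocallyIntegrable f volume) (x : Rd d) :
    Integrable fun y => (κ y : ℂ) * f (x - y) :=
  h.compact.convolutionExists_left (ContinuousLinearMap.lsmul ℝ ℝ) h.smooth.continuous hf x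

/-- Jensen's inequality for the probability density `κ` bounds `|κ ⋆ f - f|²` at `x` by the
`κ`-average of `|f(x - y) - f(x)|²`. After Tonelli, only translations by `‖y‖ < δ` contribute. -/
theorem IsKernel.lintegral_moll_sub_le {d : ℕ} {κ : Rd d → ℝ} {δ : ℝ} (h : IsKernel κ δ)
    {f : Rd d → ℂ} (hf : MemLp f 2 volume) {ε : ℝ≥0∞}
    (hδ : ∀ y : Rd d, ‖y‖ < δ → ∫⁻ x, ‖f (x - y) - f x‖ₑ ^ 2 ≤ ε) :
    ∫⁻ x, ‖moll κ f x - f x‖ₑ ^ 2 ≤ ε := by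
  have hloc : LocallyIntegrable f volume := hf.locallyIntegrable (by norm_num)
  have hκi : Integrable κ := h.smooth.continuous.integrable_of_hasCompactSupport h.compact
  have hm : ∀ x, moll κ f x - f x = ∫ y, (κ y : ℂ) * (f (x - y) - f x) := by
    intro x
    simp only [mul_sub]
    have hκc : Integrable (fun y => (κ y : ℂ)) := hκi.ofReal
    rw [integral_sub (h.integrable_mul hloc x) (hκc.mul_const (f x)), integral_mul_const,
      integral_complex_ofReal, h.integral]
    simp [moll]
  have hmeas2 : AEStronglyMeasurable (fun p : Rd d × Rd d => f (p.1 - p.2) - f p.1)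
      (volume.prod volume) := by
    refine AEStronglyMeasurable.sub ?_ hf.1.comp_fst
    have := hf.1.comp_quasiMeasurePreserving
      (quasiMeasurePreserving_sub (volume : Measure (Rd d)) volume)
    exact this
  have hκm : Measurable fun y => ‖κ y‖ₑ := h.smooth.continuous.measurable.enorm
  have hjen : ∀ᵐ x, ‖moll κ f x - f x‖ₑ ^ 2 ≤ ∫⁻ y, ‖κ y‖ₑ * ‖f (x - y) - f x‖ₑ ^ 2 := by
    filter_upwards [hmeas2.prodMk_left] with x hx
    rw [hm x]
    have hxm : AEMeasurable (fun y => ‖f (x - y) - f x‖ₑ) := hx.enorm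
    -- Writing `κ = κ^{1/2} κ^{1/2}` turns Jensen's inequality into Cauchy–Schwarz, since `∫ κ = 1`.
    have e1 : ‖∫ y, (κ y : ℂ) * (f (x - y) - f x)‖ₑ
        ≤ ∫⁻ y, ‖κ y‖ₑ ^ (1/2 : ℝ) * (‖κ y‖ₑ ^ (1/2 : ℝ) * ‖f (x - y) - f x‖ₑ) := by
      refine (enorm_integral_le_lintegral_enorm _).trans (le_of_eq (lintegral_congr fun y => ?_))
      rw [enorm_mul, ← mul_assoc, ← ENNReal.rpow_add_of_nonneg _ _ (by norm_num) (by norm_num)]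
      have : ‖(κ y : ℂ)‖ₑ = ‖κ y‖ₑ := by
        rw [← ofReal_norm, ← ofReal_norm, Complex.norm_real]
      norm_num [this]
    have hsq : ∀ y, (‖κ y‖ₑ ^ (1/2 : ℝ)) ^ 2 = ‖κ y‖ₑ := by
      intro y
      rw [← ENNReal.rpow_natCast, ← ENNReal.rpow_mul]; norm_num
    calc _ ≤ (∫⁻ y, ‖κ y‖ₑ ^ (1/2 : ℝ) * (‖κ y‖ₑ ^ (1/2 : ℝ) * ‖f (x - y) - f x‖ₑ)) ^ 2 := by
          gcongr
      _ ≤ _ := sq_lintegral_mul_le _ (hκm.pow_const _).aemeasurable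
            ((hκm.pow_const _).aemeasurable.mul hxm)
      _ = ∫⁻ y, ‖κ y‖ₑ * ‖f (x - y) - f x‖ₑ ^ 2 := by
          simp only [mul_pow, hsq, h.lintegral, one_mul]
  calc ∫⁻ x, ‖moll κ f x - f x‖ₑ ^ 2
      ≤ ∫⁻ x, ∫⁻ y, ‖κ y‖ₑ * ‖f (x - y) - f x‖ₑ ^ 2 := lintegral_mono_ae hjen
    _ = ∫⁻ y, ∫⁻ x, ‖κ y‖ₑ * ‖f (x - y) - f x‖ₑ ^ 2 := by
        refine lintegral_lintegral_swap ?_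
        exact (hκm.comp measurable_snd).aemeasurable.mul (hmeas2.enorm.pow_const 2)
    _ ≤ ∫⁻ y, ‖κ y‖ₑ * ε := by
        refine lintegral_mono fun y => ?_
        rw [lintegral_const_mul' _ _ (by simp)]
        by_cases hy : κ y = 0
        · simp [hy]
        · gcongr
          exact hδ y (h.small y hy)
    _ = ε := by rw [lintegral_mul_const _ hκm, h.lintegral, one_mul]

/-- The radius `δ` is chosen before the kernel, so kernels concentrated away from the origin are
allowed; this is what permits mollification combined with a shift. -/
theorem exists_forall_kernel_lintegral_moll_sub_le {d : ℕ} {f : Rd d → ℂ} (hf : MemLp f 2 volume)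
    {ε : ℝ≥0∞} (hε : ε ≠ 0) :
    ∃ δ > 0, ∀ κ : Rd d → ℝ, IsKernel κ δ → ∫⁻ x, ‖moll κ f x - f x‖ₑ ^ 2 ≤ ε := by
  obtain ⟨δ, hδ, h⟩ := exists_lintegral_translate_sub_le hf hε
  exact ⟨δ, hδ, fun κ hκ => hκ.lintegral_moll_sub_le hf h⟩

/-- The centre `a` need not be the origin: convolution with this kernel averages over a small ball
around `x - a`. -/
theorem exists_isKernel {d : ℕ} (a : Rd d) {r : ℝ} (hr : 0 < r) :
    ∃ κ : Rd d → ℝ, IsKernel κ (‖a‖ + r) ∧ ∀ y, κ y ≠ 0 → dist y a < r := by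
  let b : ContDiffBump a := ⟨r / 2, r, by positivity, by linarith⟩
  have hs : ∀ y, b.normed volume y ≠ 0 → dist y a < r := by
    intro y hy
    have : y ∈ Function.support (b.normed volume) := hy
    rw [b.support_normed_eq] at this
    exact this
  refine ⟨b.normed volume, ⟨?_, b.hasCompactSupport_normed, b.nonneg_normed, b.integral_normed,
    fun y hy => ?_⟩, hs⟩
  · exact b.contDiff_normed (n := ⊤)
  · have h1 := hs y hy
    calc ‖y‖ = ‖a + (y - a)‖ := by simp
      _ ≤ ‖a‖ + ‖y - a‖ := norm_add_le _ _
      _ < _ := by rw [dist_eq_norm] at h1; linarith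

theorem IsKernel.contDiff_moll {d : ℕ} {κ : Rd d → ℝ} {δ : ℝ} (h : IsKernel κ δ) {f : Rd d → ℂ}
    (hf : LocallyIntegrable f volume) : ContDiff ℝ ∞ (moll κ f) :=
  h.compact.contDiff_convolution_left (n := ⊤) (ContinuousLinearMap.lsmul ℝ ℝ) h.smooth hf

theorem IsKernel.hasCompactSupport_moll {d : ℕ} {κ : Rd d → ℝ} {δ : ℝ} (h : IsKernel κ δ)
    {f : Rd d → ℂ} (hf : HasCompactSupport f) : HasCompactSupport (moll κ f) :=
  HasCompactSupport.convolution (ContinuousLinearMap.lsmul ℝ ℝ) h.compact hf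

/-- The derivative of a mollified function falls on the kernel. -/
theorem IsKernel.pderiv_moll {d : ℕ} {κ : Rd d → ℝ} {δ : ℝ} (h : IsKernel κ δ) {f : Rd d → ℂ}
    (hf : LocallyIntegrable f volume) (i : Fin d) (x : Rd d) :
    pderiv (moll κ f) i x =
      ∫ y, ((fderiv ℝ κ (x - y) (EuclideanSpace.single i 1) : ℝ) : ℂ) * f y := by
  have hd := h.compact.hasFDerivAt_convolution_left (ContinuousLinearMap.lsmul ℝ ℝ (E := ℂ))
    (μ := volume) (h.smooth.of_le (by simp)) hf x
  have e : pderiv (moll κ f) i x = _ := congrArg (· (EuclideanSpace.single i 1)) hd.fderiv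
  rw [e, convolution_eq_swap, ContinuousLinearMap.integral_apply]
  · rfl
  · have := (h.compact.fderiv (𝕜 := ℝ)).convolutionExists_left
      ((ContinuousLinearMap.lsmul ℝ ℝ (E := ℂ)).precompL (Rd d))
      (h.smooth.continuous_fderiv (by simp)) hf x
    exact this.integrable_swap

theorem moll_eq_swap {d : ℕ} (κ : Rd d → ℝ) (f : Rd d → ℂ) (x : Rd d) :
    moll κ f x = ∫ y, (κ (x - y) : ℂ) * f y := by
  rw [moll, ← integral_sub_left_eq_self _ volume x]
  simp

/-! ## Bilinear `L²` brackets -/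

/-- The bounded functional `f ↦ ∫ f ζ` on `L²(μ)`. -/
def pairL2 {α : Type*} [MeasurableSpace α] {μ : Measure α} (ζ : α → ℂ) (hζ : MemLp ζ 2 μ) :
    Lp ℂ 2 μ →L[ℂ] ℂ :=
  -- The inner product conjugates its first argument; the extra conjugation makes the bracket
  -- bilinear.
  innerSL ℂ (hζ.star.toLp (star ζ))

theorem pairL2_apply {α : Type*} [MeasurableSpace α] {μ : Measure α} (ζ : α → ℂ)
    (hζ : MemLp ζ 2 μ) (f : Lp ℂ 2 μ) : pairL2 ζ hζ f = ∫ x, f x * ζ x ∂μ := by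
  rw [pairL2, innerSL_apply_apply, L2.inner_def]
  refine integral_congr_ae ?_
  filter_upwards [hζ.star.coeFn_toLp] with x hx
  rw [hx]
  simp

theorem continuous_integral_mul {α : Type*} [MeasurableSpace α] {μ : Measure α} {ζ : α → ℂ}
    (hζ : MemLp ζ 2 μ) : Continuous fun f : Lp ℂ 2 μ => ∫ x, f x * ζ x ∂μ := by
  simp only [← pairL2_apply ζ hζ]
  exact (pairL2 ζ hζ).continuous

/-! ## Smooth multipliers -/

theorem pderiv_mul {d : ℕ} {f g : Rd d → ℂ} (hf : ContDiff ℝ ∞ f) (hg : ContDiff ℝ ∞ g)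
    (i : Fin d) (x : Rd d) : pderiv (fun y => f y * g y) i x = f x * pderiv g i x + pderiv f i x * g x := by
  have h := ((hf.differentiable (by simp) x).hasFDerivAt.mul
    (hg.differentiable (by simp) x).hasFDerivAt).fderiv
  have e : pderiv (fun y => f y * g y) i x = _ := congrArg (· (EuclideanSpace.single i 1)) h
  rw [e]
  simp [pderiv, mul_comm]

theorem IsTestFunction.mono {d : ℕ} {U V : Set (Rd d)} {η : Rd d → ℂ} (h : IsTestFunction U η)
    (hUV : U ⊆ V) : IsTestFunction V η :=
  ⟨h.smooth, h.compact, h.support.trans hUV⟩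

theorem IsTestFunction.smooth_mul {d : ℕ} {U : Set (Rd d)} {η m : Rd d → ℂ}
    (h : IsTestFunction U η) (hm : ContDiff ℝ ∞ m) : IsTestFunction U fun x => m x * η x :=
  ⟨hm.mul h.smooth, h.compact.mul_left, (tsupport_mul_subset_right).trans h.support⟩

theorem continuous_pderiv {d : ℕ} {f : Rd d → ℂ} (hf : ContDiff ℝ ∞ f) (i : Fin d) :
    Continuous (pderiv f i) :=
  (hf.continuous_fderiv (by simp)).clm_apply continuous_const

theorem norm_pderiv_le {d : ℕ} (f : Rd d → ℂ) (i : Fin d) (x : Rd d) :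
    ‖pderiv f i x‖ ≤ ‖fderiv ℝ f x‖ := by
  refine ((fderiv ℝ f x).le_opNorm _).trans ?_
  simp

/-- A smooth bounded function with bounded first derivatives. -/
structure IsMultiplier {d : ℕ} (m : Rd d → ℂ) : Prop where
  smooth : ContDiff ℝ ∞ m
  bdd : ∃ C, ∀ x, ‖m x‖ ≤ C
  bdd_pderiv : ∃ C, ∀ i x, ‖pderiv m i x‖ ≤ C

theorem IsTestFunction.isMultiplier {d : ℕ} {U : Set (Rd d)} {η : Rd d → ℂ}
    (h : IsTestFunction U η) : IsMultiplier η := by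
  refine ⟨h.smooth, h.compact.exists_bound_of_continuous h.smooth.continuous, ?_⟩
  obtain ⟨C, hC⟩ := (h.compact.fderiv ℝ).exists_bound_of_continuous
    (h.smooth.continuous_fderiv (by simp))
  exact ⟨C, fun i x => (norm_pderiv_le η i x).trans (hC x)⟩

theorem MemLp.bdd_mul_two {d : ℕ} {μ : Measure (Rd d)} {f m : Rd d → ℂ} (hf : MemLp f 2 μ)
    (hm : Continuous m) (hb : ∃ C, ∀ x, ‖m x‖ ≤ C) : MemLp (fun x => m x * f x) 2 μ := by
  obtain ⟨C, hC⟩ := hb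
  refine MemLp.mul (p := ∞) (q := 2) hf ?_
  exact memLp_top_of_bound hm.aestronglyMeasurable C (Filter.Eventually.of_forall hC)

/-! ## Elements of `H¹` -/

section

variable {d : ℕ} {U : Set (Rd d)}

/-- The element of `H¹(U)` with prescribed function and weak derivatives. -/
def mkH1 (f : Option (Fin d) → Rd d → ℂ) (hf : ∀ k, MemLp (f k) 2 (volume.restrict U))
    (hw : ∀ (i : Fin d) (η : Rd d → ℂ), IsTestFunction U η →
      ∫ x in U, f none x * pderiv η i x = -(∫ x in U, f (some i) x * η x)) : H1 U :=
  ⟨WithLp.toLp 2 fun k => (hf k).toLp (f k), by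
    intro i η hη
    have e : ∀ (k : Option (Fin d)) (ζ : Rd d → ℂ),
        ∫ x in U, (hf k).toLp (f k) x * ζ x = ∫ x in U, f k x * ζ x := by
      intro k ζ
      refine integral_congr_ae ?_
      filter_upwards [(hf k).coeFn_toLp] with x hx
      rw [hx]
    exact (e none _).trans ((hw i η hη).trans (congrArg Neg.neg (e (some i) η).symm))⟩

theorem mkH1_coeFn (f : Option (Fin d) → Rd d → ℂ) (hf : ∀ k, MemLp (f k) 2 (volume.restrict U))
    (hw : ∀ (i : Fin d) (η : Rd d → ℂ), IsTestFunction U η →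
      ∫ x in U, f none x * pderiv η i x = -(∫ x in U, f (some i) x * η x))
    (k : Option (Fin d)) : (mkH1 f hf hw).1 k =ᵐ[volume.restrict U] f k :=
  (hf k).coeFn_toLp

theorem H1.ext_ae {u w : H1 U} (h : ∀ k, u.1 k =ᵐ[volume.restrict U] w.1 k) : u = w := by
  refine Subtype.ext (PiLp.ext fun k => ?_)
  exact Lp.ext (h k)

theorem coeFn_add_H1 (u w : H1 U) (k : Option (Fin d)) :
    (u + w).1 k =ᵐ[volume.restrict U] fun x => u.1 k x + w.1 k x :=
  Lp.coeFn_add (u.1 k) (w.1 k)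

theorem coeFn_sub_H1 (u w : H1 U) (k : Option (Fin d)) :
    (u - w).1 k =ᵐ[volume.restrict U] fun x => u.1 k x - w.1 k x :=
  Lp.coeFn_sub (u.1 k) (w.1 k)

theorem coeFn_smul_H1 (c : ℂ) (u : H1 U) (k : Option (Fin d)) :
    (c • u).1 k =ᵐ[volume.restrict U] fun x => c * u.1 k x :=
  Lp.coeFn_smul c (u.1 k)

theorem coeFn_sum_H1 {ι : Type*} (s : Finset ι) (u : ι → H1 U) (k : Option (Fin d)) :
    (∑ j ∈ s, u j).1 k =ᵐ[volume.restrict U] fun x => ∑ j ∈ s, (u j).1 k x := by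
  classical
  induction s using Finset.induction_on with
  | empty =>
    simp only [Finset.sum_empty]
    exact Lp.coeFn_zero ℂ 2 (volume.restrict U)
  | insert a s ha ih =>
    simp only [Finset.sum_insert ha]
    filter_upwards [coeFn_add_H1 (u a) (∑ j ∈ s, u j) k, ih] with x h1 h2
    rw [h1, h2]

theorem enorm_sq_H1 (u : H1 U) : ‖u‖ₑ ^ 2 = ∑ k, ∫⁻ x in U, ‖u.1 k x‖ₑ ^ 2 := by
  have h : ‖u‖ ^ 2 = ∑ k, ‖u.1 k‖ ^ 2 := PiLp.norm_sq_eq_of_L2 _ u.1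
  simp only [lintegral_enorm_sq_eq]
  have h2 := congrArg ENNReal.ofReal h
  rw [ENNReal.ofReal_sum_of_nonneg (fun _ _ => by positivity)] at h2
  simpa only [ENNReal.ofReal_pow (norm_nonneg _), ofReal_norm] using h2

theorem lintegral_le_enorm_sq_H1 (u : H1 U) (k : Option (Fin d)) :
    ∫⁻ x in U, ‖u.1 k x‖ₑ ^ 2 ≤ ‖u‖ₑ ^ 2 := by
  rw [enorm_sq_H1]
  exact Finset.single_le_sum (f := fun k => ∫⁻ x in U, ‖u.1 k x‖ₑ ^ 2)
    (fun _ _ => bot_le) (Finset.mem_univ k)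

theorem tendsto_H1_iff {ι : Type*} {l : Filter ι} {u : ι → H1 U} {w : H1 U} :
    Filter.Tendsto u l (𝓝 w) ↔
      ∀ k, Filter.Tendsto (fun n => ∫⁻ x in U, ‖(u n).1 k x - w.1 k x‖ₑ ^ 2) l (𝓝 0) := by
  have e : ∀ n k, ∫⁻ x in U, ‖(u n).1 k x - w.1 k x‖ₑ ^ 2
      = ∫⁻ x in U, ‖(u n - w).1 k x‖ₑ ^ 2 := by
    intro n k
    refine lintegral_congr_ae ?_
    filter_upwards [coeFn_sub_H1 (u n) w k] with x hx
    rw [hx]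
  simp only [e]
  rw [tendsto_iff_edist_tendsto_0]
  simp only [edist_eq_enorm_sub]
  constructor
  · intro h k
    have h2 : Filter.Tendsto (fun n => ‖u n - w‖ₑ ^ 2) l (𝓝 0) := by
      have := ENNReal.Tendsto.pow (n := 2) h
      simpa using this
    exact tendsto_of_tendsto_of_tendsto_of_le_of_le tendsto_const_nhds h2 (fun _ => bot_le)
      (fun n => lintegral_le_enorm_sq_H1 _ k)
  · intro h
    have h2 : Filter.Tendsto (fun n => ‖u n - w‖ₑ ^ 2) l (𝓝 0) := by
      simp only [enorm_sq_H1]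
      have := tendsto_finsetSum Finset.univ fun k _ => h k
      simpa using this
    have h3 := (ENNReal.continuous_rpow_const (y := 1 / 2)).tendsto 0 |>.comp h2
    have e2 : ∀ a : ℝ≥0∞, (a ^ 2) ^ (1 / 2 : ℝ) = a := by
      intro a
      rw [← ENNReal.rpow_natCast, ← ENNReal.rpow_mul]; norm_num
    simpa only [Function.comp_def, e2, ENNReal.zero_rpow_of_pos (show (0 : ℝ) < 1 / 2 by norm_num)]
      using h3

theorem mem_closure_H1_of_lintegral {S : Set (H1 U)} {w : H1 U}
    (h : ∀ ε : ℝ≥0∞, ε ≠ 0 → ∃ u ∈ S, ∀ k, ∫⁻ x in U, ‖u.1 k x - w.1 k x‖ₑ ^ 2 ≤ ε) :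
    w ∈ closure S := by
  choose u hu hb using fun n : ℕ => h ((n : ℝ≥0∞) + 1)⁻¹ (by simp [ENNReal.add_eq_top])
  refine mem_closure_of_tendsto (f := u) (b := Filter.atTop) ?_
    (Filter.Eventually.of_forall hu)
  rw [tendsto_H1_iff]
  intro k
  refine tendsto_of_tendsto_of_tendsto_of_le_of_le tendsto_const_nhds ?_ (fun _ => bot_le)
    (fun n => hb n k)
  have := (Filter.tendsto_add_atTop_iff_nat 1).mpr ENNReal.tendsto_inv_nat_nhds_zero
  simpa using this

/-- Each defining identity is an equality of two continuous functionals. Closedness makes `H1 U` a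
Hilbert space, as the Riesz representation in the double annihilator argument requires. -/
theorem isClosed_H1 : IsClosed (H1 U : Set (PiLp 2 fun _ : Option (Fin d) => L2 U)) := by
  have e : (H1 U : Set (PiLp 2 fun _ : Option (Fin d) => L2 U)) =
      ⋂ (i : Fin d), ⋂ (η : Rd d → ℂ), ⋂ (_ : IsTestFunction U η),
        {f | ∫ x in U, f none x * pderiv η i x = -(∫ x in U, f (some i) x * η x)} := by
    ext f
    simp only [mem_iInter]
    rfl
  rw [e]
  refine isClosed_iInter fun i => isClosed_iInter fun η => isClosed_iInter fun hη => ?_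
  refine isClosed_eq ?_ ?_
  · exact (continuous_integral_mul (hη.memLp_pderiv i _)).comp
      (PiLp.continuous_apply 2 (fun _ : Option (Fin d) => L2 U) none)
  · exact ((continuous_integral_mul (hη.memLp _)).comp
      (PiLp.continuous_apply 2 (fun _ : Option (Fin d) => L2 U) (some i))).neg

instance : CompleteSpace (H1 U) := (isClosed_H1 (U := U)).completeSpace_coe

/-! ### Multiplication by smooth functions -/

theorem weak_H1 (u : H1 U) {i : Fin d} {η : Rd d → ℂ} (hη : IsTestFunction U η) :
    ∫ x in U, u.1 none x * pderiv η i x = -(∫ x in U, u.1 (some i) x * η x) :=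
  u.2 i η hη

/-- The components of `m u`. -/
def mulFun (m : Rd d → ℂ) (u : H1 U) : Option (Fin d) → Rd d → ℂ
  | none => fun x => m x * u.1 none x
  | some i => fun x => m x * u.1 (some i) x + pderiv m i x * u.1 none x

theorem memLp_mulFun {m : Rd d → ℂ} (hm : IsMultiplier m) (u : H1 U) (k : Option (Fin d)) :
    MemLp (mulFun m u k) 2 (volume.restrict U) := by
  cases k with
  | none => exact MemLp.bdd_mul_two (Lp.memLp _) hm.smooth.continuous hm.bdd
  | some i =>
    refine (MemLp.bdd_mul_two (Lp.memLp _) hm.smooth.continuous hm.bdd).add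
      (MemLp.bdd_mul_two (Lp.memLp _) (continuous_pderiv hm.smooth i) ?_)
    obtain ⟨C, hC⟩ := hm.bdd_pderiv
    exact ⟨C, hC i⟩

/-- The product `m u` of `u ∈ H¹(U)` and of a smooth multiplier. -/
def mulH1 (m : Rd d → ℂ) (hm : IsMultiplier m) (u : H1 U) : H1 U :=
  mkH1 (mulFun m u) (memLp_mulFun hm u) (by
    intro i η hη
    -- Leibniz rule: `u` is tested against `m η`, and the term with `∂m` is moved to the other side.
    have hmη := hη.smooth_mul hm.smooth
    have h1 := weak_H1 u (i := i) hmη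
    have i1 : Integrable (fun x => u.1 none x * (m x * pderiv η i x)) (volume.restrict U) :=
      (Lp.memLp (u.1 none)).integrable_mul
        (MemLp.bdd_mul_two (hη.memLp_pderiv i _) hm.smooth.continuous hm.bdd)
    have hb : ∃ C, ∀ x, ‖pderiv m i x‖ ≤ C := by
      obtain ⟨C, hC⟩ := hm.bdd_pderiv
      exact ⟨C, hC i⟩
    have i2 : Integrable (fun x => u.1 none x * (pderiv m i x * η x)) (volume.restrict U) :=
      (Lp.memLp (u.1 none)).integrable_mul
        (MemLp.bdd_mul_two (hη.memLp _) (continuous_pderiv hm.smooth i) hb)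
    have i3 : Integrable (fun x => u.1 (some i) x * (m x * η x)) (volume.restrict U) :=
      (Lp.memLp (u.1 (some i))).integrable_mul
        (MemLp.bdd_mul_two (hη.memLp _) hm.smooth.continuous hm.bdd)
    have h2 : ∫ x in U, u.1 none x * pderiv (fun y => m y * η y) i x =
        (∫ x in U, u.1 none x * (m x * pderiv η i x)) +
          ∫ x in U, u.1 none x * (pderiv m i x * η x) := by
      rw [← integral_add i1 i2]
      refine integral_congr_ae (Filter.Eventually.of_forall fun x => ?_)
      simp only [pderiv_mul hm.smooth hη.smooth]
      ring
    have h3 : ∫ x in U, mulFun m u (some i) x * η x =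
        (∫ x in U, u.1 (some i) x * (m x * η x)) +
          ∫ x in U, u.1 none x * (pderiv m i x * η x) := by
      rw [← integral_add i3 i2]
      refine integral_congr_ae (Filter.Eventually.of_forall fun x => ?_)
      simp only [mulFun]
      ring
    have h4 : ∫ x in U, mulFun m u none x * pderiv η i x =
        ∫ x in U, u.1 none x * (m x * pderiv η i x) := by
      refine integral_congr_ae (Filter.Eventually.of_forall fun x => ?_)
      simp only [mulFun]
      ring
    rw [h3, h4]
    rw [h2] at h1
    linear_combination h1)

theorem mulH1_coeFn {m : Rd d → ℂ} (hm : IsMultiplier m) (u : H1 U) (k : Option (Fin d)) :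
    (mulH1 m hm u).1 k =ᵐ[volume.restrict U] mulFun m u k :=
  mkH1_coeFn _ _ _ k

/-! ### Test functions in `H¹` -/

/-- The function and its classical partial derivatives. -/
def jet (φ : Rd d → ℂ) : Option (Fin d) → Rd d → ℂ
  | none => φ
  | some i => pderiv φ i

theorem continuous_jet {φ : Rd d → ℂ} (hφ : ContDiff ℝ ∞ φ) (k : Option (Fin d)) :
    Continuous (jet φ k) := by
  cases k with
  | none => exact hφ.continuous
  | some i => exact continuous_pderiv hφ i

/-- The space `C_c^∞(V)`. -/
def testFns (V : Set (Rd d)) : Submodule ℂ (Rd d → ℂ) where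
  carrier := {φ | IsTestFunction V φ}
  zero_mem' := ⟨contDiff_const, HasCompactSupport.zero, by
    rw [show tsupport (0 : Rd d → ℂ) = ∅ by simp [tsupport]]; exact empty_subset _⟩
  add_mem' := fun hf hg => ⟨hf.smooth.add hg.smooth, hf.compact.add hg.compact,
    (tsupport_add _ _).trans (union_subset hf.support hg.support)⟩
  smul_mem' := fun c f hf => ⟨contDiff_const.smul hf.smooth, hf.compact.smul_left,
    (closure_mono (Function.support_const_smul_subset c f)).trans hf.support⟩

theorem pderiv_add {f g : Rd d → ℂ} (hf : ContDiff ℝ ∞ f) (hg : ContDiff ℝ ∞ g)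
    (i : Fin d) (x : Rd d) : pderiv (f + g) i x = pderiv f i x + pderiv g i x := by
  have h := ((hf.differentiable (by simp) x).hasFDerivAt.add
    (hg.differentiable (by simp) x).hasFDerivAt).fderiv
  exact congrArg (· (EuclideanSpace.single i 1)) h

theorem pderiv_const_smul {f : Rd d → ℂ} (hf : ContDiff ℝ ∞ f) (c : ℂ)
    (i : Fin d) (x : Rd d) : pderiv (c • f) i x = c * pderiv f i x := by
  have h := ((hf.differentiable (by simp) x).hasFDerivAt.const_smul c).fderiv
  exact congrArg (· (EuclideanSpace.single i 1)) h

theorem IsTestFunction.memLp_jet {V : Set (Rd d)} {φ : Rd d → ℂ} (h : IsTestFunction V φ)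
    (k : Option (Fin d)) (μ : Measure (Rd d)) [IsFiniteMeasureOnCompacts μ] :
    MemLp (jet φ k) 2 μ := by
  cases k with
  | none => exact h.memLp μ
  | some i => exact h.memLp_pderiv i μ

/-- Since `η` vanishes off `U`, both integrals extend to the whole space, where classical
integration by parts applies; no regularity of `U` is involved. -/
theorem IsTestFunction.weak_jet {V : Set (Rd d)} {φ : Rd d → ℂ} (h : IsTestFunction V φ)
    (i : Fin d) (η : Rd d → ℂ) (hη : IsTestFunction U η) :
    ∫ x in U, φ x * pderiv η i x = -(∫ x in U, pderiv φ i x * η x) := by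
  rw [setIntegral_eq_integral_of_forall_compl_eq_zero
      (fun x hx => by rw [hη.pderiv_eq_zero i hx, mul_zero]),
    setIntegral_eq_integral_of_forall_compl_eq_zero
      (fun x hx => by rw [hη.eq_zero hx, mul_zero])]
  refine integral_mul_fderiv_eq_neg_fderiv_mul_of_integrable ?_ ?_ ?_
    (fun x _ => h.smooth.differentiable (by simp) x)
    (fun x _ => hη.smooth.differentiable (by simp) x)
  · exact (h.memLp_pderiv i volume).integrable_mul (hη.memLp volume)
  · exact (h.memLp volume).integrable_mul (hη.memLp_pderiv i volume)
  · exact (h.memLp volume).integrable_mul (hη.memLp volume)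

/-- The restriction to `U` of a test function, as an element of `H¹(U)`. -/
def testToH1 (U V : Set (Rd d)) : testFns V →ₗ[ℂ] H1 U where
  toFun φ := mkH1 (jet φ.1) (fun k => IsTestFunction.memLp_jet φ.2 k _)
    (IsTestFunction.weak_jet φ.2)
  map_add' φ ψ := by
    refine H1.ext_ae fun k => ?_
    refine (mkH1_coeFn _ _ _ k).trans ?_
    refine Filter.EventuallyEq.trans ?_ (coeFn_add_H1 _ _ k).symm
    filter_upwards [mkH1_coeFn (U := U) (jet φ.1) (fun k => IsTestFunction.memLp_jet φ.2 k _)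
        (IsTestFunction.weak_jet φ.2) k,
      mkH1_coeFn (U := U) (jet ψ.1) (fun k => IsTestFunction.memLp_jet ψ.2 k _)
        (IsTestFunction.weak_jet ψ.2) k] with x h1 h2
    rw [h1, h2]
    cases k with
    | none => rfl
    | some i => exact pderiv_add φ.2.smooth ψ.2.smooth i x
  map_smul' c φ := by
    refine H1.ext_ae fun k => ?_
    refine (mkH1_coeFn _ _ _ k).trans ?_
    refine Filter.EventuallyEq.trans ?_ (coeFn_smul_H1 _ _ k).symm
    filter_upwards [mkH1_coeFn (U := U) (jet φ.1) (fun k => IsTestFunction.memLp_jet φ.2 k _)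
        (IsTestFunction.weak_jet φ.2) k] with x h1
    rw [h1]
    cases k with
    | none => rfl
    | some i => exact pderiv_const_smul φ.2.smooth c i x

theorem testToH1_coeFn {V : Set (Rd d)} (φ : testFns V) (k : Option (Fin d)) :
    (testToH1 U V φ).1 k =ᵐ[volume.restrict U] jet φ.1 k :=
  mkH1_coeFn _ _ (IsTestFunction.weak_jet φ.2) k

/-- The fundamental lemma of the calculus of variations in `L²(U)`. -/
theorem L2_ext_of_test (hU : IsOpen U) {f g : L2 U}
    (h : ∀ η, IsTestFunction U η → ∫ x in U, f x * η x = ∫ x in U, g x * η x) : f = g := by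
  have hl : LocallyIntegrableOn (fun x => f x - g x) U volume :=
    locallyIntegrableOn_of_locallyIntegrable_restrict
      (((Lp.memLp f).sub (Lp.memLp g)).locallyIntegrable (by norm_num))
  have key := hU.ae_eq_zero_of_integral_contDiff_smul_eq_zero hl (by
    intro η h1 h2 h3
    have hη : IsTestFunction U fun x => (η x : ℂ) := by
      refine ⟨Complex.ofRealCLM.contDiff.comp h1, h2.comp_left (g := Complex.ofReal) Complex.ofReal_zero, ?_⟩
      refine (closure_mono ?_).trans h3
      intro x hx
      simpa using hx
    have e := h _ hη
    have hz : ∀ x, x ∉ U → η x • (f x - g x) = 0 := fun x hx => by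
      rw [image_eq_zero_of_notMem_tsupport fun h' => hx (h3 h'), zero_smul]
    refine (setIntegral_eq_integral_of_forall_compl_eq_zero hz).symm.trans ?_
    have i1 : Integrable (fun x => f x * (η x : ℂ)) (volume.restrict U) :=
      (Lp.memLp f).integrable_mul (hη.memLp _)
    have i2 : Integrable (fun x => g x * (η x : ℂ)) (volume.restrict U) :=
      (Lp.memLp g).integrable_mul (hη.memLp _)
    have e2 := integral_sub i1 i2
    rw [e, sub_self] at e2
    rw [← e2]
    refine integral_congr_ae (Filter.Eventually.of_forall fun x => ?_)
    simp only [Complex.real_smul]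
    ring)
  refine Lp.ext ?_
  filter_upwards [ae_restrict_of_ae key, ae_restrict_mem hU.measurableSet] with x h1 h2
  exact sub_eq_zero.mp (h1 h2)

/-- Weak derivatives are determined by the function. -/
theorem H1.ext_val (hU : IsOpen U) {u w : H1 U} (h : valH1 u = valH1 w) : u = w := by
  refine Subtype.ext (PiLp.ext fun k => ?_)
  cases k with
  | none => exact h
  | some i =>
    refine L2_ext_of_test hU fun η hη => ?_
    have h1 := weak_H1 u (i := i) hη
    have h2 := weak_H1 w (i := i) hη
    have h' : u.1 none = w.1 none := h
    rw [h'] at h1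
    exact neg_injective (h1.symm.trans h2)

end

/-! ## Density of smooth functions in `H¹` -/

section

variable {d : ℕ} {U : Set (Rd d)}

/-- The error in the derivative is `(m_n - 1) ∂u + ∂m_n u`. Dominated convergence handles the first
term. The second is left as a hypothesis because its decay has different causes: slowly varying
cutoffs at infinity, zero trace near the boundary. -/
theorem tendsto_mulH1 (hU : MeasurableSet U) {m : ℕ → Rd d → ℂ} (hm : ∀ n, IsMultiplier (m n))
    (u : H1 U) (hb : ∀ n x, ‖m n x‖ ≤ 1)
    (hlim : ∀ x ∈ U, Filter.Tendsto (fun n => m n x) Filter.atTop (𝓝 1))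
    (hd : ∀ i, Filter.Tendsto (fun n => ∫⁻ x in U, ‖pderiv (m n) i x * u.1 none x‖ₑ ^ 2)
      Filter.atTop (𝓝 0)) :
    Filter.Tendsto (fun n => mulH1 (m n) (hm n) u) Filter.atTop (𝓝 u) := by
  have key : ∀ k, Filter.Tendsto (fun n => ∫⁻ x in U, ‖(m n x - 1) * u.1 k x‖ₑ ^ 2)
      Filter.atTop (𝓝 0) := by
    intro k
    have hlm : AEMeasurable (fun x => u.1 k x) (volume.restrict U) :=
      (Lp.aestronglyMeasurable (u.1 k)).aemeasurable
    -- The dominating factor is `4 = (1 + 1)²`, from `‖m n x - 1‖ ≤ 2`.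
    have := tendsto_lintegral_of_dominated_convergence' (μ := volume.restrict U)
      (F := fun n x => ‖(m n x - 1) * u.1 k x‖ₑ ^ 2) (f := fun _ => 0)
      (fun x => 4 * ‖u.1 k x‖ₑ ^ 2) ?_ ?_ ?_ ?_
    · simpa using this
    · intro n
      exact ((((hm n).smooth.continuous.sub continuous_const).measurable.aemeasurable.mul
        hlm).enorm.pow_const 2)
    · intro n
      refine Filter.Eventually.of_forall fun x => ?_
      simp only [enorm_mul, mul_pow]
      gcongr
      have h2 : ‖m n x - 1‖ₑ ≤ 2 := by
        rw [← ofReal_norm, show (2 : ℝ≥0∞) = ENNReal.ofReal 2 by simp]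
        refine ENNReal.ofReal_le_ofReal ((norm_sub_le _ _).trans ?_)
        have := hb n x
        rw [norm_one]
        linarith
      calc ‖m n x - 1‖ₑ ^ 2 ≤ 2 ^ 2 := by gcongr
        _ = 4 := by norm_num
    · rw [lintegral_const_mul' _ _ (by norm_num), lintegral_enorm_sq_eq]
      exact ENNReal.mul_ne_top (by norm_num) (by simp)
    · filter_upwards [ae_restrict_mem hU] with x hx
      have h1 : Filter.Tendsto (fun n => (m n x - 1) * u.1 k x) Filter.atTop (𝓝 0) := by
        simpa using ((hlim x hx).sub_const 1).mul_const (u.1 k x)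
      have := ((ENNReal.continuous_pow 2).comp continuous_enorm).tendsto (0 : ℂ) |>.comp h1
      simpa [Function.comp_def] using this
  rw [tendsto_H1_iff]
  intro k
  cases k with
  | none =>
    refine (key none).congr fun n => lintegral_congr_ae ?_
    filter_upwards [mulH1_coeFn (hm n) u none] with x hx
    rw [hx]
    simp only [mulFun, sub_mul, one_mul]
  | some i =>
    have h0 : Filter.Tendsto (fun n => 2 * (∫⁻ x in U, ‖(m n x - 1) * u.1 (some i) x‖ₑ ^ 2) +
        2 * ∫⁻ x in U, ‖pderiv (m n) i x * u.1 none x‖ₑ ^ 2) Filter.atTop (𝓝 0) := by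
      have := (ENNReal.Tendsto.const_mul (a := 2) (key (some i)) (by simp)).add
        (ENNReal.Tendsto.const_mul (a := 2) (hd i) (by simp))
      simpa using this
    refine tendsto_of_tendsto_of_tendsto_of_le_of_le tendsto_const_nhds h0 (fun _ => bot_le)
      fun n => ?_
    have hlm : ∀ k, AEMeasurable (fun x => u.1 k x) (volume.restrict U) := fun k =>
      (Lp.aestronglyMeasurable (u.1 k)).aemeasurable
    calc ∫⁻ x in U, ‖(mulH1 (m n) (hm n) u).1 (some i) x - u.1 (some i) x‖ₑ ^ 2
        ≤ ∫⁻ x in U, (2 * ‖(m n x - 1) * u.1 (some i) x‖ₑ ^ 2 +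
            2 * ‖pderiv (m n) i x * u.1 none x‖ₑ ^ 2) := by
          refine lintegral_mono_ae ?_
          filter_upwards [mulH1_coeFn (hm n) u (some i)] with x hx
          rw [hx]
          refine le_trans (le_of_eq ?_) (enorm_add_sq_le _ _)
          simp only [mulFun]
          congr 2
          ring
      _ = _ := by
          rw [lintegral_add_left', lintegral_const_mul' _ _ (by simp),
            lintegral_const_mul' _ _ (by simp)]
          exact (((((hm n).smooth.continuous.sub continuous_const).measurable.aemeasurable.mul
            (hlm _)).enorm.pow_const 2).const_mul 2)

/-- Smooth cutoffs at infinity. -/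
theorem exists_cutoff_infinity (d : ℕ) : ∃ m : ℕ → Rd d → ℂ,
    (∀ n, IsTestFunction univ (m n)) ∧ (∀ n x, ‖m n x‖ ≤ 1) ∧
    (∀ x, Filter.Tendsto (fun n => m n x) Filter.atTop (𝓝 1)) ∧
    ∃ C : ℝ, ∀ n i x, ‖pderiv (m n) i x‖ ≤ C * ((n : ℝ) + 1)⁻¹ := by
  let b : ContDiffBump (0 : Rd d) := ⟨1, 2, by norm_num, by norm_num⟩
  let B : Rd d → ℂ := fun x => (b x : ℂ)
  have hB : ContDiff ℝ ∞ B := Complex.ofRealCLM.contDiff.comp (b.contDiff (n := ⊤))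
  have hBc : HasCompactSupport B :=
    b.hasCompactSupport.comp_left (g := Complex.ofReal) Complex.ofReal_zero
  obtain ⟨C, hC⟩ := (hBc.fderiv ℝ).exists_bound_of_continuous (hB.continuous_fderiv (by simp))
  have hn : ∀ n : ℕ, ((n : ℝ) + 1)⁻¹ ≠ 0 := fun n => by positivity
  refine ⟨fun n x => B (((n : ℝ) + 1)⁻¹ • x), fun n => ⟨?_, hBc.comp_smul (hn n), by simp⟩,
    fun n x => ?_, fun x => ?_, C, fun n i x => ?_⟩
  · exact hB.comp (contDiff_const_smul _)
  · simp only [B, Complex.norm_real, Real.norm_eq_abs, abs_of_nonneg b.nonneg]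
    exact b.le_one
  · refine tendsto_const_nhds.congr' ?_
    obtain ⟨N, hN⟩ := exists_nat_gt ‖x‖
    filter_upwards [Filter.eventually_ge_atTop N] with n hnN
    have : b (((n : ℝ) + 1)⁻¹ • x) = 1 := by
      refine b.one_of_mem_closedBall ?_
      rw [mem_closedBall_zero_iff, norm_smul, norm_inv, Real.norm_of_nonneg (by positivity)]
      have h1 : (N : ℝ) ≤ n := by exact_mod_cast hnN
      change _ ≤ (1 : ℝ)
      rw [inv_mul_le_iff₀ (by positivity)]
      linarith
    simp [B, this]
  · refine (norm_pderiv_le _ i x).trans ?_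
    rw [fderiv_comp_smul, norm_smul, norm_inv, Real.norm_of_nonneg (by positivity), mul_comm]
    gcongr
    exact hC _

/-- From each point of `Ω` close to `x` one can move in a fixed direction so as to stay at a
distance from the complement of `Ω` that is proportional to the displacement. -/
def HasInteriorDirections (Ω : Set (Rd d)) : Prop :=
  ∀ x, ∃ (a : Rd d) (r c t₀ : ℝ), 0 < r ∧ 0 < c ∧ 0 < t₀ ∧
    ∀ y ∈ Metric.ball x r ∩ Ω, ∀ t, 0 < t → t < t₀ → Metric.ball (y + t • a) (c * t) ⊆ Ω

theorem contDiff_kernel_sub {κ : Rd d → ℝ} (h : ContDiff ℝ ∞ κ) (x : Rd d) :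
    ContDiff ℝ ∞ fun y => (κ (x - y) : ℂ) :=
  Complex.ofRealCLM.contDiff.comp (h.comp (contDiff_const.sub contDiff_id))

theorem pderiv_kernel_sub {κ : Rd d → ℝ} (h : ContDiff ℝ ∞ κ) (x : Rd d) (i : Fin d) (y : Rd d) :
    pderiv (fun y => (κ (x - y) : ℂ)) i y =
      -((fderiv ℝ κ (x - y) (EuclideanSpace.single i 1) : ℝ) : ℂ) := by
  have h1 : HasFDerivAt κ (fderiv ℝ κ (x - y)) (x - y) :=
    (h.differentiable (by simp) _).hasFDerivAt
  have h2 := (Complex.ofRealCLM.hasFDerivAt (x := κ (x - y))).comp y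
    (h1.comp y ((hasFDerivAt_id y).const_sub x))
  have e : pderiv (fun y => (κ (x - y) : ℂ)) i y = _ :=
    congrArg (· (EuclideanSpace.single i 1)) h2.fderiv
  rw [e]
  simp

/-- If the kernel is supported where `x - κ` stays in `U`, mollification of the zero extension of
`χ u` commutes with differentiation at `x`. -/
theorem pderiv_moll_indicator (hU : IsOpen U) {κ : Rd d → ℝ} {δ : ℝ} (hκ : IsKernel κ δ)
    {χ : Rd d → ℂ} (hχ : IsTestFunction univ χ) (u : H1 U) (i : Fin d) (x : Rd d)
    (hx : tsupport (fun y => χ y * (κ (x - y) : ℂ)) ⊆ U) :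
    pderiv (moll κ (U.indicator (mulFun χ u none))) i x =
      moll κ (U.indicator (mulFun χ u (some i))) x := by
  have hF : ∀ k, MemLp (U.indicator (mulFun χ u k)) 2 volume := fun k =>
    (memLp_indicator_iff_restrict hU.measurableSet).mpr (memLp_mulFun hχ.isMultiplier u k)
  rw [hκ.pderiv_moll ((hF none).locallyIntegrable (by norm_num)), moll_eq_swap]
  set K : Rd d → ℂ := fun y => (κ (x - y) : ℂ) with hK
  have hKs : ContDiff ℝ ∞ K := contDiff_kernel_sub hκ.smooth x
  -- The weak derivative identity for `u` tested with `y ↦ χ(y) κ(x - y)` is the assertion at `x`,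
  -- once the product rule is expanded.
  have hη : IsTestFunction U fun y => χ y * K y :=
    ⟨hχ.smooth.mul hKs, hχ.compact.mul_right, hx⟩
  have hw := weak_H1 u (i := i) hη
  have e1 : ∫ y, ((fderiv ℝ κ (x - y) (EuclideanSpace.single i 1) : ℝ) : ℂ) *
      U.indicator (mulFun χ u none) y = -∫ y in U, u.1 none y * (χ y * pderiv K i y) := by
    rw [← integral_indicator hU.measurableSet, ← integral_neg]
    refine integral_congr_ae (Filter.Eventually.of_forall fun y => ?_)
    by_cases hy : y ∈ U
    · simp only [indicator_of_mem hy, mulFun, hK, pderiv_kernel_sub hκ.smooth]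
      ring
    · simp [indicator_of_notMem hy]
  have e2 : ∫ y, (κ (x - y) : ℂ) * U.indicator (mulFun χ u (some i)) y =
      ∫ y in U, (u.1 (some i) y * (χ y * K y) + u.1 none y * (pderiv χ i y * K y)) := by
    rw [← integral_indicator hU.measurableSet]
    refine integral_congr_ae (Filter.Eventually.of_forall fun y => ?_)
    by_cases hy : y ∈ U
    · simp only [indicator_of_mem hy, mulFun, hK]
      ring
    · simp [indicator_of_notMem hy]
  have m1 : MemLp (fun y => χ y * pderiv K i y) 2 (volume.restrict U) :=
    (hχ.smooth.continuous.mul (continuous_pderiv hKs i)).memLp_of_hasCompactSupport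
      hχ.compact.mul_right
  have m2 : MemLp (fun y => pderiv χ i y * K y) 2 (volume.restrict U) :=
    ((continuous_pderiv hχ.smooth i).mul hKs.continuous).memLp_of_hasCompactSupport
      (hχ.hasCompactSupport_pderiv i).mul_right
  have i1 : Integrable (fun y => u.1 none y * (χ y * pderiv K i y)) (volume.restrict U) :=
    (Lp.memLp (u.1 none)).integrable_mul m1
  have i2 : Integrable (fun y => u.1 none y * (pderiv χ i y * K y)) (volume.restrict U) :=
    (Lp.memLp (u.1 none)).integrable_mul m2
  have i3 : Integrable (fun y => u.1 (some i) y * (χ y * K y)) (volume.restrict U) :=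
    (Lp.memLp (u.1 (some i))).integrable_mul (hη.memLp _)
  have e3 : ∫ y in U, u.1 none y * pderiv (fun y => χ y * K y) i y =
      (∫ y in U, u.1 none y * (χ y * pderiv K i y)) +
        ∫ y in U, u.1 none y * (pderiv χ i y * K y) := by
    rw [← integral_add i1 i2]
    refine integral_congr_ae (Filter.Eventually.of_forall fun y => ?_)
    simp only [pderiv_mul hχ.smooth hKs]
    ring
  rw [e1, e2, integral_add i3 i2]
  rw [e3] at hw
  linear_combination -hw

/-- The zero extension of `χ u` may jump across the boundary of `U`, so it is mollified with a
kernel concentrated near `-t a`. The value at `x ∈ U` then only involves points near `x + t a`,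
which the interior direction keeps inside `U`, and there mollification commutes with weak
differentiation. -/
theorem mulH1_mem_closure_of_local (hU : IsOpen U) {x₀ a : Rd d} {r c t₀ : ℝ} (hr : 0 < r)
    (hc : 0 < c) (ht₀ : 0 < t₀)
    (hdir : ∀ y ∈ Metric.ball x₀ r ∩ U, ∀ t, 0 < t → t < t₀ →
      Metric.ball (y + t • a) (c * t) ⊆ U)
    {χ : Rd d → ℂ} (hχ : IsTestFunction univ χ) (hχs : tsupport χ ⊆ Metric.ball x₀ (r / 2))
    (u : H1 U) :
    mulH1 χ hχ.isMultiplier u ∈ closure (range (testToH1 U univ)) := by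
  refine mem_closure_H1_of_lintegral fun ε hε => ?_
  set F : Option (Fin d) → Rd d → ℂ := fun k => U.indicator (mulFun χ u k) with hFdef
  have hF : ∀ k, MemLp (F k) 2 volume := fun k =>
    (memLp_indicator_iff_restrict hU.measurableSet).mpr (memLp_mulFun hχ.isMultiplier u k)
  choose δ hδ hmoll using fun k => exists_forall_kernel_lintegral_moll_sub_le (hF k) hε
  obtain ⟨k₀, hk₀⟩ := Finite.exists_min δ
  have hA : 0 < ‖a‖ + c := by positivity
  have hM : 0 < min (δ k₀) (r / 2) := lt_min (hδ k₀) (by positivity)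
  -- The kernel lives in the ball of radius `t (‖a‖ + c)` about the origin. This is made smaller
  -- than every `δ k`, so that all components converge, and than `r / 2`, so that only `x` in the
  -- ball of radius `r` matter.
  obtain ⟨t, ht, ht'⟩ : ∃ t, 0 < t ∧ t < min t₀ (min (δ k₀) (r / 2) / (‖a‖ + c)) :=
    exists_between (lt_min ht₀ (by positivity))
  have htt₀ : t < t₀ := ht'.trans_le (min_le_left _ _)
  have htA : t * (‖a‖ + c) < min (δ k₀) (r / 2) := by
    rw [← lt_div_iff₀ hA]
    exact ht'.trans_le (min_le_right _ _)
  have hct : 0 < c * t := by positivity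
  -- Radius `c t / 2` rather than `c t`: the closed support then fits in the open ball of radius `c
  -- t` that is known to lie in `U`.
  obtain ⟨κ, hκ, hκs⟩ := exists_isKernel (-(t • a)) (half_pos hct)
  have hna : ‖-(t • a)‖ = t * ‖a‖ := by rw [norm_neg, norm_smul, Real.norm_of_nonneg ht.le]
  have hsmall : ‖-(t • a)‖ + c * t / 2 < t * (‖a‖ + c) := by rw [hna]; nlinarith
  have hFc : HasCompactSupport (F none) := by
    refine hχ.compact.mono' ?_
    intro y hy
    refine subset_tsupport _ fun h0 => hy ?_
    by_cases hyU : y ∈ U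
    · simp [F, indicator_of_mem hyU, mulFun, h0]
    · simp [F, indicator_of_notMem hyU]
  have hφ : IsTestFunction univ (moll κ (F none)) :=
    ⟨hκ.contDiff_moll ((hF none).locallyIntegrable (by norm_num)),
      hκ.hasCompactSupport_moll hFc, subset_univ _⟩
  have hjet : ∀ k, ∀ x ∈ U, jet (moll κ (F none)) k x = moll κ (F k) x := by
    intro k x hx
    cases k with
    | none => rfl
    | some i =>
      refine pderiv_moll_indicator hU hκ hχ u i x fun y hy => ?_
      have hy1 : y ∈ Metric.ball x₀ (r / 2) := hχs (tsupport_mul_subset_left hy)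
      have hy2 : dist y (x + t • a) ≤ c * t / 2 := by
        have hsub : tsupport (fun y => (κ (x - y) : ℂ)) ⊆
            Metric.closedBall (x + t • a) (c * t / 2) := by
          refine closure_minimal ?_ Metric.isClosed_closedBall
          intro z hz
          have h1 : κ (x - z) ≠ 0 := fun h0 => hz (by simp [h0])
          have h2 := hκs _ h1
          rw [Metric.mem_closedBall, dist_comm, dist_eq_norm]
          rw [dist_eq_norm] at h2
          rw [show x + t • a - z = x - z - -(t • a) by abel]
          exact h2.le
        exact hsub (tsupport_mul_subset_right hy)
      have hxy : dist x y < r / 2 := by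
        calc dist x y ≤ dist x (x + t • a) + dist (x + t • a) y := dist_triangle _ _ _
          _ ≤ t * ‖a‖ + c * t / 2 := by
              refine add_le_add (le_of_eq ?_) (by rwa [dist_comm])
              rw [dist_eq_norm, ← hna]
              congr 1
              abel
          _ < r / 2 := by
              rw [← hna]
              exact hsmall.trans (htA.trans_le (min_le_right _ _))
      have hxb : x ∈ Metric.ball x₀ r := by
        rw [Metric.mem_ball] at hy1 ⊢
        calc dist x x₀ ≤ dist x y + dist y x₀ := dist_triangle _ _ _
          _ < r := by linarith
      refine hdir x ⟨hxb, hx⟩ t ht htt₀ ?_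
      rw [Metric.mem_ball]
      linarith
  refine ⟨testToH1 U univ ⟨_, hφ⟩, mem_range_self _, fun k => ?_⟩
  have hκ' : IsKernel κ (δ k) := ⟨hκ.smooth, hκ.compact, hκ.nonneg, hκ.integral, fun y hy =>
    (hκ.small y hy).trans ((hsmall.trans (htA.trans_le (min_le_left _ _))).trans_le (hk₀ k))⟩
  calc ∫⁻ x in U, ‖(testToH1 U univ ⟨_, hφ⟩).1 k x - (mulH1 χ hχ.isMultiplier u).1 k x‖ₑ ^ 2
      = ∫⁻ x in U, ‖moll κ (F k) x - F k x‖ₑ ^ 2 := by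
        refine lintegral_congr_ae ?_
        filter_upwards [testToH1_coeFn (U := U) ⟨_, hφ⟩ k, mulH1_coeFn hχ.isMultiplier u k,
          ae_restrict_mem hU.measurableSet] with x h1 h2 h3
        rw [h1, h2, hjet k x h3]
        simp [F, indicator_of_mem h3]
    _ ≤ ∫⁻ x, ‖moll κ (F k) x - F k x‖ₑ ^ 2 := setLIntegral_le_lintegral _ _
    _ ≤ ε := hmoll k κ hκ'

theorem pderiv_sum {ι : Type*} (s : Finset ι) {f : ι → Rd d → ℂ} (hf : ∀ j, ContDiff ℝ ∞ (f j))
    (i : Fin d) (x : Rd d) : pderiv (fun y => ∑ j ∈ s, f j y) i x = ∑ j ∈ s, pderiv (f j) i x := by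
  have h := (HasFDerivAt.fun_sum (u := s) (A := f) fun j _ =>
    ((hf j).differentiable (by simp) x).hasFDerivAt).fderiv
  have e : pderiv (fun y => ∑ j ∈ s, f j y) i x = _ :=
    congrArg (· (EuclideanSpace.single i 1)) h
  rw [e]
  simp [pderiv]

/-- A finite smooth partition of a test function subordinate to small balls. -/
theorem exists_test_partition {m : Rd d → ℂ} (hm : IsTestFunction univ m) {r : Rd d → ℝ}
    (hr : ∀ x, 0 < r x) :
    ∃ (s : Finset (Rd d)) (f : Rd d → Rd d → ℂ), (∀ z, IsTestFunction univ (f z)) ∧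
      (∀ z, tsupport (f z) ⊆ Metric.ball z (r z)) ∧ ∀ x, m x = ∑ z ∈ s, f z x := by
  obtain ⟨s, hs⟩ := (hm.compact : IsCompact (tsupport m)).elim_nhds_subcover
    (fun z => Metric.ball z (r z)) fun z _ => Metric.ball_mem_nhds z (hr z)
  obtain ⟨ρ, hρ⟩ := SmoothPartitionOfUnity.exists_isSubordinate (modelWithCornersSelf ℝ (Rd d))
    (isClosed_tsupport m) (fun z : s => Metric.ball (z : Rd d) (r z))
    (fun _ => Metric.isOpen_ball) (by
      refine hs.2.trans ?_
      intro x hx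
      simp only [mem_iUnion] at hx ⊢
      obtain ⟨z, hz, hxz⟩ := hx
      exact ⟨⟨z, hz⟩, hxz⟩)
  classical
  have hρs : ∀ z : s, ContDiff ℝ ∞ fun x => ((ρ z x : ℝ) : ℂ) := fun z =>
    Complex.ofRealCLM.contDiff.comp (ρ z).contMDiff.contDiff
  have hg : ∀ z : s, IsTestFunction univ fun x => ((ρ z x : ℝ) : ℂ) * m x := fun z =>
    hm.smooth_mul (hρs z)
  refine ⟨s, fun z x => if h : z ∈ s then ((ρ ⟨z, h⟩ x : ℝ) : ℂ) * m x else 0, ?_, ?_, ?_⟩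
  · intro z
    by_cases h : z ∈ s
    · simp only [h, dite_true]
      exact hg _
    · simp only [h, dite_false]
      exact (testFns univ).zero_mem
  · intro z
    by_cases h : z ∈ s
    · simp only [h, dite_true]
      refine tsupport_mul_subset_left.trans ((closure_mono ?_).trans (hρ ⟨z, h⟩))
      intro x hx
      simpa using hx
    · simp only [h, dite_false]
      rw [show tsupport (fun _ : Rd d => (0 : ℂ)) = ∅ by simp [tsupport, Function.support]]
      exact empty_subset _
  · intro x
    rw [← Finset.sum_coe_sort]
    simp only [Finset.coe_mem, dite_true, Subtype.coe_eta]
    rw [← Finset.sum_mul]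
    by_cases hx : x ∈ tsupport m
    · have h1 := ρ.sum_eq_one hx
      rw [finsum_eq_sum_of_fintype] at h1
      rw [← Complex.ofReal_sum, h1]
      simp
    · rw [image_eq_zero_of_notMem_tsupport hx, mul_zero]

/-- Restrictions of test functions are dense in `H¹(U)`. -/
theorem denseRange_testToH1 (hU : IsOpen U) (hdir : HasInteriorDirections U) :
    DenseRange (testToH1 U univ) := by
  choose a r c t₀ hr hc ht₀ h using hdir
  have hcpt : ∀ (m : Rd d → ℂ) (hm : IsTestFunction univ m) (u : H1 U),
      mulH1 m hm.isMultiplier u ∈ closure (range (testToH1 U univ)) := by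
    intro m hm u
    obtain ⟨s, f, hf, hfs, hsum⟩ := exists_test_partition hm (r := fun x => r x / 2)
      fun x => half_pos (hr x)
    have e : mulH1 m hm.isMultiplier u = ∑ z ∈ s, mulH1 (f z) (hf z).isMultiplier u := by
      refine H1.ext_ae fun k => ?_
      refine (mulH1_coeFn _ _ k).trans ?_
      refine Filter.EventuallyEq.trans ?_ (coeFn_sum_H1 _ _ k).symm
      have hall : ∀ᵐ x ∂(volume.restrict U), ∀ z ∈ s,
          (mulH1 (f z) (hf z).isMultiplier u).1 k x = mulFun (f z) u k x :=
        (ae_ball_iff s.countable_toSet).mpr fun z _ => mulH1_coeFn (hf z).isMultiplier u k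
      filter_upwards [hall] with x hx
      rw [Finset.sum_congr rfl hx]
      have hm' : m = fun y => ∑ z ∈ s, f z y := funext hsum
      cases k with
      | none => simp only [mulFun, hsum x, Finset.sum_mul]
      | some i =>
        simp only [mulFun, Finset.sum_add_distrib, ← Finset.sum_mul]
        rw [hsum x, hm', pderiv_sum s (fun z => (hf z).smooth)]
    rw [e]
    -- The closure of a linear range is a subspace, so the finitely many local pieces may be
    -- approximated separately.
    have hcl : closure (range (testToH1 U univ)) =
        ((LinearMap.range (testToH1 U univ)).topologicalClosure : Set (H1 U)) := by
      rw [Submodule.topologicalClosure_coe]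
      rfl
    rw [hcl]
    refine Submodule.sum_mem _ fun z _ => ?_
    have := mulH1_mem_closure_of_local hU (hr z) (hc z) (ht₀ z) (h z) (hf z) (hfs z) u
    rw [hcl] at this
    exact this
  intro u
  obtain ⟨m, hm, hb, hlim, C, hC⟩ := exists_cutoff_infinity d
  refine isClosed_closure.mem_of_tendsto
    (tendsto_mulH1 hU.measurableSet (fun n => (hm n).isMultiplier) u hb (fun x _ => hlim x) ?_)
    (Filter.Eventually.of_forall fun n => hcpt (m n) (hm n) u)
  intro i
  have hb2 : ∀ n : ℕ, ∫⁻ x in U, ‖pderiv (m n) i x * u.1 none x‖ₑ ^ 2 ≤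
      ENNReal.ofReal (C * ((n : ℝ) + 1)⁻¹) ^ 2 * ‖u.1 none‖ₑ ^ 2 := by
    intro n
    rw [← lintegral_enorm_sq_eq, ← lintegral_const_mul' _ _ (by simp)]
    refine lintegral_mono fun x => ?_
    rw [enorm_mul, mul_pow]
    gcongr
    rw [← ofReal_norm]
    exact ENNReal.ofReal_le_ofReal (hC n i x)
  refine tendsto_of_tendsto_of_tendsto_of_le_of_le tendsto_const_nhds ?_ (fun _ => bot_le) hb2
  have h1 : Filter.Tendsto (fun n : ℕ => C * ((n : ℝ) + 1)⁻¹) Filter.atTop (𝓝 0) := by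
    have := (tendsto_one_div_add_atTop_nhds_zero_nat (𝕜 := ℝ)).const_mul C
    simpa using this
  have h2 := (ENNReal.continuous_ofReal.tendsto 0).comp h1
  have h3 := ENNReal.Tendsto.mul_const (b := ‖u.1 none‖ₑ ^ 2) (ENNReal.Tendsto.pow (n := 2) h2)
    (Or.inr (by simp))
  simpa [Function.comp_def] using h3

theorem hasInteriorDirections_univ : HasInteriorDirections (univ : Set (Rd d)) :=
  fun _ => ⟨0, 1, 1, 1, one_pos, one_pos, one_pos, fun _ _ _ _ _ => subset_univ _⟩

end

/-! ## Estimates along lines -/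

theorem enorm_sub_sq_le_lintegral_deriv {h h' : ℝ → ℂ} (hd : ∀ t, HasDerivAt h (h' t) t)
    (hc : Continuous h') {ε τ : ℝ} (hτ : τ ∈ Ioo 0 ε) :
    ‖h τ - h 0‖ₑ ^ 2 ≤ ENNReal.ofReal ε * ∫⁻ t in Ioo 0 ε, ‖h' t‖ₑ ^ 2 := by
  have e := intervalIntegral.integral_eq_sub_of_hasDerivAt (a := 0) (b := τ) (fun t _ => hd t)
    (hc.intervalIntegrable _ _)
  rw [intervalIntegral.integral_of_le hτ.1.le] at e
  rw [← e]
  have h1 : ‖∫ t in Ioc 0 τ, h' t‖ₑ ≤ ∫⁻ t in Ioo 0 ε, 1 * ‖h' t‖ₑ := by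
    refine (enorm_integral_le_lintegral_enorm _).trans ?_
    simp only [one_mul]
    exact lintegral_mono_set fun t ht => ⟨ht.1, ht.2.trans_lt hτ.2⟩
  calc ‖∫ t in Ioc 0 τ, h' t‖ₑ ^ 2 ≤ (∫⁻ t in Ioo 0 ε, 1 * ‖h' t‖ₑ) ^ 2 := by gcongr
    _ ≤ (∫⁻ _ in Ioo 0 ε, 1 ^ 2) * ∫⁻ t in Ioo 0 ε, ‖h' t‖ₑ ^ 2 :=
        sq_lintegral_mul_le _ aemeasurable_const hc.measurable.enorm.aemeasurable
    _ = _ := by simp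

/-- The starting value plus the integral of the derivative controls the segment. This direction
serves functions with zero trace, for which the starting value drops out and a factor of order `ε²`
remains. -/
theorem lintegral_line_le {h h' : ℝ → ℂ} (hd : ∀ t, HasDerivAt h (h' t) t)
    (hc : Continuous h') (ε : ℝ) :
    ∫⁻ t in Ioo 0 ε, ‖h t‖ₑ ^ 2 ≤ 2 * ENNReal.ofReal ε * ‖h 0‖ₑ ^ 2 +
      2 * ENNReal.ofReal ε ^ 2 * ∫⁻ t in Ioo 0 ε, ‖h' t‖ₑ ^ 2 := by
  have hb : ∀ t ∈ Ioo 0 ε, ‖h t‖ₑ ^ 2 ≤ 2 * ‖h 0‖ₑ ^ 2 +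
      2 * (ENNReal.ofReal ε * ∫⁻ t in Ioo 0 ε, ‖h' t‖ₑ ^ 2) := by
    intro t ht
    calc ‖h t‖ₑ ^ 2 = ‖h 0 + (h t - h 0)‖ₑ ^ 2 := by simp
      _ ≤ 2 * ‖h 0‖ₑ ^ 2 + 2 * ‖h t - h 0‖ₑ ^ 2 := enorm_add_sq_le _ _
      _ ≤ _ := by gcongr; exact enorm_sub_sq_le_lintegral_deriv hd hc ht
  calc ∫⁻ t in Ioo 0 ε, ‖h t‖ₑ ^ 2 ≤ ∫⁻ _ in Ioo 0 ε, (2 * ‖h 0‖ₑ ^ 2 +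
      2 * (ENNReal.ofReal ε * ∫⁻ t in Ioo 0 ε, ‖h' t‖ₑ ^ 2)) :=
        setLIntegral_mono' measurableSet_Ioo hb
    _ = _ := by
      rw [lintegral_const, Measure.restrict_apply_univ, Real.volume_Ioo, sub_zero]
      ring

/-- The opposite comparison, averaged over the segment; it is the one-dimensional form of the trace
inequality. -/
theorem line_start_le {h h' : ℝ → ℂ} (hd : ∀ t, HasDerivAt h (h' t) t)
    (hc : Continuous h') (ε : ℝ) :
    ENNReal.ofReal ε * ‖h 0‖ₑ ^ 2 ≤ 2 * (∫⁻ t in Ioo 0 ε, ‖h t‖ₑ ^ 2) +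
      2 * ENNReal.ofReal ε ^ 2 * ∫⁻ t in Ioo 0 ε, ‖h' t‖ₑ ^ 2 := by
  have hcont : Continuous h := continuous_iff_continuousAt.mpr fun t => (hd t).continuousAt
  have hb : ∀ t ∈ Ioo 0 ε, ‖h 0‖ₑ ^ 2 ≤ 2 * ‖h t‖ₑ ^ 2 +
      2 * (ENNReal.ofReal ε * ∫⁻ t in Ioo 0 ε, ‖h' t‖ₑ ^ 2) := by
    intro t ht
    calc ‖h 0‖ₑ ^ 2 = ‖h t + -(h t - h 0)‖ₑ ^ 2 := by simp
      _ ≤ 2 * ‖h t‖ₑ ^ 2 + 2 * ‖-(h t - h 0)‖ₑ ^ 2 := enorm_add_sq_le _ _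
      _ ≤ _ := by rw [enorm_neg]; gcongr; exact enorm_sub_sq_le_lintegral_deriv hd hc ht
  calc ENNReal.ofReal ε * ‖h 0‖ₑ ^ 2 = ∫⁻ _ in Ioo 0 ε, ‖h 0‖ₑ ^ 2 := by
        rw [lintegral_const, Measure.restrict_apply_univ, Real.volume_Ioo, sub_zero, mul_comm]
    _ ≤ ∫⁻ t in Ioo 0 ε, (2 * ‖h t‖ₑ ^ 2 +
      2 * (ENNReal.ofReal ε * ∫⁻ t in Ioo 0 ε, ‖h' t‖ₑ ^ 2)) :=
        setLIntegral_mono' measurableSet_Ioo hb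
    _ = _ := by
      rw [lintegral_add_right _ measurable_const, lintegral_const, Measure.restrict_apply_univ,
        Real.volume_Ioo, sub_zero, lintegral_const_mul' _ _ (by simp)]
      ring

/-! ## Lipschitz graphs -/

/-- Near `x₀`, in orthonormal coordinates with last direction `e`, the set `Ω` is the region above
a Lipschitz graph and `Γ` is the graph. -/
structure GraphChart {d : ℕ} (Ω Γ : Set (Rd d)) (x₀ : Rd d) where
  e : Rd d
  g : Rd d → ℝ
  K : ℝ≥0
  r : ℝ
  norm_e : ‖e‖ = 1
  lip : LipschitzWith K g
  inv : ∀ (y : Rd d) (t : ℝ), g (y + t • e) = g y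
  r_pos : 0 < r
  mem_iff : ∀ y ∈ Metric.ball x₀ r, (y ∈ Ω ↔ g y < inner ℝ e y)
  mem_bdry_iff : ∀ y ∈ Metric.ball x₀ r, (y ∈ Γ ↔ g y = inner ℝ e y)

namespace GraphChart

variable {d : ℕ} {Ω Γ : Set (Rd d)} {x₀ : Rd d} (c : GraphChart Ω Γ x₀)

/-- The hyperplane of horizontal directions. -/
abbrev H : Submodule ℝ (Rd d) := (Submodule.span ℝ {c.e})ᗮ

/-- The height over the graph. -/
def height (y : Rd d) : ℝ := inner ℝ c.e y - c.g y

/-- The vertical projection to the graph. -/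
def foot (y : Rd d) : Rd d := y - c.height y • c.e

/-- The graph map. -/
def graph (y : c.H) : Rd d := (y : Rd d) + c.g y • c.e

/-- Coordinates straightening the graph. -/
def flat (p : c.H × ℝ) : Rd d := c.graph p.1 + p.2 • c.e

theorem inner_e_e : inner ℝ c.e c.e = (1 : ℝ) := by
  rw [real_inner_self_eq_norm_sq, c.norm_e]; norm_num

theorem inner_e_H (y : c.H) : inner ℝ c.e (y : Rd d) = (0 : ℝ) :=
  Submodule.mem_orthogonal_singleton_iff_inner_right.mp y.2

theorem height_add (y : Rd d) (t : ℝ) : c.height (y + t • c.e) = c.height y + t := by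
  rw [height, height, c.inv, inner_add_right, inner_smul_right, c.inner_e_e]
  ring

theorem height_graph (y : c.H) : c.height (c.graph y) = 0 := by
  rw [graph, height_add, height, c.inner_e_H]
  ring

theorem height_flat (p : c.H × ℝ) : c.height (c.flat p) = p.2 := by
  rw [flat, height_add, height_graph, zero_add]

theorem foot_flat (p : c.H × ℝ) : c.foot (c.flat p) = c.graph p.1 := by
  rw [foot, height_flat, flat, add_sub_cancel_right]

theorem continuous_g : Continuous c.g := c.lip.continuous

theorem continuous_height : Continuous c.height := by
  have := c.continuous_g
  unfold height
  fun_prop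

theorem continuous_foot : Continuous c.foot := by
  have := c.continuous_height
  unfold foot
  fun_prop

theorem abs_height_sub_le (y z : Rd d) : |c.height y - c.height z| ≤ (1 + c.K) * dist y z := by
  have h1 := c.lip.dist_le_mul y z
  rw [Real.dist_eq] at h1
  have h2 : |inner ℝ c.e (y - z)| ≤ dist y z := by
    rw [dist_eq_norm]
    simpa [c.norm_e] using abs_real_inner_le_norm c.e (y - z)
  rw [inner_sub_right] at h2
  calc |c.height y - c.height z|
      = |(inner ℝ c.e y - inner ℝ c.e z) - (c.g y - c.g z)| := by
        unfold height; congr 1; ring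
    _ ≤ |inner ℝ c.e y - inner ℝ c.e z| + |c.g y - c.g z| := abs_sub _ _
    _ ≤ _ := by linarith

theorem lipschitz_graph : LipschitzWith (1 + c.K) c.graph := by
  refine LipschitzWith.of_dist_le_mul fun y z => ?_
  have h1 := c.lip.dist_le_mul (y : Rd d) z
  rw [dist_eq_norm, graph, graph]
  have : (y : Rd d) + c.g y • c.e - (z + c.g z • c.e) = (y - z : Rd d) + (c.g y - c.g z) • c.e := by
    rw [sub_smul]; abel
  rw [this]
  refine (norm_add_le _ _).trans ?_
  rw [norm_smul, c.norm_e, mul_one, ← dist_eq_norm, ← dist_eq_norm]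
  rw [Subtype.dist_eq]
  push_cast
  linarith

theorem exists_graph_eq_foot (y : Rd d) : ∃ z : c.H, c.graph z = c.foot y := by
  refine ⟨⟨y - (inner ℝ c.e y : ℝ) • c.e, ?_⟩, ?_⟩
  · rw [Submodule.mem_orthogonal_singleton_iff_inner_right, inner_sub_right, inner_smul_right,
      c.inner_e_e]
    ring
  · have : c.g (y - (inner ℝ c.e y : ℝ) • c.e) = c.g y := by
      have := c.inv y (-(inner ℝ c.e y : ℝ))
      rwa [neg_smul, ← sub_eq_add_neg] at this
    simp only [graph, foot, height, this, sub_smul]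
    abel

/-- Straightening the graph is a shear followed by an orthonormal change of coordinates. The shear
translates each vertical line, so it preserves measure without any differentiability of `g`. -/
theorem measurePreserving_flat :
    MeasurePreserving c.flat ((volume : Measure c.H).prod (volume : Measure ℝ)) volume := by
  have h1 : MeasurePreserving (fun p : c.H × ℝ => (p.1, c.g p.1 + p.2))
      ((volume : Measure c.H).prod (volume : Measure ℝ)) (volume.prod volume) := by
    refine (MeasurePreserving.id (volume : Measure c.H)).skew_product
      (g := fun (y : c.H) (t : ℝ) => c.g y + t) ?_ ?_
    · have := c.continuous_g
      exact (by fun_prop : Continuous fun p : c.H × ℝ => c.g p.1 + p.2).measurable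
    · exact Filter.Eventually.of_forall fun y => (measurePreserving_add_left volume (c.g y)).map_eq
  have h2 : MeasurePreserving (Prod.swap : c.H × ℝ → ℝ × c.H) (volume.prod volume)
      (volume.prod volume) := Measure.measurePreserving_swap
  have h3 : MeasurePreserving (Prod.map (LinearIsometryEquiv.toSpanUnitSingleton (𝕜 := ℝ) c.e c.norm_e)
      (id : c.H → c.H)) ((volume : Measure ℝ).prod volume) (volume.prod volume) :=
    (LinearIsometryEquiv.toSpanUnitSingleton (𝕜 := ℝ) c.e c.norm_e).measurePreserving.prod
      (MeasurePreserving.id _)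
  have h4 := ((Submodule.span ℝ {c.e}).measurePreserving_measurableEquivProd (0 : Rd d)).symm
  rw [InnerProductSpace.euclideanHausdorffMeasure_eq_volume] at h4
  have h5 := h4.comp (h3.comp (h2.comp h1))
  have e : c.flat = ((Submodule.span ℝ {c.e}).measurableEquivProd (0 : Rd d)).symm ∘
      Prod.map (LinearIsometryEquiv.toSpanUnitSingleton (𝕜 := ℝ) c.e c.norm_e) (id : c.H → c.H) ∘
        Prod.swap ∘ fun p : c.H × ℝ => (p.1, c.g p.1 + p.2) := by
    funext p
    simp [flat, graph, add_smul]
    abel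
  rw [e]
  exact h5

/-- The layer of height `ε` over the part of the graph in the ball of radius `ρ`. -/
def layer (ρ ε : ℝ) : Set (Rd d) :=
  c.foot ⁻¹' Metric.ball x₀ ρ ∩ c.height ⁻¹' Ioo 0 ε

/-- The parameters of the part of the graph in the ball of radius `ρ`. -/
def base (ρ : ℝ) : Set c.H := c.graph ⁻¹' Metric.ball x₀ ρ

theorem mem_layer {ρ ε : ℝ} {y : Rd d} :
    y ∈ c.layer ρ ε ↔ dist (c.foot y) x₀ < ρ ∧ 0 < c.height y ∧ c.height y < ε := by
  rw [layer, mem_inter_iff, mem_preimage, mem_preimage, Metric.mem_ball, mem_Ioo]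

theorem measurableSet_layer (ρ ε : ℝ) : MeasurableSet (c.layer ρ ε) :=
  (c.continuous_foot.measurable measurableSet_ball).inter
    (c.continuous_height.measurable measurableSet_Ioo)

theorem dist_foot (y : Rd d) : dist y (c.foot y) = |c.height y| := by
  rw [foot, dist_eq_norm, sub_sub_cancel, norm_smul, c.norm_e, mul_one, Real.norm_eq_abs]

theorem layer_subset_ball {ρ ε : ℝ} : c.layer ρ ε ⊆ Metric.ball x₀ (ρ + ε) := by
  intro y hy
  obtain ⟨h1, h2, h2'⟩ := c.mem_layer.mp hy
  have h3 := c.dist_foot y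
  rw [abs_of_pos h2] at h3
  rw [Metric.mem_ball]
  have := dist_triangle y (c.foot y) x₀
  linarith

theorem layer_subset {ρ ε : ℝ} (h : ρ + ε ≤ c.r) : c.layer ρ ε ⊆ Ω := by
  intro y hy
  rw [c.mem_iff y (Metric.ball_subset_ball h (c.layer_subset_ball hy))]
  have := (c.mem_layer.mp hy).2.1
  unfold height at this
  linarith

theorem foot_mem {ρ ε : ℝ} (h : ρ ≤ c.r) {y : Rd d} (hy : y ∈ c.layer ρ ε) : c.foot y ∈ Γ := by
  rw [c.mem_bdry_iff _ (Metric.ball_subset_ball h (Metric.mem_ball.mpr (c.mem_layer.mp hy).1))]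
  obtain ⟨z, hz⟩ := c.exists_graph_eq_foot y
  have := c.height_graph z
  rw [hz] at this
  unfold height at this
  linarith

theorem layer_subset_thickening {ρ ε : ℝ} (h : ρ + ε ≤ c.r) (hε : 0 < ε) :
    c.layer ρ ε ⊆ Ω ∩ Metric.thickening ε Γ := by
  intro y hy
  refine ⟨c.layer_subset h hy, ?_⟩
  rw [Metric.mem_thickening_iff]
  refine ⟨c.foot y, c.foot_mem (by linarith) hy, ?_⟩
  rw [c.dist_foot, abs_of_pos (c.mem_layer.mp hy).2.1]
  exact (c.mem_layer.mp hy).2.2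

/-- The height is `(1 + K)`-Lipschitz and vanishes on the graph, so a point at distance less than
`ε` from the graph has height below `(1 + K) ε`. Its foot is displaced by exactly that height,
whence the enlarged radius. -/
theorem inter_thickening_subset_layer {ρ ε : ℝ}
    (h : ρ + ε + (1 + c.K) * ε ≤ c.r) {S : Set (Rd d)} (hS : S ⊆ Γ ∩ Metric.ball x₀ ρ) :
    Ω ∩ Metric.thickening ε S ⊆ c.layer (ρ + ε + (1 + c.K) * ε) ((1 + c.K) * ε) := by
  rintro y ⟨hyΩ, hy⟩
  rw [Metric.mem_thickening_iff] at hy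
  obtain ⟨p, hp, hyp⟩ := hy
  have hε : 0 < ε := dist_nonneg.trans_lt hyp
  have hKε : 0 ≤ (1 + (c.K : ℝ)) * ε := by positivity
  have hpb : p ∈ Metric.ball x₀ ρ := (hS hp).2
  have hp0 : c.height p = 0 := by
    have := (c.mem_bdry_iff p (Metric.ball_subset_ball (by linarith) hpb)).mp (hS hp).1
    unfold height
    linarith
  have hyb : dist y x₀ < ρ + ε := by
    rw [Metric.mem_ball] at hpb
    have := dist_triangle y p x₀
    linarith
  have hpos : 0 < c.height y := by
    have := (c.mem_iff y (Metric.ball_subset_ball (by linarith) hyb)).mp hyΩ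
    unfold height
    linarith
  have hlt : c.height y < (1 + c.K) * ε := by
    have h1 := c.abs_height_sub_le y p
    rw [hp0, sub_zero, abs_of_pos hpos] at h1
    have : (1 + (c.K : ℝ)) * dist y p < (1 + c.K) * ε := by gcongr
    linarith
  refine c.mem_layer.mpr ⟨?_, hpos, hlt⟩
  have h3 := c.dist_foot y
  rw [abs_of_pos hpos, dist_comm] at h3
  have := dist_triangle (c.foot y) y x₀
  linarith

theorem image_base {ρ : ℝ} (h : ρ ≤ c.r) : c.graph '' c.base ρ = Γ ∩ Metric.ball x₀ ρ := by
  ext y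
  constructor
  · rintro ⟨z, hz, rfl⟩
    refine ⟨?_, hz⟩
    rw [c.mem_bdry_iff _ (Metric.ball_subset_ball h hz)]
    have := c.height_graph z
    unfold height at this
    linarith
  · rintro ⟨hy, hyb⟩
    have h0 : c.height y = 0 := by
      have := (c.mem_bdry_iff y (Metric.ball_subset_ball h hyb)).mp hy
      unfold height
      linarith
    obtain ⟨z, hz⟩ := c.exists_graph_eq_foot y
    rw [foot, h0, zero_smul, sub_zero] at hz
    exact ⟨z, by rw [base, mem_preimage, hz]; exact hyb, hz⟩

/-- Fubini's theorem in a layer. -/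
theorem lintegral_layer (ρ ε : ℝ) {f : Rd d → ℝ≥0∞} (hf : Measurable f) :
    ∫⁻ y in c.layer ρ ε, f y =
      ∫⁻ z in c.base ρ, ∫⁻ t in Ioo 0 ε, f (c.graph z + t • c.e) := by
  have hpre : c.flat ⁻¹' c.layer ρ ε = c.base ρ ×ˢ Ioo 0 ε := by
    ext p
    simp only [layer, base, mem_preimage, mem_inter_iff, mem_prod, c.foot_flat, c.height_flat]
  rw [← c.measurePreserving_flat.setLIntegral_comp_preimage (c.measurableSet_layer ρ ε) hf, hpre,
    ← Measure.prod_restrict, lintegral_prod]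
  · rfl
  · exact (hf.comp c.measurePreserving_flat.measurable).aemeasurable

/-! ### Surface measure on a graph -/

theorem finrank_H : Module.finrank ℝ c.H = d - 1 := by
  have h := (Submodule.span ℝ {c.e}).finrank_add_finrank_orthogonal
  have he : c.e ≠ 0 := by
    intro h0
    have := c.norm_e
    rw [h0, norm_zero] at this
    norm_num at this
  rw [finrank_span_singleton he, finrank_euclideanSpace, Fintype.card_fin] at h
  change Module.finrank ℝ (Submodule.span ℝ {c.e})ᗮ = d - 1
  omega

theorem volume_H : (volume : Measure c.H) = μHE[d - 1] := by
  rw [← c.finrank_H, InnerProductSpace.euclideanHausdorffMeasure_eq_volume]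

end GraphChart

/-- The Euclidean normalization multiplies both Hausdorff measures by the same constant, depending
only on `n`. -/
theorem LipschitzWith.euclideanHausdorffMeasure_image_le {X Y : Type*} [EMetricSpace X]
    [MeasurableSpace X] [BorelSpace X] [EMetricSpace Y] [MeasurableSpace Y] [BorelSpace Y]
    {K : ℝ≥0} {f : X → Y} (h : LipschitzWith K f) (n : ℕ) (s : Set X) :
    μHE[n] (f '' s) ≤ (K : ℝ≥0∞) ^ n * μHE[n] s := by
  have h1 := h.hausdorffMeasure_image_le (d := n) (by positivity) s
  rw [ENNReal.rpow_natCast] at h1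
  simp only [Measure.euclideanHausdorffMeasure_def, Measure.smul_apply, ENNReal.smul_def,
    smul_eq_mul]
  rw [mul_left_comm]
  gcongr

namespace GraphChart

variable {d : ℕ} {Ω Γ : Set (Rd d)} {x₀ : Rd d} (c : GraphChart Ω Γ x₀)

/-- The graph map is `(1 + K)`-Lipschitz. Together with the converse bound, this two-sided
comparison of surface measure with Lebesgue measure on the base replaces the area formula. -/
theorem surf_le_map_graph {ρ : ℝ} (h : ρ ≤ c.r) :
    (μHE[d - 1] : Measure (Rd d)).restrict (Γ ∩ Metric.ball x₀ ρ) ≤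
      ((1 + c.K : ℝ≥0) : ℝ≥0∞) ^ (d - 1) • (volume.restrict (c.base ρ)).map c.graph := by
  have hgm : Measurable c.graph := c.lipschitz_graph.continuous.measurable
  refine Measure.le_iff.mpr fun S hS => ?_
  rw [Measure.restrict_apply hS, Measure.smul_apply, Measure.map_apply hgm hS,
    Measure.restrict_apply (hgm hS), smul_eq_mul, c.volume_H]
  have e : S ∩ (Γ ∩ Metric.ball x₀ ρ) = c.graph '' (c.graph ⁻¹' S ∩ c.base ρ) := by
    rw [image_preimage_inter, c.image_base h]
  rw [e]
  exact LipschitzWith.euclideanHausdorffMeasure_image_le c.lipschitz_graph _ _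

/-- Orthogonal projection to the hyperplane is a `1`-Lipschitz left inverse of the graph map, so it
does not increase Hausdorff measure. -/
theorem map_graph_le_surf {ρ : ℝ} (h : ρ ≤ c.r) :
    (volume.restrict (c.base ρ)).map c.graph ≤
      (μHE[d - 1] : Measure (Rd d)).restrict (Γ ∩ Metric.ball x₀ ρ) := by
  have hgm : Measurable c.graph := c.lipschitz_graph.continuous.measurable
  refine Measure.le_iff.mpr fun S hS => ?_
  rw [Measure.restrict_apply hS, Measure.map_apply hgm hS,
    Measure.restrict_apply (hgm hS), c.volume_H]
  have e : S ∩ (Γ ∩ Metric.ball x₀ ρ) = c.graph '' (c.graph ⁻¹' S ∩ c.base ρ) := by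
    rw [image_preimage_inter, c.image_base h]
  rw [e]
  set P : Rd d → c.H := fun y => c.H.orthogonalProjectionOnto y with hP
  have hPl : LipschitzWith 1 P := by
    refine LipschitzWith.of_dist_le_mul fun y z => ?_
    simp only [hP, NNReal.coe_one, one_mul, dist_eq_norm, ← map_sub]
    exact c.H.norm_orthogonalProjectionOnto_apply_le _
  have hPg : ∀ y, P (c.graph y) = y := by
    intro y
    have he : c.e ∈ c.Hᗮ := by
      rw [Submodule.orthogonal_orthogonal]
      exact Submodule.mem_span_singleton_self _
    simp only [hP, graph]
    rw [map_add, map_smul, Submodule.orthogonalProjectionOnto_mem_subspace_eq_self,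
      Submodule.orthogonalProjectionOnto_eq_zero_iff.mpr he, smul_zero,
      add_zero]
  have h1 := LipschitzWith.euclideanHausdorffMeasure_image_le hPl (d - 1)
    (c.graph '' (c.graph ⁻¹' S ∩ c.base ρ))
  rw [image_image] at h1
  simpa only [hPg, image_id', ENNReal.coe_one, one_pow, one_mul] using h1

theorem lintegral_surf_le {ρ : ℝ} (h : ρ ≤ c.r) {f : Rd d → ℝ≥0∞} (hf : Measurable f) :
    ∫⁻ x in Γ ∩ Metric.ball x₀ ρ, f x ∂μHE[d - 1] ≤
      ((1 + c.K : ℝ≥0) : ℝ≥0∞) ^ (d - 1) * ∫⁻ y in c.base ρ, f (c.graph y) := by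
  refine (lintegral_mono' (c.surf_le_map_graph h) le_rfl).trans (le_of_eq ?_)
  rw [lintegral_smul_measure, smul_eq_mul,
    lintegral_map hf c.lipschitz_graph.continuous.measurable]

theorem lintegral_base_le {ρ : ℝ} (h : ρ ≤ c.r) {f : Rd d → ℝ≥0∞} (hf : Measurable f) :
    ∫⁻ y in c.base ρ, f (c.graph y) ≤ ∫⁻ x in Γ ∩ Metric.ball x₀ ρ, f x ∂μHE[d - 1] := by
  rw [← lintegral_map hf c.lipschitz_graph.continuous.measurable]
  exact lintegral_mono' (c.map_graph_le_surf h) le_rfl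

end GraphChart

/-! ## Trace and layer estimates -/

theorem lintegral_enorm_sq_le {α : Type*} [MeasurableSpace α] {μ : Measure α} {f g : α → ℂ}
    (hg : AEMeasurable g μ) :
    ∫⁻ x, ‖f x‖ₑ ^ 2 ∂μ ≤ 2 * ∫⁻ x, ‖g x‖ₑ ^ 2 ∂μ + 2 * ∫⁻ x, ‖f x - g x‖ₑ ^ 2 ∂μ := by
  rw [← lintegral_const_mul' _ _ (by simp), ← lintegral_const_mul' _ _ (by simp),
    ← lintegral_add_left' ((hg.enorm.pow_const 2).const_mul 2)]
  refine lintegral_mono fun x => ?_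
  calc ‖f x‖ₑ ^ 2 = ‖g x + (f x - g x)‖ₑ ^ 2 := by simp
    _ ≤ _ := enorm_add_sq_le _ _

section

variable {d : ℕ}

/-- `|∇φ|²` -/
def gradSq (φ : Rd d → ℂ) (x : Rd d) : ℝ≥0∞ := ∑ i, ‖pderiv φ i x‖ₑ ^ 2

theorem measurable_gradSq {φ : Rd d → ℂ} (hφ : ContDiff ℝ ∞ φ) : Measurable (gradSq φ) :=
  Finset.measurable_fun_sum _ fun i _ => (continuous_pderiv hφ i).measurable.enorm.pow_const 2

theorem enorm_fderiv_sq_le (φ : Rd d → ℂ) (x : Rd d) {e : Rd d} (he : ‖e‖ = 1) :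
    ‖fderiv ℝ φ x e‖ₑ ^ 2 ≤ gradSq φ x := by
  have h1 : fderiv ℝ φ x e = ∑ i, e i • pderiv φ i x := by
    conv_lhs => rw [← (EuclideanSpace.basisFun (Fin d) ℝ).sum_repr e]
    simp [pderiv, map_sum]
  have h2 : ‖fderiv ℝ φ x e‖ ^ 2 ≤ ∑ i, ‖pderiv φ i x‖ ^ 2 := by
    rw [h1]
    calc ‖∑ i, e i • pderiv φ i x‖ ^ 2 ≤ (∑ i, ‖e i‖ * ‖pderiv φ i x‖) ^ 2 := by
          gcongr
          refine (norm_sum_le _ _).trans (le_of_eq ?_)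
          simp
      _ ≤ (∑ i, ‖e i‖ ^ 2) * ∑ i, ‖pderiv φ i x‖ ^ 2 := Finset.sum_mul_sq_le_sq_mul_sq _ _ _
      _ = _ := by rw [← EuclideanSpace.norm_sq_eq, he]; simp
  have h3 := ENNReal.ofReal_le_ofReal h2
  rw [ENNReal.ofReal_sum_of_nonneg fun _ _ => by positivity] at h3
  simpa only [gradSq, ENNReal.ofReal_pow (norm_nonneg _), ofReal_norm] using h3

theorem hasDerivAt_line {φ : Rd d → ℂ} (hφ : ContDiff ℝ ∞ φ) (p e : Rd d) (t : ℝ) :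
    HasDerivAt (fun t : ℝ => φ (p + t • e)) (fderiv ℝ φ (p + t • e) e) t := by
  have h1 : HasDerivAt (fun t : ℝ => p + t • e) e t := by
    simpa using ((hasDerivAt_id t).smul_const e).const_add p
  exact (hφ.differentiable (by simp) _).hasFDerivAt.comp_hasDerivAt t h1

theorem continuous_fderiv_line {φ : Rd d → ℂ} (hφ : ContDiff ℝ ∞ φ) (p e : Rd d) :
    Continuous fun t : ℝ => fderiv ℝ φ (p + t • e) e :=
  ((hφ.continuous_fderiv (by simp)).comp (by fun_prop)).clm_apply continuous_const

namespace GraphChart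

variable {Ω Γ : Set (Rd d)} {x₀ : Rd d} (c : GraphChart Ω Γ x₀)

theorem lintegral_layer_le (ρ ε : ℝ) {φ : Rd d → ℂ} (hφ : ContDiff ℝ ∞ φ) :
    ∫⁻ y in c.layer ρ ε, ‖φ y‖ₑ ^ 2 ≤
      2 * ENNReal.ofReal ε * (∫⁻ z in c.base ρ, ‖φ (c.graph z)‖ₑ ^ 2) +
      2 * ENNReal.ofReal ε ^ 2 * ∫⁻ y in c.layer ρ ε, gradSq φ y := by
  rw [c.lintegral_layer ρ ε (hφ.continuous.measurable.enorm.pow_const 2),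
    c.lintegral_layer ρ ε (measurable_gradSq hφ),
    ← lintegral_const_mul' _ _ (ENNReal.mul_ne_top (by simp) (by simp)),
    ← lintegral_const_mul' _ _ (ENNReal.mul_ne_top (by simp) (by simp)),
    ← lintegral_add_left]
  · refine lintegral_mono fun z => ?_
    have h := lintegral_line_le (fun t => hasDerivAt_line hφ (c.graph z) c.e t)
      (continuous_fderiv_line hφ (c.graph z) c.e) ε
    simp only [zero_smul, add_zero] at h
    refine h.trans ?_
    gcongr with t
    exact enorm_fderiv_sq_le φ _ c.norm_e
  · exact ((hφ.continuous.comp c.lipschitz_graph.continuous).measurable.enorm.pow_const 2).const_mul _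

theorem lintegral_base_le_layer (ρ ε : ℝ) {φ : Rd d → ℂ} (hφ : ContDiff ℝ ∞ φ) :
    ENNReal.ofReal ε * (∫⁻ z in c.base ρ, ‖φ (c.graph z)‖ₑ ^ 2) ≤
      2 * (∫⁻ y in c.layer ρ ε, ‖φ y‖ₑ ^ 2) +
      2 * ENNReal.ofReal ε ^ 2 * ∫⁻ y in c.layer ρ ε, gradSq φ y := by
  rw [c.lintegral_layer ρ ε (hφ.continuous.measurable.enorm.pow_const 2),
    c.lintegral_layer ρ ε (measurable_gradSq hφ),
    ← lintegral_const_mul' _ _ (by simp), ← lintegral_const_mul' _ _ (by simp),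
    ← lintegral_const_mul' _ _ (ENNReal.mul_ne_top (by simp) (by simp)),
    ← lintegral_add_left]
  · refine lintegral_mono fun z => ?_
    have h := line_start_le (fun t => hasDerivAt_line hφ (c.graph z) c.e t)
      (continuous_fderiv_line hφ (c.graph z) c.e) ε
    simp only [zero_smul, add_zero] at h
    refine h.trans ?_
    gcongr with t
    exact enorm_fderiv_sq_le φ _ c.norm_e
  · refine Measurable.const_mul ?_ _
    have hm : Measurable fun p : c.H × ℝ => ‖φ (c.graph p.1 + p.2 • c.e)‖ₑ ^ 2 := by
      have := c.lipschitz_graph.continuous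
      exact ((hφ.continuous.comp
        (by fun_prop : Continuous fun p : c.H × ℝ => c.graph p.1 + p.2 • c.e)).measurable.enorm.pow_const 2)
    exact hm.lintegral_prod_right'

end GraphChart

/-- `Ω` is open, its boundary `Γ` is compact, and near each point of `Γ` the set `Ω` is the region
above a Lipschitz graph. -/
structure IsLipschitzPair (Ω Γ : Set (Rd d)) : Prop where
  isOpen : IsOpen Ω
  compact : IsCompact Γ
  frontier_eq : frontier Ω = Γ
  chart : ∀ x ∈ Γ, Nonempty (GraphChart Ω Γ x)

theorem enorm_sq_testToH1 {U V : Set (Rd d)} (φ : testFns V) :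
    ‖testToH1 U V φ‖ₑ ^ 2 = (∫⁻ x in U, ‖φ.1 x‖ₑ ^ 2) + ∫⁻ x in U, gradSq φ.1 x := by
  have e : ∀ k, ∫⁻ x in U, ‖(testToH1 U V φ).1 k x‖ₑ ^ 2 = ∫⁻ x in U, ‖jet φ.1 k x‖ₑ ^ 2 := by
    intro k
    refine lintegral_congr_ae ?_
    filter_upwards [testToH1_coeFn (U := U) φ k] with x hx
    rw [hx]
  rw [enorm_sq_H1]
  simp only [e, Fintype.sum_option]
  congr 1
  simp only [gradSq]
  rw [lintegral_finsetSum]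
  · rfl
  · exact fun i _ => (continuous_pderiv φ.2.smooth i).measurable.enorm.pow_const 2

/-- In a layer, a function with vanishing trace is bounded by its gradient. -/
theorem GraphChart.lintegral_layer_le_of_trace_zero {Ω Γ : Set (Rd d)} {x₀ : Rd d}
    (c : GraphChart Ω Γ x₀) {z : H1 Ω}
    {φ : ℕ → testFns (univ : Set (Rd d))}
    (hz : Filter.Tendsto (fun n => testToH1 Ω univ (φ n)) Filter.atTop (𝓝 z))
    (hφ : Filter.Tendsto (fun n => ∫⁻ x in Γ, ‖(φ n).1 x‖ₑ ^ 2 ∂μHE[d - 1]) Filter.atTop (𝓝 0))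
    {ρ ε : ℝ} (hε : 0 < ε) (hr : ρ + ε ≤ c.r) :
    ∫⁻ x in c.layer ρ ε, ‖z.1 none x‖ₑ ^ 2 ≤
      8 * ENNReal.ofReal ε ^ 2 * ∑ i, ∫⁻ x in c.layer ρ ε, ‖z.1 (some i) x‖ₑ ^ 2 := by
  set Λ := c.layer ρ ε with hΛ
  have hsub : Λ ⊆ Ω := c.layer_subset hr
  have hmono : volume.restrict Λ ≤ volume.restrict Ω := Measure.restrict_mono hsub le_rfl
  set E := ENNReal.ofReal ε with hE
  have hEt : E ≠ ⊤ := by simp [hE]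
  set D : Option (Fin d) → ℕ → ℝ≥0∞ := fun k n =>
    ∫⁻ x in Ω, ‖(testToH1 Ω univ (φ n)).1 k x - z.1 k x‖ₑ ^ 2 with hD
  have hD0 := tendsto_H1_iff.mp hz
  have hDb : ∀ k n, ∫⁻ x in Λ, ‖jet (φ n).1 k x - z.1 k x‖ₑ ^ 2 ≤ D k n := by
    intro k n
    refine (lintegral_mono_set hsub).trans (le_of_eq (lintegral_congr_ae ?_))
    filter_upwards [testToH1_coeFn (U := Ω) (φ n) k] with x hx
    rw [hx]
  have hjm : ∀ k n, Measurable (jet (φ n).1 k) := fun k n =>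
    (continuous_jet (φ n).2.smooth k).measurable
  have hzm : ∀ k, AEMeasurable (fun x => z.1 k x) (volume.restrict Λ) := fun k =>
    (Lp.aestronglyMeasurable (z.1 k)).aemeasurable.mono_measure hmono
  set b : ℕ → ℝ≥0∞ := fun n => ∫⁻ x in Γ, ‖(φ n).1 x‖ₑ ^ 2 ∂μHE[d - 1] with hb
  -- An `L²` class has no values on lines, so the line estimate is applied to the approximants.
  -- Passing from `z` to `φ n`, the line estimate, and passing back for the gradient each cost a
  -- factor `2`, whence `8`; the remaining terms tend to zero.
  have hstep : ∀ n, ∫⁻ x in Λ, ‖z.1 none x‖ₑ ^ 2 ≤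
      8 * E ^ 2 * (∑ i, ∫⁻ x in Λ, ‖z.1 (some i) x‖ₑ ^ 2) +
        (2 * D none n + 4 * E * b n + 8 * E ^ 2 * ∑ i, D (some i) n) := by
    intro n
    have e1 : ∫⁻ x in Λ, ‖z.1 none x‖ₑ ^ 2 ≤
        2 * (∫⁻ x in Λ, ‖(φ n).1 x‖ₑ ^ 2) + 2 * D none n := by
      refine (lintegral_enorm_sq_le (f := fun x => z.1 none x)
        (hjm none n).aemeasurable).trans ?_
      refine add_le_add le_rfl (mul_le_mul_right ?_ _)
      refine le_trans (le_of_eq (lintegral_congr fun x => ?_)) (hDb none n)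
      rw [← enorm_neg, neg_sub]
    have e2 := c.lintegral_layer_le ρ ε (φ n).2.smooth
    have e3 : ∫⁻ z in c.base ρ, ‖(φ n).1 (c.graph z)‖ₑ ^ 2 ≤ b n :=
      (c.lintegral_base_le (by linarith)
        ((φ n).2.smooth.continuous.measurable.enorm.pow_const 2)).trans
        (lintegral_mono_set inter_subset_left)
    have e4 : ∫⁻ y in Λ, gradSq (φ n).1 y ≤
        ∑ i, (2 * (∫⁻ x in Λ, ‖z.1 (some i) x‖ₑ ^ 2) + 2 * D (some i) n) := by
      simp only [gradSq]
      rw [lintegral_finsetSum _ fun i _ =>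
        (continuous_pderiv (φ n).2.smooth i).measurable.enorm.pow_const 2]
      refine Finset.sum_le_sum fun i _ => ?_
      refine (lintegral_enorm_sq_le (f := pderiv (φ n).1 i) (hzm (some i))).trans ?_
      exact add_le_add le_rfl (mul_le_mul_right (hDb (some i) n) _)
    rw [Finset.sum_add_distrib, ← Finset.mul_sum, ← Finset.mul_sum] at e4
    calc ∫⁻ x in Λ, ‖z.1 none x‖ₑ ^ 2
        ≤ 2 * (2 * E * b n + 2 * E ^ 2 * (2 * (∑ i, ∫⁻ x in Λ, ‖z.1 (some i) x‖ₑ ^ 2) +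
            2 * ∑ i, D (some i) n)) + 2 * D none n := by
          refine e1.trans ?_
          gcongr
          refine e2.trans ?_
          gcongr
      _ = _ := by ring
  have hlim : Filter.Tendsto (fun n => 8 * E ^ 2 * (∑ i, ∫⁻ x in Λ, ‖z.1 (some i) x‖ₑ ^ 2) +
        (2 * D none n + 4 * E * b n + 8 * E ^ 2 * ∑ i, D (some i) n)) Filter.atTop
      (𝓝 (8 * E ^ 2 * (∑ i, ∫⁻ x in Λ, ‖z.1 (some i) x‖ₑ ^ 2) +
        (2 * 0 + 4 * E * 0 + 8 * E ^ 2 * ∑ _i : Fin d, 0))) := by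
    refine tendsto_const_nhds.add (((ENNReal.Tendsto.const_mul (hD0 none) ?_).add
      (ENNReal.Tendsto.const_mul hφ ?_)).add
      (ENNReal.Tendsto.const_mul (tendsto_finsetSum _ fun i _ => hD0 (some i)) ?_))
    · exact Or.inr (by simp)
    · exact Or.inr (ENNReal.mul_ne_top (by simp) hEt)
    · exact Or.inr (ENNReal.mul_ne_top (by simp) (by simp [hEt]))
  have := ge_of_tendsto' hlim hstep
  simpa using this

namespace IsLipschitzPair

variable {Ω Γ : Set (Rd d)}

/-- The trace inequality. -/
theorem exists_trace_bound (h : IsLipschitzPair Ω Γ) : ∃ C : ℝ≥0∞, C ≠ ⊤ ∧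
    ∀ φ : testFns (univ : Set (Rd d)), ∫⁻ x in Γ, ‖φ.1 x‖ₑ ^ 2 ∂μHE[d - 1] ≤
      C * ‖testToH1 Ω univ φ‖ₑ ^ 2 := by
  -- The estimate passes to subsets and to unions, so by compactness it is enough to prove it on the
  -- part of `Γ` in one chart.
  refine h.compact.induction_on (p := fun S => ∃ C : ℝ≥0∞, C ≠ ⊤ ∧
    ∀ φ : testFns (univ : Set (Rd d)), ∫⁻ x in S, ‖φ.1 x‖ₑ ^ 2 ∂μHE[d - 1] ≤
      C * ‖testToH1 Ω univ φ‖ₑ ^ 2) ?_ ?_ ?_ ?_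
  · exact ⟨0, by simp, by simp⟩
  · rintro S T hST ⟨C, hC, hb⟩
    exact ⟨C, hC, fun φ => (lintegral_mono_set hST).trans (hb φ)⟩
  · rintro S T ⟨C, hC, hb⟩ ⟨C', hC', hb'⟩
    refine ⟨C + C', by simp [hC, hC'], fun φ => (lintegral_union_le _ _ _).trans ?_⟩
    rw [add_mul]
    exact add_le_add (hb φ) (hb' φ)
  · intro x hx
    obtain ⟨c⟩ := h.chart x hx
    have hr := c.r_pos
    refine ⟨Γ ∩ Metric.ball x (c.r / 2), ?_, ?_⟩
    · exact inter_mem_nhdsWithin _ (Metric.ball_mem_nhds x (by positivity))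
    set L := ((1 + c.K : ℝ≥0) : ℝ≥0∞) ^ (d - 1) with hL
    have hLt : L ≠ ⊤ := by simp [hL]
    have hε0 : ENNReal.ofReal (c.r / 2) ≠ 0 := by
      simp only [ne_eq, ENNReal.ofReal_eq_zero, not_le]; positivity
    set ε := ENNReal.ofReal (c.r / 2) with hε
    have hεt : ε ≠ ⊤ := by simp [hε]
    -- `L` compares surface measure with the base; the rest is the segment estimate for a layer of
    -- fixed height `ε`, divided by `ε`.
    refine ⟨L * (ε⁻¹ * (2 + 2 * ε ^ 2)), ?_, fun φ => ?_⟩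
    · refine ENNReal.mul_ne_top hLt (ENNReal.mul_ne_top (by simpa using hε0) ?_)
      exact ENNReal.add_ne_top.mpr ⟨by simp, ENNReal.mul_ne_top (by simp) (by simp [hεt])⟩
    have h1 := c.lintegral_surf_le (ρ := c.r / 2) (by linarith)
      (φ.2.smooth.continuous.measurable.enorm.pow_const 2)
    have h2 := c.lintegral_base_le_layer (c.r / 2) (c.r / 2) φ.2.smooth
    have hsub : c.layer (c.r / 2) (c.r / 2) ⊆ Ω := c.layer_subset (by linarith)
    have hN := enorm_sq_testToH1 (U := Ω) φ
    have h3 : ∫⁻ y in c.layer (c.r / 2) (c.r / 2), ‖φ.1 y‖ₑ ^ 2 ≤ ‖testToH1 Ω univ φ‖ₑ ^ 2 := by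
      rw [hN]
      exact (lintegral_mono_set hsub).trans le_self_add
    have h4 : ∫⁻ y in c.layer (c.r / 2) (c.r / 2), gradSq φ.1 y ≤ ‖testToH1 Ω univ φ‖ₑ ^ 2 := by
      rw [hN]
      exact (lintegral_mono_set hsub).trans le_add_self
    have h5 : ∫⁻ z in c.base (c.r / 2), ‖φ.1 (c.graph z)‖ₑ ^ 2 ≤
        ε⁻¹ * ((2 + 2 * ε ^ 2) * ‖testToH1 Ω univ φ‖ₑ ^ 2) := by
      rw [← ENNReal.mul_le_iff_le_inv hε0 hεt]
      refine h2.trans ?_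
      rw [add_mul]
      gcongr
    refine h1.trans ?_
    rw [mul_assoc, mul_assoc]
    gcongr

/-- The chartwise layer estimate, globalized by compactness. Comparing metric neighbourhoods of `Γ`
with layers widens the neighbourhood on the right by a constant factor, which is harmless because
that neighbourhood still shrinks to `Γ`. -/
theorem exists_lintegral_thickening_le (h : IsLipschitzPair Ω Γ) {z : H1 Ω}
    {φ : ℕ → testFns (univ : Set (Rd d))}
    (hz : Filter.Tendsto (fun n => testToH1 Ω univ (φ n)) Filter.atTop (𝓝 z))
    (hφ : Filter.Tendsto (fun n => ∫⁻ x in Γ, ‖(φ n).1 x‖ₑ ^ 2 ∂μHE[d - 1]) Filter.atTop (𝓝 0)) :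
    ∃ C : ℝ, 0 < C ∧ ∃ ε₀ > 0, ∀ ε, 0 < ε → ε < ε₀ →
      ∫⁻ x in Ω ∩ Metric.thickening ε Γ, ‖z.1 none x‖ₑ ^ 2 ≤
        ENNReal.ofReal (C * ε ^ 2) *
          ∑ i, ∫⁻ x in Ω ∩ Metric.thickening (C * ε) Γ, ‖z.1 (some i) x‖ₑ ^ 2 := by
  refine h.compact.induction_on (p := fun S => ∃ C : ℝ, 0 < C ∧ ∃ ε₀ > 0, ∀ ε, 0 < ε → ε < ε₀ →
      ∫⁻ x in Ω ∩ Metric.thickening ε S, ‖z.1 none x‖ₑ ^ 2 ≤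
        ENNReal.ofReal (C * ε ^ 2) *
          ∑ i, ∫⁻ x in Ω ∩ Metric.thickening (C * ε) Γ, ‖z.1 (some i) x‖ₑ ^ 2) ?_ ?_ ?_ ?_
  · exact ⟨1, one_pos, 1, one_pos, by simp⟩
  · rintro S T hST ⟨C, hC, ε₀, hε₀, hb⟩
    refine ⟨C, hC, ε₀, hε₀, fun ε h1 h2 => le_trans ?_ (hb ε h1 h2)⟩
    exact lintegral_mono_set (inter_subset_inter_right _ (Metric.thickening_subset_of_subset _ hST))
  · rintro S T ⟨C, hC, ε₀, hε₀, hb⟩ ⟨C', hC', ε₁, hε₁, hb'⟩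
    refine ⟨C + C', by positivity, min ε₀ ε₁, lt_min hε₀ hε₁, fun ε h1 h2 => ?_⟩
    rw [Metric.thickening_union, inter_union_distrib_left]
    refine (lintegral_union_le _ _ _).trans ?_
    have i1 := hb ε h1 (h2.trans_le (min_le_left _ _))
    have i2 := hb' ε h1 (h2.trans_le (min_le_right _ _))
    rw [add_mul C, ENNReal.ofReal_add (by positivity) (by positivity), add_mul]
    refine add_le_add (i1.trans ?_) (i2.trans ?_)
    · exact mul_le_mul' le_rfl (Finset.sum_le_sum fun i _ => lintegral_mono_set
        (inter_subset_inter_right _ (Metric.thickening_mono (by nlinarith) _)))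
    · exact mul_le_mul' le_rfl (Finset.sum_le_sum fun i _ => lintegral_mono_set
        (inter_subset_inter_right _ (Metric.thickening_mono (by nlinarith) _)))
  · intro x hx
    obtain ⟨c⟩ := h.chart x hx
    have hr := c.r_pos
    have hK : 0 ≤ (c.K : ℝ) := c.K.2
    set M : ℝ := 1 + c.K with hM
    have hM1 : 1 ≤ M := by rw [hM]; linarith
    -- `8 M²` comes from `8 (M ε)²`, the layer estimate at height `M ε`. The bound on `ε` says `(1 +
    -- 2 M) ε < r / 2`, so the enlarged layer stays in the chart.
    refine ⟨Γ ∩ Metric.ball x (c.r / 2), ?_, 8 * M ^ 2, by positivity, c.r / (2 * (1 + 2 * M)),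
      by positivity, fun ε h1 h2 => ?_⟩
    · exact inter_mem_nhdsWithin _ (Metric.ball_mem_nhds x (by positivity))
    have h3 : c.r / 2 + ε + M * ε + M * ε ≤ c.r := by
      rw [lt_div_iff₀ (by positivity)] at h2
      nlinarith
    have hMε : 0 < M * ε := by positivity
    have s1 : Ω ∩ Metric.thickening ε (Γ ∩ Metric.ball x (c.r / 2)) ⊆
        c.layer (c.r / 2 + ε + M * ε) (M * ε) :=
      c.inter_thickening_subset_layer (by rw [← hM]; linarith) le_rfl
    have s2 := c.layer_subset_thickening h3 hMε
    calc ∫⁻ x in Ω ∩ Metric.thickening ε (Γ ∩ Metric.ball x (c.r / 2)), ‖z.1 none x‖ₑ ^ 2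
        ≤ ∫⁻ x in c.layer (c.r / 2 + ε + M * ε) (M * ε), ‖z.1 none x‖ₑ ^ 2 :=
          lintegral_mono_set s1
      _ ≤ 8 * ENNReal.ofReal (M * ε) ^ 2 * ∑ i, ∫⁻ x in c.layer (c.r / 2 + ε + M * ε) (M * ε),
            ‖z.1 (some i) x‖ₑ ^ 2 := c.lintegral_layer_le_of_trace_zero hz hφ hMε h3
      _ ≤ _ := by
          refine mul_le_mul' (le_of_eq ?_) (Finset.sum_le_sum fun i _ => ?_)
          · rw [← ENNReal.ofReal_pow hMε.le, show (8 : ℝ≥0∞) = ENNReal.ofReal 8 by simp,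
              ← ENNReal.ofReal_mul (by norm_num)]
            congr 1
            ring
          · refine lintegral_mono_set (s2.trans (inter_subset_inter_right _
              (Metric.thickening_mono ?_ _)))
            gcongr
            nlinarith

end IsLipschitzPair

end

/-! ## Trace operators on Lipschitz domains -/

section

variable {d : ℕ}

/-- Cutoffs away from a set, with derivatives of the order of the inverse distance. -/
theorem exists_cutoff_away (d : ℕ) : ∃ C : ℝ, 0 ≤ C ∧ ∀ (S : Set (Rd d)) (ε : ℝ), 0 < ε →
    ∃ m : Rd d → ℂ, ContDiff ℝ ∞ m ∧ (∀ x, ‖m x‖ ≤ 1) ∧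
      (∀ x ∈ Metric.thickening ε S, m x = 0) ∧ (∀ x ∉ Metric.thickening (3 * ε) S, m x = 1) ∧
      ∀ i x, ‖pderiv m i x‖ ≤ C / ε := by
  obtain ⟨κ, hκ, -⟩ := exists_isKernel (0 : Rd d) one_pos
  rw [norm_zero, zero_add] at hκ
  have hκi : Integrable fun y => ‖fderiv ℝ κ y‖ :=
    ((hκ.smooth.continuous_fderiv (by simp)).integrable_of_hasCompactSupport
      (hκ.compact.fderiv ℝ)).norm
  refine ⟨∫ y, ‖fderiv ℝ κ y‖, integral_nonneg fun _ => norm_nonneg _, fun S ε hε => ?_⟩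
  -- Rescaling reduces to unit scale. The indicator of the complement of the `2`-thickening,
  -- mollified at radius `1`, vanishes on the `1`-thickening and equals one off the `3`-thickening.
  -- Its gradient is at most `∫ ‖Dκ‖`, and scaling back divides by `ε`.
  set S' : Set (Rd d) := (fun y => ε • y) ⁻¹' S with hS'
  set A : Set (Rd d) := (Metric.thickening 2 S')ᶜ with hA
  have hAm : MeasurableSet A := Metric.isOpen_thickening.measurableSet.compl
  set f : Rd d → ℂ := A.indicator fun _ => 1 with hf
  have hf1 : ∀ x, ‖f x‖ ≤ 1 := fun x => by
    by_cases hx : x ∈ A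
    · simp [f, indicator_of_mem hx]
    · simp [f, indicator_of_notMem hx]
  have hfl : LocallyIntegrable f volume :=
    (locallyIntegrable_const (1 : ℂ)).indicator hAm
  have hthick : ∀ {x y : Rd d} {a b : ℝ}, ‖y‖ ≤ b → x ∈ Metric.thickening a S' →
      x - y ∈ Metric.thickening (a + b) S' := by
    intro x y a b hy hx
    rw [Metric.mem_thickening_iff] at hx ⊢
    obtain ⟨p, hp, hd⟩ := hx
    refine ⟨p, hp, ?_⟩
    calc dist (x - y) p ≤ dist (x - y) x + dist x p := dist_triangle _ _ _
      _ < a + b := by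
        have : dist (x - y) x = ‖y‖ := by rw [dist_eq_norm]; simp
        linarith
  have hscale : ∀ {x : Rd d} {a : ℝ}, ε⁻¹ • x ∈ Metric.thickening a S' ↔
      x ∈ Metric.thickening (a * ε) S := by
    intro x a
    simp only [Metric.mem_thickening_iff]
    constructor
    · rintro ⟨p, hp, hd⟩
      refine ⟨ε • p, hp, ?_⟩
      have : dist x (ε • p) = ε * dist (ε⁻¹ • x) p := by
        rw [← Real.norm_of_nonneg hε.le, ← dist_smul₀, Real.norm_of_nonneg hε.le,
          smul_inv_smul₀ hε.ne']
      rw [this, mul_comm]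
      gcongr
    · rintro ⟨p, hp, hd⟩
      refine ⟨ε⁻¹ • p, ?_, ?_⟩
      · rw [hS', mem_preimage, smul_inv_smul₀ hε.ne']
        exact hp
      · rw [dist_smul₀, norm_inv, Real.norm_of_nonneg hε.le, inv_mul_lt_iff₀ hε, mul_comm]
        exact hd
  have hF := hκ.contDiff_moll hfl
  refine ⟨fun x => moll κ f (ε⁻¹ • x), hF.comp (contDiff_const_smul _), fun x => ?_,
    fun x hx => ?_, fun x hx => ?_, fun i x => ?_⟩
  · dsimp only
    rw [moll]
    calc ‖∫ y, (κ y : ℂ) * f (ε⁻¹ • x - y)‖ ≤ ∫ y, κ y := by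
          refine norm_integral_le_of_norm_le
            (hκ.smooth.continuous.integrable_of_hasCompactSupport hκ.compact)
            (Filter.Eventually.of_forall fun y => ?_)
          rw [norm_mul, Complex.norm_real, Real.norm_of_nonneg (hκ.nonneg y)]
          exact mul_le_of_le_one_right (hκ.nonneg y) (hf1 _)
      _ = 1 := hκ.integral
  · dsimp only
    rw [moll]
    refine integral_eq_zero_of_ae (Filter.Eventually.of_forall fun y => ?_)
    by_cases hy : κ y = 0
    · simp [hy]
    · have h1 : ε⁻¹ • x ∈ Metric.thickening 1 S' := hscale.mpr (by rwa [one_mul])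
      have h2 := hthick (hκ.small y hy).le h1
      norm_num at h2
      have h3 : ε⁻¹ • x - y ∉ A := fun h => h h2
      simp [f, indicator_of_notMem h3]
  · have e : moll κ f (ε⁻¹ • x) = ∫ y, (κ y : ℂ) := by
      rw [moll]
      refine integral_congr_ae (Filter.Eventually.of_forall fun y => ?_)
      by_cases hy : κ y = 0
      · simp [hy]
      · have h3 : ε⁻¹ • x - y ∈ A := by
          intro h
          have h2 := hthick (y := -y) (b := 1) (by rw [norm_neg]; exact (hκ.small y hy).le) h
          rw [sub_neg_eq_add, sub_add_cancel] at h2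
          norm_num at h2
          exact hx (hscale.mp h2)
        simp [f, indicator_of_mem h3]
    dsimp only
    rw [e, integral_complex_ofReal, hκ.integral, Complex.ofReal_one]
  · have e : pderiv (fun x => moll κ f (ε⁻¹ • x)) i x = ε⁻¹ • pderiv (moll κ f) i (ε⁻¹ • x) := by
      rw [pderiv, fderiv_comp_smul]
      rfl
    rw [e, norm_smul, norm_inv, Real.norm_of_nonneg hε.le, div_eq_inv_mul]
    gcongr
    rw [hκ.pderiv_moll hfl]
    refine (norm_integral_le_of_norm_le (hκi.comp_sub_left (ε⁻¹ • x))
      (Filter.Eventually.of_forall fun y => ?_)).trans (le_of_eq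
        (integral_sub_left_eq_self (fun y => ‖fderiv ℝ κ y‖) volume (ε⁻¹ • x)))
    rw [norm_mul, Complex.norm_real]
    refine (mul_le_of_le_one_right (norm_nonneg _) (hf1 _)).trans ?_
    refine ((fderiv ℝ κ _).le_opNorm _).trans ?_
    simp

theorem tendsto_mulH1_right {U : Set (Rd d)} {m : Rd d → ℂ} (hm : IsMultiplier m) {u : ℕ → H1 U}
    {w : H1 U} (h : Filter.Tendsto u Filter.atTop (𝓝 w)) :
    Filter.Tendsto (fun n => mulH1 m hm (u n)) Filter.atTop (𝓝 (mulH1 m hm w)) := by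
  rw [tendsto_H1_iff] at h ⊢
  obtain ⟨M, hM⟩ := hm.bdd
  obtain ⟨N, hN⟩ := hm.bdd_pderiv
  have hb : ∀ (f g : Rd d → ℂ) (B : ℝ), (∀ x, ‖f x‖ ≤ B) →
      ∫⁻ x in U, ‖f x * g x‖ₑ ^ 2 ≤ ENNReal.ofReal B ^ 2 * ∫⁻ x in U, ‖g x‖ₑ ^ 2 := by
    intro f g B hB
    rw [← lintegral_const_mul' _ _ (by simp)]
    refine lintegral_mono fun x => ?_
    rw [enorm_mul, mul_pow]
    gcongr
    rw [← ofReal_norm]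
    exact ENNReal.ofReal_le_ofReal (hB x)
  intro k
  have hlim : Filter.Tendsto (fun n =>
      2 * (ENNReal.ofReal M ^ 2 * ∫⁻ x in U, ‖(u n).1 k x - w.1 k x‖ₑ ^ 2) +
      2 * (ENNReal.ofReal N ^ 2 * ∫⁻ x in U, ‖(u n).1 none x - w.1 none x‖ₑ ^ 2))
      Filter.atTop (𝓝 0) := by
    have := (ENNReal.Tendsto.const_mul (a := 2) (ENNReal.Tendsto.const_mul
        (a := ENNReal.ofReal M ^ 2) (h k) (by simp)) (by simp)).add
      (ENNReal.Tendsto.const_mul (a := 2) (ENNReal.Tendsto.const_mul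
        (a := ENNReal.ofReal N ^ 2) (h none) (by simp)) (by simp))
    simpa using this
  refine tendsto_of_tendsto_of_tendsto_of_le_of_le tendsto_const_nhds hlim (fun _ => bot_le)
    fun n => ?_
  have hmeas : ∀ k, AEMeasurable (fun x => m x * ((u n).1 k x - w.1 k x)) (volume.restrict U) :=
    fun k => hm.smooth.continuous.measurable.aemeasurable.mul
      ((Lp.aestronglyMeasurable ((u n).1 k)).aemeasurable.sub
        (Lp.aestronglyMeasurable (w.1 k)).aemeasurable)
  have e : ∫⁻ x in U, ‖(mulH1 m hm (u n)).1 k x - (mulH1 m hm w).1 k x‖ₑ ^ 2 =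
      ∫⁻ x in U, ‖mulFun m (u n) k x - mulFun m w k x‖ₑ ^ 2 := by
    refine lintegral_congr_ae ?_
    filter_upwards [mulH1_coeFn hm (u n) k, mulH1_coeFn hm w k] with x h1 h2
    rw [h1, h2]
  dsimp only
  rw [e]
  cases k with
  | none =>
    refine le_trans ?_ le_self_add
    refine le_trans ?_ (le_mul_of_one_le_left' (by norm_num))
    refine le_trans (le_of_eq (lintegral_congr fun x => ?_))
      (hb m (fun x => (u n).1 none x - w.1 none x) M hM)
    simp only [mulFun, mul_sub]
  | some i =>
    refine (lintegral_enorm_sq_le (hmeas (some i))).trans ?_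
    refine add_le_add ?_ ?_
    · gcongr
      exact hb _ _ M hM
    · gcongr
      refine le_trans (le_of_eq (lintegral_congr fun x => ?_))
        (hb (pderiv m i) (fun x => (u n).1 none x - w.1 none x) N (hN i))
      simp only [mulFun]
      congr 2
      ring

namespace IsLipschitzPair

variable {Ω Γ : Set (Rd d)}

theorem closure_eq (h : IsLipschitzPair Ω Γ) : closure Ω = Ω ∪ Γ := by
  rw [closure_eq_self_union_frontier, h.frontier_eq]

theorem notMem_of_mem (h : IsLipschitzPair Ω Γ) {x : Rd d} (hx : x ∈ Ω) : x ∉ Γ := by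
  rw [← h.frontier_eq, h.isOpen.frontier_eq]
  exact fun h' => h'.2 hx

/-- Only boundary points need an argument. Moving by `t` along `e` raises the height by `t`, while
moving less than `t / (1 + K)` changes it by less than `t`, so the height stays positive. Away from
the closure the condition is void. -/
theorem hasInteriorDirections (h : IsLipschitzPair Ω Γ) : HasInteriorDirections Ω := by
  intro x
  by_cases hx : x ∈ Ω
  · obtain ⟨ρ, hρ, hb⟩ := Metric.isOpen_iff.mp h.isOpen x hx
    refine ⟨0, ρ / 2, 1, ρ / 2, by positivity, one_pos, by positivity, fun y hy t ht ht' => ?_⟩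
    refine Subset.trans (fun z hz => ?_) hb
    have h1 := hy.1
    rw [smul_zero, add_zero, one_mul] at hz
    rw [Metric.mem_ball] at hz h1 ⊢
    have := dist_triangle z y x
    linarith
  by_cases hx' : x ∈ Γ
  · obtain ⟨c⟩ := h.chart x hx'
    have hr := c.r_pos
    have hK : 0 ≤ (c.K : ℝ) := c.K.2
    refine ⟨c.e, c.r / 2, (1 + (c.K : ℝ))⁻¹, c.r / 4, by positivity, by positivity, by positivity,
      fun y hy t ht ht' z hz => ?_⟩
    have hyb : dist y x < c.r / 2 := hy.1
    rw [Metric.mem_ball] at hz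
    have hle : (1 + (c.K : ℝ))⁻¹ * t ≤ t := by
      refine mul_le_of_le_one_left ht.le (inv_le_one_of_one_le₀ (by linarith))
    have hte : dist (y + t • c.e) y = t := by
      rw [dist_eq_norm, add_sub_cancel_left, norm_smul, c.norm_e, mul_one,
        Real.norm_of_nonneg ht.le]
    have hzb : dist z x < c.r := by
      have h1 := dist_triangle z (y + t • c.e) x
      have h2 := dist_triangle (y + t • c.e) y x
      linarith
    rw [c.mem_iff z hzb]
    have hy0 : 0 < c.height y := by
      have := (c.mem_iff y (Metric.ball_subset_ball (by linarith) hy.1)).mp hy.2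
      unfold GraphChart.height
      linarith
    have h3 := c.abs_height_sub_le z (y + t • c.e)
    rw [c.height_add] at h3
    have h4 : (1 + (c.K : ℝ)) * dist z (y + t • c.e) < t := by
      rwa [← lt_inv_mul_iff₀ (by positivity)]
    have h5 := (abs_le.mp h3).1
    have h6 : 0 < c.height z := by linarith
    unfold GraphChart.height at h6
    linarith
  · have hcl : x ∉ closure Ω := by
      rw [h.closure_eq]
      exact fun h' => h'.elim hx hx'
    obtain ⟨ρ, hρ, hb⟩ := Metric.isOpen_iff.mp isClosed_closure.isOpen_compl x hcl
    exact ⟨0, ρ, 1, 1, hρ, one_pos, one_pos, fun y hy => absurd (subset_closure hy.2) (hb hy.1)⟩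

theorem denseRange_testToH1 (h : IsLipschitzPair Ω Γ) : DenseRange (testToH1 Ω univ) :=
  PiezoScattering.denseRange_testToH1 h.isOpen h.hasInteriorDirections

/-- Restriction of smooth functions to `Γ` is bounded for the `H¹(Ω)` norm by the trace inequality,
and extends by density. -/
theorem exists_isTraceOperator (h : IsLipschitzPair Ω Γ) :
    ∃ T : H1 Ω →L[ℂ] L2Surf Γ, IsTraceOperator Ω Γ T := by
  obtain ⟨C, hC, hb⟩ := h.exists_trace_bound
  have hmem : ∀ φ : testFns (univ : Set (Rd d)), MemLp φ.1 2 (surf Γ) := fun φ => by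
    refine memLp_two_of_lintegral φ.2.smooth.continuous.aestronglyMeasurable ?_
    refine (hb φ).trans_lt (ENNReal.mul_lt_top hC.lt_top ?_)
    simp
  let τ : testFns (univ : Set (Rd d)) →ₗ[ℂ] L2Surf Γ :=
    { toFun := fun φ => (hmem φ).toLp φ.1
      map_add' := fun _ _ => rfl
      map_smul' := fun _ _ => rfl }
  have hτ : ∀ φ, ‖τ φ‖ ≤ (C ^ (1 / 2 : ℝ)).toReal * ‖testToH1 Ω univ φ‖ := by
    intro φ
    have h1 : ‖τ φ‖ₑ ^ 2 ≤ C * ‖testToH1 Ω univ φ‖ₑ ^ 2 := by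
      rw [← lintegral_enorm_sq_eq]
      refine le_trans (le_of_eq (lintegral_congr_ae ?_)) (hb φ)
      filter_upwards [(hmem φ).coeFn_toLp] with x hx
      rw [← hx]
      rfl
    have h2 := ENNReal.rpow_le_rpow h1 (z := 1 / 2) (by norm_num)
    rw [ENNReal.mul_rpow_of_nonneg _ _ (by norm_num), ← ENNReal.rpow_natCast,
      ← ENNReal.rpow_natCast, ← ENNReal.rpow_mul, ← ENNReal.rpow_mul] at h2
    norm_num at h2
    have h3 := ENNReal.toReal_mono (ENNReal.mul_ne_top (by simp [hC]) (by simp)) h2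
    rw [ENNReal.toReal_mul] at h3
    simpa using h3
  refine ⟨τ.extendOfNorm (testToH1 Ω univ), fun φ u hφ hu => ?_⟩
  -- The definition of a trace operator only prescribes the function; its weak derivatives follow.
  have e : u = testToH1 Ω univ ⟨φ, hφ⟩ := by
    refine H1.ext_val h.isOpen (Lp.ext ?_)
    exact hu.trans (testToH1_coeFn (U := Ω) ⟨φ, hφ⟩ none).symm
  rw [e, LinearMap.extendOfNorm_eq h.denseRange_testToH1 ⟨_, hτ⟩]
  exact (hmem ⟨φ, hφ⟩).coeFn_toLp

theorem isTraceOperator_trace (h : IsLipschitzPair Ω Γ) : IsTraceOperator Ω Γ (trace Ω Γ) := by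
  have hex := h.exists_isTraceOperator
  rw [trace, dif_pos hex]
  exact hex.choose_spec

theorem trace_testToH1 (h : IsLipschitzPair Ω Γ) (φ : testFns (univ : Set (Rd d))) :
    trace Ω Γ (testToH1 Ω univ φ) =ᵐ[surf Γ] φ.1 :=
  h.isTraceOperator_trace φ.1 _ φ.2 (testToH1_coeFn φ none)

/-- Smooth cutoffs near `Γ` make a test function compactly supported in `Ω`. -/
theorem isTestFunction_indicator (h : IsLipschitzPair Ω Γ) {m φ : Rd d → ℂ} {ε : ℝ} (hε : 0 < ε)
    (hm : ContDiff ℝ ∞ m) (hm0 : ∀ x ∈ Metric.thickening ε Γ, m x = 0)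
    (hφ : IsTestFunction univ φ) : IsTestFunction Ω (Ω.indicator fun x => m x * φ x) := by
  refine ⟨contDiff_iff_contDiffAt.mpr fun x => ?_, ?_, ?_⟩
  · by_cases hx : x ∈ Ω
    · refine (hm.mul hφ.smooth).contDiffAt.congr_of_eventuallyEq ?_
      filter_upwards [h.isOpen.mem_nhds hx] with y hy
      rw [indicator_of_mem hy]
    by_cases hx' : x ∈ Γ
    · refine contDiffAt_const (c := 0) |>.congr_of_eventuallyEq ?_
      filter_upwards [Metric.isOpen_thickening.mem_nhds (Metric.self_subset_thickening hε _ hx')]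
        with y hy
      by_cases hyΩ : y ∈ Ω
      · rw [indicator_of_mem hyΩ, hm0 y hy, zero_mul]
      · rw [indicator_of_notMem hyΩ]
    · have hcl : x ∉ closure Ω := by
        rw [h.closure_eq]
        exact fun h' => h'.elim hx hx'
      refine contDiffAt_const (c := 0) |>.congr_of_eventuallyEq ?_
      filter_upwards [isClosed_closure.isOpen_compl.mem_nhds hcl] with y hy
      rw [indicator_of_notMem fun hyΩ => hy (subset_closure hyΩ)]
  · refine hφ.compact.mono' fun x hx => subset_tsupport _ fun h0 => hx ?_
    by_cases hxΩ : x ∈ Ω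
    · rw [indicator_of_mem hxΩ, h0, mul_zero]
    · rw [indicator_of_notMem hxΩ]
  · have h1 : Function.support (Ω.indicator fun x => m x * φ x) ⊆
        closure Ω ∩ (Metric.thickening ε Γ)ᶜ := by
      intro x hx
      refine ⟨subset_closure (mem_of_indicator_ne_zero hx), fun h' => hx ?_⟩
      by_cases hxΩ : x ∈ Ω
      · rw [indicator_of_mem hxΩ, hm0 x h', zero_mul]
      · rw [indicator_of_notMem hxΩ]
    have h2 := closure_minimal h1
      (isClosed_closure.inter Metric.isOpen_thickening.isClosed_compl)
    intro x hx
    obtain ⟨h3, h4⟩ := h2 hx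
    rw [h.closure_eq] at h3
    exact h3.elim id fun h5 => absurd (Metric.self_subset_thickening hε _ h5) h4

/-- If `φ_n → z` with `φ_n` smooth up to `Γ`, then the functions `m φ_n`, set to zero off `Ω`, are
test functions in `Ω` and converge to `m z`. -/
theorem mulH1_mem_closure (h : IsLipschitzPair Ω Γ) {m : Rd d → ℂ} {ε : ℝ} (hε : 0 < ε)
    (hm : IsMultiplier m) (hm0 : ∀ x ∈ Metric.thickening ε Γ, m x = 0) (z : H1 Ω) :
    mulH1 m hm z ∈ closure (range (testToH1 Ω Ω)) := by
  obtain ⟨w, hw, hlim⟩ := mem_closure_iff_seq_limit.mp (h.denseRange_testToH1 z)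
  choose φ hφ using hw
  refine mem_closure_of_tendsto (tendsto_mulH1_right hm hlim)
    (Filter.Eventually.of_forall fun n => ?_)
  refine ⟨⟨_, h.isTestFunction_indicator hε hm.smooth hm0 (φ n).2⟩, ?_⟩
  refine H1.ext_val h.isOpen (Lp.ext ?_)
  refine (testToH1_coeFn (U := Ω)
    ⟨_, h.isTestFunction_indicator hε hm.smooth hm0 (φ n).2⟩ none).trans ?_
  refine Filter.EventuallyEq.trans ?_ (mulH1_coeFn hm (w n) none).symm
  rw [← hφ n]
  filter_upwards [testToH1_coeFn (U := Ω) (φ n) none, ae_restrict_mem h.isOpen.measurableSet]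
    with x h1 h2
  simp only [jet, mulFun, indicator_of_mem h2, h1]

/-- Each point of `Ω` has positive distance to `Γ`, so the indicators tend to zero pointwise and
dominated convergence applies. -/
theorem tendsto_lintegral_thickening (h : IsLipschitzPair Ω Γ) (f : L2 Ω) {δ : ℕ → ℝ}
    (hδ : Filter.Tendsto δ Filter.atTop (𝓝 0)) :
    Filter.Tendsto (fun n => ∫⁻ x in Ω ∩ Metric.thickening (δ n) Γ, ‖f x‖ₑ ^ 2)
      Filter.atTop (𝓝 0) := by
  have e : ∀ n, ∫⁻ x in Ω ∩ Metric.thickening (δ n) Γ, ‖f x‖ₑ ^ 2 =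
      ∫⁻ x in Ω, (Metric.thickening (δ n) Γ).indicator (fun x => ‖f x‖ₑ ^ 2) x := by
    intro n
    rw [lintegral_indicator Metric.isOpen_thickening.measurableSet,
      Measure.restrict_restrict Metric.isOpen_thickening.measurableSet, inter_comm]
  simp only [e]
  have hfm : AEMeasurable (fun x => ‖f x‖ₑ ^ 2) (volume.restrict Ω) :=
    (Lp.aestronglyMeasurable f).enorm.pow_const 2
  have := tendsto_lintegral_of_dominated_convergence' (μ := volume.restrict Ω)
    (F := fun n x => (Metric.thickening (δ n) Γ).indicator (fun x => ‖f x‖ₑ ^ 2) x)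
    (f := fun _ => 0) (fun x => ‖f x‖ₑ ^ 2) ?_ ?_ ?_ ?_
  · simpa using this
  · exact fun n => hfm.indicator Metric.isOpen_thickening.measurableSet
  · exact fun n => Filter.Eventually.of_forall fun x => indicator_le_self _ _ x
  · rw [lintegral_enorm_sq_eq]
    simp
  · filter_upwards [ae_restrict_mem h.isOpen.measurableSet] with x hx
    have hxΓ : x ∈ Γᶜ := h.notMem_of_mem hx
    obtain ⟨ρ, hρ, hb⟩ := Metric.isOpen_iff.mp h.compact.isClosed.isOpen_compl x hxΓ
    refine tendsto_const_nhds.congr' ?_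
    filter_upwards [hδ.eventually (gt_mem_nhds hρ)] with n hn
    rw [indicator_of_notMem]
    intro hx'
    rw [Metric.mem_thickening_iff] at hx'
    obtain ⟨p, hp, hd⟩ := hx'
    exact hb (by rw [Metric.mem_ball, dist_comm]; linarith) hp

/-- Functions in `H¹(Ω)` with vanishing trace are limits of test functions. -/
theorem mem_closure_of_trace_eq_zero (h : IsLipschitzPair Ω Γ) {z : H1 Ω}
    (hz : trace Ω Γ z = 0) : z ∈ closure (range (testToH1 Ω Ω)) := by
  obtain ⟨w, hw, hlim⟩ := mem_closure_iff_seq_limit.mp (h.denseRange_testToH1 z)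
  choose φ hφ using hw
  have hφlim : Filter.Tendsto (fun n => testToH1 Ω univ (φ n)) Filter.atTop (𝓝 z) := by
    simpa only [hφ] using hlim
  -- The approximants need not vanish on `Γ`, but by continuity of the trace their boundary values
  -- tend to zero in `L²(Γ)`.
  have htr : Filter.Tendsto (fun n => ∫⁻ x in Γ, ‖(φ n).1 x‖ₑ ^ 2 ∂μHE[d - 1])
      Filter.atTop (𝓝 0) := by
    have h1 : Filter.Tendsto (fun n => ‖trace Ω Γ (testToH1 Ω univ (φ n))‖ₑ ^ 2)
        Filter.atTop (𝓝 (‖trace Ω Γ z‖ₑ ^ 2)) :=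
      ENNReal.Tendsto.pow ((continuous_enorm.comp (trace Ω Γ).continuous).tendsto z |>.comp hφlim)
    rw [hz] at h1
    simp only [enorm_zero, ne_eq, OfNat.ofNat_ne_zero, not_false_eq_true, zero_pow] at h1
    refine h1.congr fun n => ?_
    rw [← lintegral_enorm_sq_eq]
    refine lintegral_congr_ae ?_
    filter_upwards [h.trace_testToH1 (φ n)] with x hx
    rw [hx]
  obtain ⟨C, hC, ε₀, hε₀, hlayer⟩ := h.exists_lintegral_thickening_le hφlim htr
  obtain ⟨A, hA, hcut⟩ := exists_cutoff_away d
  -- The factor `1/8` leaves room for the layer estimate at width `4 ε n`, where the cutoff's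
  -- gradient lives.
  set ε : ℕ → ℝ := fun n => ε₀ / 8 * (1 / ((n : ℝ) + 1)) with hεdef
  have hε : ∀ n, 0 < ε n := fun n => by positivity
  have hε' : ∀ n, 4 * ε n < ε₀ := fun n => by
    have : (1 / ((n : ℝ) + 1)) ≤ 1 := by
      rw [div_le_one (by positivity)]
      linarith [(Nat.cast_nonneg n : (0 : ℝ) ≤ n)]
    have h2 : ε n ≤ ε₀ / 8 := mul_le_of_le_one_right (by positivity) this
    linarith
  have hε0 : Filter.Tendsto ε Filter.atTop (𝓝 0) := by
    have := (tendsto_one_div_add_atTop_nhds_zero_nat (𝕜 := ℝ)).const_mul (ε₀ / 8)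
    simpa [hεdef] using this
  choose m hms hm1 hm0 hm1' hmd using fun n => hcut Γ (ε n) (hε n)
  have hm : ∀ n, IsMultiplier (m n) := fun n => ⟨hms n, ⟨1, hm1 n⟩, ⟨A / ε n, hmd n⟩⟩
  refine isClosed_closure.mem_of_tendsto
    (tendsto_mulH1 h.isOpen.measurableSet hm z hm1 ?_ ?_)
    (Filter.Eventually.of_forall fun n => h.mulH1_mem_closure (hε n) (hm n) (hm0 n) z)
  · intro x hx
    have hxΓ : x ∈ Γᶜ := h.notMem_of_mem hx
    obtain ⟨ρ, hρ, hb⟩ := Metric.isOpen_iff.mp h.compact.isClosed.isOpen_compl x hxΓ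
    refine tendsto_const_nhds.congr' ?_
    have h3 : Filter.Tendsto (fun n => 3 * ε n) Filter.atTop (𝓝 0) := by
      simpa using hε0.const_mul 3
    filter_upwards [h3.eventually (gt_mem_nhds hρ)] with n hn
    refine (hm1' n x fun hx' => ?_).symm
    rw [Metric.mem_thickening_iff] at hx'
    obtain ⟨p, hp, hd⟩ := hx'
    exact hb (by rw [Metric.mem_ball, dist_comm]; linarith) hp
  · intro i
    -- The cutoff equals one off the `3 ε`-thickening; the additional `ε` makes it constant in a
    -- whole ball around `x`.
    have hsupp : ∀ n, ∀ x ∉ Metric.thickening (4 * ε n) Γ, pderiv (m n) i x = 0 := by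
      intro n x hx
      have hev : m n =ᶠ[𝓝 x] fun _ => 1 := by
        filter_upwards [Metric.ball_mem_nhds x (hε n)] with y hy
        refine hm1' n y fun hy' => hx ?_
        rw [Metric.mem_thickening_iff] at hy' ⊢
        obtain ⟨p, hp, hd⟩ := hy'
        refine ⟨p, hp, ?_⟩
        rw [Metric.mem_ball, dist_comm] at hy
        have := dist_triangle x y p
        linarith
      rw [pderiv, hev.fderiv_eq]
      simp
    -- Here `(A / ε)²` from the cutoff meets `C (4 ε)²` from the layer estimate: the powers of `ε`
    -- cancel, leaving `16 A² C` times a gradient integral over a shrinking set.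
    have hbound : ∀ n, ∫⁻ x in Ω, ‖pderiv (m n) i x * z.1 none x‖ₑ ^ 2 ≤
        ENNReal.ofReal (16 * A ^ 2 * C) *
          ∑ j, ∫⁻ x in Ω ∩ Metric.thickening (C * (4 * ε n)) Γ, ‖z.1 (some j) x‖ₑ ^ 2 := by
      intro n
      have e1 : ∫⁻ x in Ω, ‖pderiv (m n) i x * z.1 none x‖ₑ ^ 2 ≤
          ENNReal.ofReal ((A / ε n) ^ 2) *
            ∫⁻ x in Ω ∩ Metric.thickening (4 * ε n) Γ, ‖z.1 none x‖ₑ ^ 2 := by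
        rw [inter_comm, ← Measure.restrict_restrict Metric.isOpen_thickening.measurableSet,
          ← lintegral_indicator Metric.isOpen_thickening.measurableSet,
          ← lintegral_const_mul' _ _ (by simp)]
        refine lintegral_mono fun x => ?_
        by_cases hx : x ∈ Metric.thickening (4 * ε n) Γ
        · rw [indicator_of_mem hx, enorm_mul, mul_pow,
            ENNReal.ofReal_pow (div_nonneg hA (hε n).le)]
          gcongr
          rw [← ofReal_norm]
          exact ENNReal.ofReal_le_ofReal (hmd n i x)
        · rw [hsupp n x hx, zero_mul, enorm_zero]
          simp
      refine e1.trans ?_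
      have e2 := hlayer (4 * ε n) (by have := hε n; positivity) (hε' n)
      calc _ ≤ ENNReal.ofReal ((A / ε n) ^ 2) * (ENNReal.ofReal (C * (4 * ε n) ^ 2) *
            ∑ j, ∫⁻ x in Ω ∩ Metric.thickening (C * (4 * ε n)) Γ, ‖z.1 (some j) x‖ₑ ^ 2) := by
            gcongr
        _ = _ := by
            rw [← mul_assoc, ← ENNReal.ofReal_mul (by positivity)]
            congr 2
            have := (hε n).ne'
            field_simp
            ring
    refine tendsto_of_tendsto_of_tendsto_of_le_of_le tendsto_const_nhds ?_ (fun _ => bot_le) hbound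
    have h4 : Filter.Tendsto (fun n => C * (4 * ε n)) Filter.atTop (𝓝 0) := by
      simpa using (hε0.const_mul 4).const_mul C
    have h5 := tendsto_finsetSum (Finset.univ : Finset (Fin d)) fun j _ =>
      h.tendsto_lintegral_thickening (z.1 (some j)) h4
    have h6 := ENNReal.Tendsto.const_mul (a := ENNReal.ofReal (16 * A ^ 2 * C)) h5
      (Or.inr (by simp))
    simpa using h6

end IsLipschitzPair

end

/-! ## The interior and the exterior domain -/

theorem mem_closure_of_graph {d : ℕ} {Ω : Set (Rd d)} {x e y : Rd d} {g : Rd d → ℝ} {r : ℝ}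
    (he : ‖e‖ = 1) (hinv : ∀ (y : Rd d) (t : ℝ), g (y + t • e) = g y)
    (hmem : ∀ y ∈ Metric.ball x r, g y < inner ℝ e y → y ∈ Ω)
    (hy : y ∈ Metric.ball x r) (hgy : g y = inner ℝ e y) : y ∈ closure Ω := by
  rw [Metric.mem_closure_iff]
  intro ε hε
  obtain ⟨δ, hδ, hsub⟩ := Metric.isOpen_iff.mp Metric.isOpen_ball y hy
  obtain ⟨t, ht0, ht⟩ := exists_between (lt_min hε hδ)
  have hd : dist (y + t • e) y = t := by
    rw [dist_eq_norm, add_sub_cancel_left, norm_smul, he, mul_one, Real.norm_of_nonneg ht0.le]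
  refine ⟨y + t • e, hmem _ (hsub ?_) ?_, ?_⟩
  · rw [Metric.mem_ball, hd]
    exact ht.trans_le (min_le_right _ _)
  · rw [hinv, hgy, inner_add_right, real_inner_smul_right, real_inner_self_eq_norm_sq, he]
    linarith
  · rw [dist_comm, hd]
    exact ht.trans_le (min_le_left _ _)

/-- A graph chart of `Ω`, read from the other side of the boundary. -/
def GraphChart.flip {d : ℕ} {Ω Ω' Γ : Set (Rd d)} {x₀ : Rd d} (c : GraphChart Ω Γ x₀)
    (hΩ' : Ω' = (Ω ∪ Γ)ᶜ) : GraphChart Ω' Γ x₀ where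
  e := -c.e
  g := fun y => -c.g y
  K := c.K
  r := c.r
  norm_e := by rw [norm_neg, c.norm_e]
  lip := c.lip.neg
  inv := fun y t => by rw [smul_neg, ← neg_smul, c.inv]
  r_pos := c.r_pos
  mem_iff := fun y hy => by
    rw [hΩ', mem_compl_iff, mem_union, c.mem_iff y hy, c.mem_bdry_iff y hy, inner_neg_left,
      neg_lt_neg_iff, ← le_iff_lt_or_eq, not_le]
  mem_bdry_iff := fun y hy => by rw [c.mem_bdry_iff y hy, inner_neg_left, neg_inj]

namespace Geometry

variable {d : ℕ} (𝒢 : Geometry d)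

theorem isOpen_Op : IsOpen 𝒢.Op := isClosed_closure.isOpen_compl

theorem isCompact_Γ : IsCompact 𝒢.Γ :=
  Metric.isCompact_of_isClosed_isBounded isClosed_frontier
    (𝒢.isBounded_Om.closure.subset frontier_subset_closure)

theorem isOpen_compl_Γ : IsOpen 𝒢.Γᶜ := 𝒢.isCompact_Γ.isClosed.isOpen_compl

theorem Op_eq : 𝒢.Op = (𝒢.Om ∪ 𝒢.Γ)ᶜ := by
  rw [Op, Γ, closure_eq_self_union_frontier]

theorem Om_union_Op : 𝒢.Om ∪ 𝒢.Op = 𝒢.Γᶜ := by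
  refine subset_antisymm (union_subset 𝒢.Om_subset 𝒢.Op_subset) fun x hx => ?_
  rw [Op_eq]
  by_cases h : x ∈ 𝒢.Om
  · exact Or.inl h
  · exact Or.inr fun h' => h'.elim h hx

theorem disjoint_Om_Op : Disjoint 𝒢.Om 𝒢.Op :=
  disjoint_left.mpr fun _ hx hx' => hx' (subset_closure hx)

/-- The Lipschitz condition describes only `Ω`; the boundary is recovered topologically. Points
above the graph are in the open set `Ω`, points below have a neighbourhood disjoint from `Ω`, and
points of the graph are limits from above. -/
theorem exists_graphChart {x : Rd d} (hx : x ∈ 𝒢.Γ) : Nonempty (GraphChart 𝒢.Om 𝒢.Γ x) := by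
  obtain ⟨e, g, K, r, he, hg, hinv, hr, hmem⟩ := 𝒢.lipschitz x hx
  refine ⟨⟨e, g, K, r, he, hg, hinv, hr, hmem, fun y hy => ⟨fun hΓ => ?_, fun h => ?_⟩⟩⟩
  · have hle : inner ℝ e y ≤ g y := not_lt.mp fun h => 𝒢.Om_subset ((hmem y hy).mpr h) hΓ
    refine le_antisymm (not_lt.mp fun hlt => ?_) hle
    have hopen : IsOpen (Metric.ball x r ∩ {z | inner ℝ e z < g z}) :=
      Metric.isOpen_ball.inter (isOpen_lt (by fun_prop) hg.continuous)
    obtain ⟨z, ⟨hz, hz'⟩, hzO⟩ := mem_closure_iff.mp (frontier_subset_closure hΓ) _ hopen ⟨hy, hlt⟩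
    exact lt_asymm ((hmem z hz).mp hzO) hz'
  · rw [Γ, 𝒢.isOpen_Om.frontier_eq]
    exact ⟨mem_closure_of_graph he hinv (fun z hz => (hmem z hz).mpr) hy h,
      fun hO => ((hmem y hy).mp hO).ne h⟩

theorem isLipschitzPair_Om : IsLipschitzPair 𝒢.Om 𝒢.Γ :=
  ⟨𝒢.isOpen_Om, 𝒢.isCompact_Γ, rfl, fun _ => 𝒢.exists_graphChart⟩

/-- The same charts are read upside down. They also show that every point of `Γ` is a limit of
exterior points, so the boundary of the exterior domain is not smaller than `Γ`. -/
theorem isLipschitzPair_Op : IsLipschitzPair 𝒢.Op 𝒢.Γ := by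
  have hchart : ∀ x ∈ 𝒢.Γ, Nonempty (GraphChart 𝒢.Op 𝒢.Γ x) := fun x hx =>
    (𝒢.exists_graphChart hx).map fun c => c.flip 𝒢.Op_eq
  refine ⟨𝒢.isOpen_Op, 𝒢.isCompact_Γ, subset_antisymm ?_ fun x hx => ?_, hchart⟩
  · rw [Op, frontier_compl]
    exact frontier_closure_subset
  · obtain ⟨c⟩ := hchart x hx
    have hxb := Metric.mem_ball_self (x := x) c.r_pos
    rw [𝒢.isOpen_Op.frontier_eq]
    exact ⟨mem_closure_of_graph c.norm_e c.inv (fun z hz => (c.mem_iff z hz).mpr) hxb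
      ((c.mem_bdry_iff x hxb).mp hx), fun h => 𝒢.Op_subset h hx⟩

end Geometry

/-! ## Restriction -/

section

variable {d : ℕ} {U V : Set (Rd d)}

theorem restrictH1_coeFn (h : V ⊆ U) (u : H1 U) (k : Option (Fin d)) :
    (restrictH1 h u).1 k =ᵐ[volume.restrict V] u.1 k :=
  restrictLp_coeFn (Measure.restrict_mono h le_rfl) (u.1 k)

theorem restrictH1_testToH1 {W : Set (Rd d)} (h : V ⊆ U) (φ : testFns W) :
    restrictH1 h (testToH1 U W φ) = testToH1 V W φ :=
  H1.ext_ae fun k => (restrictH1_coeFn h _ k).trans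
    (((testToH1_coeFn (U := U) φ k).filter_mono (ae_mono (Measure.restrict_mono h le_rfl))).trans
      (testToH1_coeFn (U := V) φ k).symm)

theorem gradForm_zero_right (u : H1 U) : gradForm u 0 = 0 := by
  refine Finset.sum_eq_zero fun i _ => integral_eq_zero_of_ae ?_
  filter_upwards [Lp.coeFn_zero ℂ 2 (volume.restrict U)] with x hx
  have : gradH1 (0 : H1 U) i = 0 := rfl
  rw [this, hx]
  simp

theorem massForm_zero_right (f : L2 U) : massForm f 0 = 0 := by
  refine integral_eq_zero_of_ae ?_
  filter_upwards [Lp.coeFn_zero ℂ 2 (volume.restrict U)] with x hx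
  rw [hx]
  simp

/-- The distributional Laplacian is unique by the fundamental lemma, so the chosen representative
must be `f`. -/
theorem weakLaplacian_eq (hU : IsOpen U) {v : H1 U} {f : L2 U} (h : HasWeakLaplacian v f) :
    weakLaplacian v = f := by
  have hex : ∃ f, HasWeakLaplacian v f := ⟨f, h⟩
  rw [weakLaplacian, dif_pos hex]
  exact L2_ext_of_test hU fun η hη => (hex.choose_spec η hη).symm.trans (h η hη)

theorem HasWeakLaplacian.restrict {v : H1 U} {f : L2 U} (h : HasWeakLaplacian v f) (hVU : V ⊆ U) :
    HasWeakLaplacian (restrictH1 hVU v) (restrictLp (Measure.restrict_mono hVU le_rfl) f) := by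
  intro η hη
  have key : ∀ (a : L2 V) (b : L2 U) (ζ : Rd d → ℂ), a =ᵐ[volume.restrict V] b →
      (∀ x, x ∉ V → ζ x = 0) → ∫ x in V, a x * ζ x = ∫ x in U, b x * ζ x := by
    intro a b ζ hab hζ
    rw [integral_congr_ae (hab.mono fun x hx => congrArg (· * ζ x) hx),
      setIntegral_eq_integral_of_forall_compl_eq_zero
        (fun x hx => by rw [hζ x hx, mul_zero]),
      setIntegral_eq_integral_of_forall_compl_eq_zero
        (fun x hx => by rw [hζ x (fun hV => hx (hVU hV)), mul_zero])]
  have h' := h η (hη.mono hVU)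
  rw [key _ f η (restrictLp_coeFn _ f) fun x hx => hη.eq_zero hx, ← h']
  congr 1
  exact Finset.sum_congr rfl fun i _ =>
    key _ _ _ (restrictH1_coeFn hVU v (some i)) fun x hx => hη.pderiv_eq_zero i hx

/-- Green's functional `z ↦ (∇u, ∇z)_U + (f, z)_U`. -/
def greenForm (u : H1 U) (f : L2 U) : H1 U →L[ℂ] ℂ :=
  (∑ i, (pairL2 (gradH1 u i) (Lp.memLp _)).comp
      ((PiLp.proj 2 (fun _ : Option (Fin d) => L2 U) (some i)).comp (H1 U).subtypeL)) +
    (pairL2 f (Lp.memLp _)).comp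
      ((PiLp.proj 2 (fun _ : Option (Fin d) => L2 U) none).comp (H1 U).subtypeL)

theorem greenForm_apply (u : H1 U) (f : L2 U) (z : H1 U) :
    greenForm u f z = gradForm u z + massForm f (valH1 z) := by
  simp only [greenForm, gradForm, massForm, add_apply,
    sum_apply, ContinuousLinearMap.comp_apply, pairL2_apply]
  congr 1
  · exact Finset.sum_congr rfl fun i _ => integral_congr_ae (ae_of_all _ fun x => mul_comm _ _)
  · exact integral_congr_ae (ae_of_all _ fun x => mul_comm _ _)

theorem greenForm_testToH1 (u : H1 U) (f : L2 U) {W : Set (Rd d)} (φ : testFns W) :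
    greenForm u f (testToH1 U W φ) =
      (∑ i, ∫ x in U, gradH1 u i x * pderiv φ.1 i x) + ∫ x in U, f x * φ.1 x := by
  rw [greenForm_apply]
  congr 1
  · refine Finset.sum_congr rfl fun i _ => integral_congr_ae ?_
    filter_upwards [testToH1_coeFn (U := U) φ (some i)] with x hx
    exact congrArg _ hx
  · refine integral_congr_ae ?_
    filter_upwards [testToH1_coeFn (U := U) φ none] with x hx
    exact congrArg _ hx

theorem HasWeakLaplacian.greenForm_testToH1_eq_zero {u : H1 U} {f : L2 U}
    (h : HasWeakLaplacian u f) (φ : testFns U) : greenForm u f (testToH1 U U φ) = 0 := by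
  rw [greenForm_testToH1, ← h φ.1 φ.2]
  ring

/-- Green's functional only sees the trace. -/
theorem HasWeakLaplacian.greenForm_eq_zero {Γ : Set (Rd d)} (hUΓ : IsLipschitzPair U Γ) {u : H1 U}
    {f : L2 U} (h : HasWeakLaplacian u f) {z : H1 U} (hz : trace U Γ z = 0) :
    greenForm u f z = 0 := by
  have hsub : closure (range (testToH1 U U)) ⊆ {z | greenForm u f z = 0} := by
    refine closure_minimal ?_ (isClosed_eq (greenForm u f).continuous continuous_const)
    rintro _ ⟨φ, rfl⟩
    exact h.greenForm_testToH1_eq_zero φ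
  exact hsub (hUΓ.mem_closure_of_trace_eq_zero hz)

end

/-! ## Extension by zero to one side of the interface -/

section

variable {d : ℕ} {U V : Set (Rd d)}

/-- The support of `η` is closed and lies in the union of two disjoint open sets, so cutting `η` off
to one of them creates no discontinuity. -/
theorem IsTestFunction.indicator_eventuallyEq {η : Rd d → ℂ} (hη : IsTestFunction (U ∪ V) η)
    (hU : IsOpen U) (hV : IsOpen V) (hUV : Disjoint U V) (x : Rd d) :
    (x ∈ V ∧ V.indicator η =ᶠ[𝓝 x] η) ∨ (x ∉ V ∧ V.indicator η =ᶠ[𝓝 x] fun _ => 0) := by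
  by_cases hx : x ∈ V
  · refine Or.inl ⟨hx, ?_⟩
    filter_upwards [hV.mem_nhds hx] with y hy
    rw [indicator_of_mem hy]
  refine Or.inr ⟨hx, ?_⟩
  by_cases hx' : x ∈ tsupport η
  · have hxU : x ∈ U := (hη.support hx').elim id fun h => absurd h hx
    filter_upwards [hU.mem_nhds hxU] with y hy
    rw [indicator_of_notMem (disjoint_left.mp hUV hy)]
  · filter_upwards [notMem_tsupport_iff_eventuallyEq.mp hx'] with y hy
    by_cases hyV : y ∈ V
    · rw [indicator_of_mem hyV, hy, Pi.zero_apply]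
    · rw [indicator_of_notMem hyV]

theorem IsTestFunction.indicator {η : Rd d → ℂ} (hη : IsTestFunction (U ∪ V) η)
    (hU : IsOpen U) (hV : IsOpen V) (hUV : Disjoint U V) : IsTestFunction V (V.indicator η) := by
  refine ⟨contDiff_iff_contDiffAt.mpr fun x => ?_, ?_, fun x hx => ?_⟩
  · rcases hη.indicator_eventuallyEq hU hV hUV x with ⟨-, h⟩ | ⟨-, h⟩
    · exact hη.smooth.contDiffAt.congr_of_eventuallyEq h
    · exact contDiffAt_const.congr_of_eventuallyEq h
  · refine hη.compact.mono fun x hx h0 => hx ?_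
    rw [indicator_apply_eq_zero]
    exact fun _ => h0
  · rcases hη.indicator_eventuallyEq hU hV hUV x with ⟨h, -⟩ | ⟨-, h⟩
    · exact h
    · exact absurd hx (notMem_tsupport_iff_eventuallyEq.mpr h)

theorem IsTestFunction.pderiv_indicator {η : Rd d → ℂ} (hη : IsTestFunction (U ∪ V) η)
    (hU : IsOpen U) (hV : IsOpen V) (hUV : Disjoint U V) {x : Rd d} (hx : x ∈ V) (i : Fin d) :
    pderiv (V.indicator η) i x = pderiv η i x := by
  rcases hη.indicator_eventuallyEq hU hV hUV x with ⟨-, h⟩ | ⟨h', -⟩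
  · rw [pderiv, h.fderiv_eq, pderiv]
  · exact absurd hx h'

/-- Functions on disjoint open sets are extended by zero without creating derivatives. -/
theorem exists_extension_by_zero {W : Set (Rd d)} (hU : IsOpen U) (hV : IsOpen V)
    (hUV : Disjoint U V) (hW : U ∪ V = W) (hUW : U ⊆ W) (hVW : V ⊆ W) (z : H1 V) :
    ∃ w : H1 W, restrictH1 hUW w = 0 ∧ restrictH1 hVW w = z := by
  have hind : ∀ (k : Option (Fin d)) (ζ : Rd d → ℂ),
      ∫ x in W, V.indicator (z.1 k) x * ζ x = ∫ x in V, z.1 k x * ζ x := by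
    intro k ζ
    have : (fun x => V.indicator (z.1 k) x * ζ x) = V.indicator fun x => z.1 k x * ζ x := by
      funext x
      by_cases hx : x ∈ V
      · rw [indicator_of_mem hx, indicator_of_mem hx]
      · rw [indicator_of_notMem hx, indicator_of_notMem hx, zero_mul]
    rw [this, setIntegral_indicator hV.measurableSet, inter_eq_self_of_subset_right hVW]
  have hmem : ∀ k, MemLp (V.indicator (z.1 k)) 2 (volume.restrict W) := by
    intro k
    refine (memLp_indicator_iff_restrict hV.measurableSet).mpr ?_
    rw [Measure.restrict_restrict hV.measurableSet, inter_eq_self_of_subset_left hVW]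
    exact Lp.memLp (z.1 k)
  let w : H1 W := mkH1 (fun k => V.indicator (z.1 k)) hmem (by
    intro i η hη
    rw [← hW] at hη
    rw [hind, hind]
    have h1 : ∫ x in V, z.1 none x * pderiv η i x =
        ∫ x in V, z.1 none x * pderiv (V.indicator η) i x :=
      setIntegral_congr_fun hV.measurableSet fun x hx => by
        simp only [hη.pderiv_indicator hU hV hUV hx]
    have h2 : ∫ x in V, z.1 (some i) x * η x = ∫ x in V, z.1 (some i) x * V.indicator η x :=
      setIntegral_congr_fun hV.measurableSet fun x hx => by
        simp only [indicator_of_mem hx]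
    rw [h1, h2]
    exact z.2 i _ (hη.indicator hU hV hUV))
  refine ⟨w, H1.ext_ae fun k => ?_, H1.ext_ae fun k => ?_⟩
  · have h1 : w.1 k =ᵐ[volume.restrict U] V.indicator (z.1 k) :=
      (mkH1_coeFn _ hmem _ k).filter_mono (ae_mono (Measure.restrict_mono hUW le_rfl))
    have h0 : (0 : H1 U).1 k =ᵐ[volume.restrict U] 0 := Lp.coeFn_zero ℂ 2 _
    filter_upwards [restrictH1_coeFn hUW w k, h1, h0, ae_restrict_mem hU.measurableSet]
      with x e1 e2 e3 hx
    rw [e1, e2, e3, indicator_of_notMem (disjoint_left.mp hUV hx), Pi.zero_apply]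
  · have h1 : w.1 k =ᵐ[volume.restrict V] V.indicator (z.1 k) :=
      (mkH1_coeFn _ hmem _ k).filter_mono (ae_mono (Measure.restrict_mono hVW le_rfl))
    filter_upwards [restrictH1_coeFn hVW w k, h1, ae_restrict_mem hV.measurableSet]
      with x e1 e2 hx
    rw [e1, e2, indicator_of_mem hx]

end

/-! ## The double annihilator -/

/-- A closed subspace of the dual of a quotient of a Hilbert space is determined by its
annihilator in that quotient. -/
theorem mem_of_forall_annihilator {E : Type*} [NormedAddCommGroup E] [InnerProductSpace ℂ E]
    [CompleteSpace E] (S : Submodule ℂ E) [hS : IsClosed (S : Set E)]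
    (X : Submodule ℂ (StrongDual ℂ (E ⧸ S))) (hX : IsClosed (X : Set (StrongDual ℂ (E ⧸ S))))
    {ξ₀ : StrongDual ℂ (E ⧸ S)} (h : ∀ q, (∀ ξ ∈ X, ξ q = 0) → ξ₀ q = 0) : ξ₀ ∈ X := by
  -- `R ξ` is the Riesz representative of `ξ` pulled back to `E`. This map is conjugate-linear and
  -- isometric, so it carries the closed subspace `X` to a complete subspace of `E`, where
  -- orthogonal projection is available.
  let R : StrongDual ℂ (E ⧸ S) → E := fun ξ =>
    (InnerProductSpace.toDual ℂ E).symm (ξ.comp S.mkQL)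
  have hR : ∀ ξ x, inner ℂ (R ξ) x = ξ (S.mkQL x) := fun ξ x =>
    InnerProductSpace.toDual_symm_apply
  have hnorm : ∀ ξ, ‖R ξ‖ = ‖ξ‖ := by
    intro ξ
    refine ((LinearIsometryEquiv.norm_map _ _).trans (le_antisymm ?_ ?_))
    · refine ContinuousLinearMap.opNorm_le_bound _ ξ.opNorm_nonneg fun x => ?_
      exact (ξ.le_opNorm _).trans
        (mul_le_mul_of_nonneg_left (Submodule.Quotient.norm_mk_le S x) ξ.opNorm_nonneg)
    · refine ContinuousLinearMap.opNorm_le_bound _ (norm_nonneg _) fun q => ?_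
      refine le_of_forall_pos_le_add fun ε hε => ?_
      set N := ‖ξ.comp S.mkQL‖ with hN
      have hN0 : 0 ≤ N := norm_nonneg _
      have hpos : 0 < ε / (N + 1) := by positivity
      -- The quotient norm is an infimum, so a representative of nearly minimal norm is used.
      obtain ⟨x, rfl, hx⟩ := Submodule.Quotient.norm_mk_lt (S := S) q hpos
      calc ‖ξ (Submodule.Quotient.mk x)‖ = ‖ξ.comp S.mkQL x‖ := rfl
        _ ≤ N * ‖x‖ := ContinuousLinearMap.le_opNorm _ _
        _ ≤ N * (‖(Submodule.Quotient.mk x : E ⧸ S)‖ + ε / (N + 1)) := by gcongr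
        _ = N * ‖(Submodule.Quotient.mk x : E ⧸ S)‖ + N / (N + 1) * ε := by ring
        _ ≤ _ := by
          have : N / (N + 1) ≤ 1 := (div_le_one (by linarith)).mpr (by linarith)
          nlinarith
  have hadd : ∀ ξ ζ, R (ξ + ζ) = R ξ + R ζ := fun ξ ζ => by
    refine ext_inner_right ℂ fun x => ?_
    rw [inner_add_left, hR, hR, hR, add_apply]
  have hsmul : ∀ (a : ℂ) ξ, R (a • ξ) = (starRingEnd ℂ a) • R ξ := fun a ξ => by
    refine ext_inner_right ℂ fun x => ?_
    rw [inner_smul_left, hR, hR, Complex.conj_conj]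
    rfl
  let RL : StrongDual ℂ (E ⧸ S) →ₛₗᵢ[starRingEnd ℂ] E :=
    { toFun := R, map_add' := hadd, map_smul' := hsmul, norm_map' := hnorm }
  let K : Submodule ℂ E := X.map RL.toLinearMap
  have hKmem : ∀ x, x ∈ K ↔ ∃ ξ ∈ X, R ξ = x := fun x => Submodule.mem_map
  have hKc : IsComplete (K : Set E) := by
    have : (K : Set E) = RL '' (X : Set (StrongDual ℂ (E ⧸ S))) := by
      ext x
      exact hKmem x
    rw [this]
    exact RL.isometry.isUniformInducing.isComplete_iff.mpr hX.isComplete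
  have : CompleteSpace K := hKc.completeSpace_coe
  -- The class of the orthogonal component `z` is annihilated by `X`, hence by `ξ₀`. Thus `R ξ₀` is
  -- orthogonal to `z`, which forces `z = 0`.
  obtain ⟨y, hy, z, hz, hyz⟩ := K.exists_add_mem_mem_orthogonal (R ξ₀)
  have hzX : ∀ ξ ∈ X, ξ (S.mkQL z) = 0 := fun ξ hξ => by
    rw [← hR]
    exact hz _ ((hKmem _).mpr ⟨ξ, hξ, rfl⟩)
  have h0 : inner ℂ (R ξ₀) z = 0 := (hR ξ₀ z).trans (h _ hzX)
  have hz0 : z = 0 := by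
    rw [hyz, inner_add_left, hz y hy, zero_add] at h0
    exact inner_self_eq_zero.mp h0
  rw [hz0, add_zero] at hyz
  obtain ⟨ξ, hξ, hξy⟩ := (hKmem y).mp hy
  have : ξ₀ = ξ := RL.injective (hyz.trans hξy.symm)
  rwa [this]

namespace Geometry

variable {d : ℕ} (𝒢 : Geometry d)

/-! ## Traces and normal derivatives on the interface -/

/-- `HHalf` is built from the interior trace; this makes it equally the space of exterior traces of
functions in `H¹(ℝ^d)`. Both sides are continuous and agree on the dense set of test functions. -/
theorem trace_globOut (G : H1 (univ : Set (Rd d))) :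
    trace 𝒢.Op 𝒢.Γ (𝒢.globOut G) = 𝒢.trGlob G := by
  have hd := denseRange_testToH1 isOpen_univ (hasInteriorDirections_univ (d := d))
  refine congrFun (hd.equalizer
    ((trace 𝒢.Op 𝒢.Γ).continuous.comp 𝒢.globOut.continuous) 𝒢.trGlob.continuous
    (funext fun φ => Lp.ext ?_)) G
  have h1 : 𝒢.globOut (testToH1 univ univ φ) = testToH1 𝒢.Op univ φ := restrictH1_testToH1 _ φ
  have h2 : 𝒢.globIn (testToH1 univ univ φ) = testToH1 𝒢.Om univ φ := restrictH1_testToH1 _ φ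
  simp only [Function.comp_apply, trGlob, trIn, ContinuousLinearMap.comp_apply, h1, h2]
  exact (𝒢.isLipschitzPair_Op.trace_testToH1 φ).trans
    (𝒢.isLipschitzPair_Om.trace_testToH1 φ).symm

theorem halfToL2_mkHalf (G : H1 (univ : Set (Rd d))) : 𝒢.halfToL2 (𝒢.mkHalf G) = 𝒢.trGlob G := rfl

theorem halfToL2_injective : Function.Injective 𝒢.halfToL2 :=
  LinearMap.ker_eq_bot.mp (Submodule.ker_liftQ_eq_bot _ _ _ le_rfl)

theorem exists_mkHalf_eq (q : 𝒢.HHalf) : ∃ G, 𝒢.mkHalf G = q := Submodule.Quotient.mk_surjective _ q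

theorem dualPair_halfToL2 (ξ : 𝒢.HMinusHalf) (q : 𝒢.HHalf) :
    𝒢.dualPair ξ (𝒢.halfToL2 q) = ξ q := by
  have h : ∃ q', 𝒢.halfToL2 q' = 𝒢.halfToL2 q := ⟨q, rfl⟩
  rw [dualPair, dif_pos h, 𝒢.halfToL2_injective h.choose_spec]

theorem trMinus_restrictH1 (G : H1 (univ : Set (Rd d))) :
    𝒢.trMinus (restrictH1 (subset_univ _) G) = 𝒢.trGlob G := by
  have : 𝒢.resIn (restrictH1 (subset_univ _) G) = 𝒢.globIn G := H1.ext_ae fun k =>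
    (restrictH1_coeFn 𝒢.Om_subset _ k).trans
      (((restrictH1_coeFn (subset_univ 𝒢.Γᶜ) G k).filter_mono
        (ae_mono (Measure.restrict_mono 𝒢.Om_subset le_rfl))).trans
          (restrictH1_coeFn (subset_univ 𝒢.Om) G k).symm)
  simp only [trMinus, trGlob, ContinuousLinearMap.comp_apply, this]

theorem trPlus_restrictH1 (G : H1 (univ : Set (Rd d))) :
    𝒢.trPlus (restrictH1 (subset_univ _) G) = 𝒢.trGlob G := by
  have : 𝒢.resOut (restrictH1 (subset_univ _) G) = 𝒢.globOut G := H1.ext_ae fun k =>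
    (restrictH1_coeFn 𝒢.Op_subset _ k).trans
      (((restrictH1_coeFn (subset_univ 𝒢.Γᶜ) G k).filter_mono
        (ae_mono (Measure.restrict_mono 𝒢.Op_subset le_rfl))).trans
          (restrictH1_coeFn (subset_univ 𝒢.Op) G k).symm)
  rw [trPlus, ContinuousLinearMap.comp_apply, this, trace_globOut]

theorem trJump_restrictH1 (G : H1 (univ : Set (Rd d))) :
    𝒢.trJump (restrictH1 (subset_univ _) G) = 0 := by
  rw [trJump, sub_apply, trMinus_restrictH1, trPlus_restrictH1, sub_self]

/-- Take zero in `Ω₋` and `-G` in `Ω₊`. With `γ⁻w = 0`, testing with such `w` isolates the condition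
on `Y_h`. -/
theorem exists_trJump_eq (G : H1 (univ : Set (Rd d))) :
    ∃ w : H1 𝒢.Γᶜ, 𝒢.trMinus w = 0 ∧ 𝒢.trJump w = 𝒢.trGlob G := by
  obtain ⟨w, h1, h2⟩ := exists_extension_by_zero 𝒢.isOpen_Om 𝒢.isOpen_Op 𝒢.disjoint_Om_Op
    𝒢.Om_union_Op 𝒢.Om_subset 𝒢.Op_subset (𝒢.globOut (-G))
  have hm : 𝒢.trMinus w = 0 := (congrArg 𝒢.trIn h1).trans (map_zero _)
  have hp : 𝒢.trPlus w = -𝒢.trGlob G :=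
    (congrArg (trace 𝒢.Op 𝒢.Γ) h2).trans ((𝒢.trace_globOut _).trans (map_neg _ _))
  refine ⟨w, hm, ?_⟩
  rw [trJump, sub_apply, hm, hp, zero_sub, neg_neg]

/-- Test functions on `ℝ^d \ Γ` restrict to test functions on either side. -/
theorem restrictH1_testToH1_mem {U V W : Set (Rd d)} (hU : IsOpen U) (hV : IsOpen V)
    (hUV : Disjoint U V) (hW : U ∪ V = W) (hVW : V ⊆ W) (φ : testFns W) :
    restrictH1 hVW (testToH1 W W φ) ∈ range (testToH1 V V) := by
  have hφ : IsTestFunction (U ∪ V) φ.1 := by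
    rw [hW]
    exact φ.2
  refine ⟨⟨V.indicator φ.1, hφ.indicator hU hV hUV⟩, H1.ext_val hV (Lp.ext ?_)⟩
  have h1 := testToH1_coeFn (U := V)
    (⟨V.indicator φ.1, hφ.indicator hU hV hUV⟩ : testFns V) none
  have h2 := (testToH1_coeFn (U := W) φ none).filter_mono
    (ae_mono (Measure.restrict_mono hVW le_rfl))
  filter_upwards [h1, h2, restrictH1_coeFn hVW (testToH1 W W φ) none,
    ae_restrict_mem hV.measurableSet] with x e1 e2 e3 hx
  refine e1.trans (Eq.trans ?_ (e3.trans e2).symm)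
  simp only [jet, indicator_of_mem hx]

theorem trace_testToH1_self {U Γ : Set (Rd d)} (h : IsLipschitzPair U Γ) (φ : testFns U) :
    trace U Γ (testToH1 U U φ) = 0 := by
  have hφ : IsTestFunction univ φ.1 := IsTestFunction.mono φ.2 (subset_univ _)
  have : testToH1 U U φ = testToH1 U univ ⟨φ.1, hφ⟩ := H1.ext_ae fun k =>
    (testToH1_coeFn (U := U) φ k).trans
      (testToH1_coeFn (U := U) (⟨φ.1, hφ⟩ : testFns univ) k).symm
  rw [this]
  refine Lp.ext ((h.trace_testToH1 _).trans (Filter.EventuallyEq.trans ?_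
    (Lp.coeFn_zero ℂ 2 _).symm))
  filter_upwards [ae_restrict_mem h.compact.isClosed.measurableSet] with x hx
  exact IsTestFunction.eq_zero φ.2 fun hxU => h.notMem_of_mem hxU hx

theorem trMinus_testToH1 (φ : testFns 𝒢.Γᶜ) : 𝒢.trMinus (testToH1 _ _ φ) = 0 := by
  obtain ⟨χ, hχ⟩ := restrictH1_testToH1_mem 𝒢.isOpen_Op 𝒢.isOpen_Om 𝒢.disjoint_Om_Op.symm
    ((union_comm _ _).trans 𝒢.Om_union_Op) 𝒢.Om_subset φ
  exact (congrArg 𝒢.trIn hχ.symm).trans (trace_testToH1_self 𝒢.isLipschitzPair_Om χ)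

theorem trPlus_testToH1 (φ : testFns 𝒢.Γᶜ) : 𝒢.trPlus (testToH1 _ _ φ) = 0 := by
  obtain ⟨χ, hχ⟩ := restrictH1_testToH1_mem 𝒢.isOpen_Om 𝒢.isOpen_Op 𝒢.disjoint_Om_Op
    𝒢.Om_union_Op 𝒢.Op_subset φ
  exact (congrArg (trace 𝒢.Op 𝒢.Γ) hχ.symm).trans (trace_testToH1_self 𝒢.isLipschitzPair_Op χ)

theorem trJump_testToH1 (φ : testFns 𝒢.Γᶜ) : 𝒢.trJump (testToH1 _ _ φ) = 0 := by
  rw [trJump, sub_apply, trMinus_testToH1, trPlus_testToH1, sub_self]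

/-! ### Weak normal derivatives and Green's formula -/

variable {𝒢} {v : H1 𝒢.Γᶜ} {f : L2 𝒢.Γᶜ}

/-- The restriction of `f ∈ L²(ℝ^d \ Γ)` to `Ω₋`. -/
abbrev fIn (f : L2 𝒢.Γᶜ) : L2 𝒢.Om := restrictLp (Measure.restrict_mono 𝒢.Om_subset le_rfl) f

/-- The restriction of `f ∈ L²(ℝ^d \ Γ)` to `Ω₊`. -/
abbrev fOut (f : L2 𝒢.Γᶜ) : L2 𝒢.Op := restrictLp (Measure.restrict_mono 𝒢.Op_subset le_rfl) f

theorem massForm_restrict {U V : Set (Rd d)} (hVU : V ⊆ U) (f : L2 U)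
    (G : H1 (univ : Set (Rd d))) :
    massForm (restrictLp (Measure.restrict_mono hVU le_rfl) f)
      (valH1 (restrictH1 (subset_univ V) G)) = ∫ x in V, f x * valH1 G x := by
  refine integral_congr_ae ?_
  filter_upwards [restrictLp_coeFn (Measure.restrict_mono hVU le_rfl) f,
    restrictH1_coeFn (subset_univ V) G none] with x h1 h2
  rw [h1]
  exact congrArg _ h2

/-- Green's functional vanishes on functions with zero trace, so it descends to the quotient
`HHalf`; hence the normal derivative exists and `dnMinus` is not its default value. -/
theorem dnMinus_mkHalf (h : HasWeakLaplacian v f) (G : H1 (univ : Set (Rd d))) :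
    𝒢.dnMinus v (𝒢.mkHalf G) = greenForm (𝒢.resIn v) (fIn f) (𝒢.globIn G) := by
  have key : ∀ G, greenForm (𝒢.resIn v) (fIn f) (𝒢.globIn G) =
      gradForm (𝒢.resIn v) (𝒢.globIn G) + ∫ x in 𝒢.Om, weakLaplacian v x * valH1 G x := by
    intro G
    rw [greenForm_apply, weakLaplacian_eq 𝒢.isOpen_compl_Γ h]
    exact congrArg _ (massForm_restrict 𝒢.Om_subset f G)
  have hex : ∃ ξ, 𝒢.IsNormalDerivMinus v ξ := by
    refine ⟨(LinearMap.ker 𝒢.trGlob.toLinearMap).liftQL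
      ((greenForm (𝒢.resIn v) (fIn f)).comp 𝒢.globIn) fun G hG => ?_, fun G => key G⟩
    exact (h.restrict 𝒢.Om_subset).greenForm_eq_zero 𝒢.isLipschitzPair_Om hG
  rw [dnMinus, dif_pos hex, hex.choose_spec G, key]

theorem dnPlus_mkHalf (h : HasWeakLaplacian v f) (G : H1 (univ : Set (Rd d))) :
    𝒢.dnPlus v (𝒢.mkHalf G) = -greenForm (𝒢.resOut v) (fOut f) (𝒢.globOut G) := by
  have key : ∀ G, -greenForm (𝒢.resOut v) (fOut f) (𝒢.globOut G) =
      -gradForm (𝒢.resOut v) (𝒢.globOut G) - ∫ x in 𝒢.Op, weakLaplacian v x * valH1 G x := by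
    intro G
    rw [greenForm_apply, weakLaplacian_eq 𝒢.isOpen_compl_Γ h, neg_add, ← sub_eq_add_neg]
    exact congrArg _ (massForm_restrict 𝒢.Op_subset f G)
  have hex : ∃ ξ, 𝒢.IsNormalDerivPlus v ξ := by
    refine ⟨(LinearMap.ker 𝒢.trGlob.toLinearMap).liftQL
      (-(greenForm (𝒢.resOut v) (fOut f)).comp 𝒢.globOut) fun G hG => ?_, fun G => key G⟩
    -- The kernel defining `HHalf` refers to the interior trace and is transferred to the exterior
    -- one.
    have hG' : trace 𝒢.Op 𝒢.Γ (𝒢.globOut G) = 0 := (𝒢.trace_globOut G).trans hG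
    exact neg_eq_zero.mpr
      ((h.restrict 𝒢.Op_subset).greenForm_eq_zero 𝒢.isLipschitzPair_Op hG')
  rw [dnPlus, dif_pos hex, hex.choose_spec G, key]

theorem greenForm_split (v : H1 𝒢.Γᶜ) (f : L2 𝒢.Γᶜ) (w : H1 𝒢.Γᶜ) :
    greenForm v f w = greenForm (𝒢.resIn v) (fIn f) (𝒢.resIn w) +
      greenForm (𝒢.resOut v) (fOut f) (𝒢.resOut w) := by
  have key : ∀ (a b : L2 𝒢.Γᶜ) (a₁ b₁ : L2 𝒢.Om) (a₂ b₂ : L2 𝒢.Op),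
      a₁ =ᵐ[volume.restrict 𝒢.Om] a → b₁ =ᵐ[volume.restrict 𝒢.Om] b →
      a₂ =ᵐ[volume.restrict 𝒢.Op] a → b₂ =ᵐ[volume.restrict 𝒢.Op] b →
      ∫ x in 𝒢.Γᶜ, a x * b x = (∫ x in 𝒢.Om, a₁ x * b₁ x) + ∫ x in 𝒢.Op, a₂ x * b₂ x := by
    intro a b a₁ b₁ a₂ b₂ h1 h2 h3 h4
    have hint : IntegrableOn (fun x => a x * b x) 𝒢.Γᶜ volume :=
      (Lp.memLp a).integrable_mul (Lp.memLp b)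
    have hu := setIntegral_union 𝒢.disjoint_Om_Op 𝒢.isOpen_Op.measurableSet
      (hint.mono_set 𝒢.Om_subset) (hint.mono_set 𝒢.Op_subset)
    rw [𝒢.Om_union_Op] at hu
    rw [hu]
    refine congrArg₂ (· + ·) (integral_congr_ae ?_) (integral_congr_ae ?_)
    · filter_upwards [h1, h2] with x e1 e2
      rw [e1, e2]
    · filter_upwards [h3, h4] with x e1 e2
      rw [e1, e2]
  have hg : gradForm v w = gradForm (𝒢.resIn v) (𝒢.resIn w) +
      gradForm (𝒢.resOut v) (𝒢.resOut w) := by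
    rw [gradForm, gradForm, gradForm, ← Finset.sum_add_distrib]
    exact Finset.sum_congr rfl fun i _ => key _ _ _ _ _ _
      (restrictH1_coeFn _ v (some i)) (restrictH1_coeFn _ w (some i))
      (restrictH1_coeFn _ v (some i)) (restrictH1_coeFn _ w (some i))
  have hm : massForm f (valH1 w) = massForm (fIn f) (valH1 (𝒢.resIn w)) +
      massForm (fOut f) (valH1 (𝒢.resOut w)) :=
    key _ _ _ _ _ _ (restrictLp_coeFn _ f) (restrictH1_coeFn _ w none)
      (restrictLp_coeFn _ f) (restrictH1_coeFn _ w none)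
  rw [greenForm_apply, greenForm_apply, greenForm_apply, hg, hm]
  ring

/-- Green's formula on both sides of the interface. -/
theorem green_formula (h : HasWeakLaplacian v f) {w : H1 𝒢.Γᶜ} {qm qj : 𝒢.HHalf}
    (hm : 𝒢.halfToL2 qm = 𝒢.trMinus w) (hj : 𝒢.halfToL2 qj = 𝒢.trJump w) :
    gradForm v w + massForm f (valH1 w) = 𝒢.dnJump v qm + 𝒢.dnPlus v qj := by
  obtain ⟨Gm, rfl⟩ := 𝒢.exists_mkHalf_eq qm
  obtain ⟨Gj, rfl⟩ := 𝒢.exists_mkHalf_eq qj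
  rw [halfToL2_mkHalf] at hm hj
  have hin : greenForm (𝒢.resIn v) (fIn f) (𝒢.resIn w) = 𝒢.dnMinus v (𝒢.mkHalf Gm) := by
    rw [dnMinus_mkHalf h, ← sub_eq_zero, ← map_sub]
    refine (h.restrict 𝒢.Om_subset).greenForm_eq_zero 𝒢.isLipschitzPair_Om ?_
    rw [map_sub, sub_eq_zero]
    exact hm.symm
  -- The exterior trace is `γ⁺w = γ⁻w - ⟦γw⟧`, the trace of `Gm - Gj`; Green's functional may
  -- therefore be evaluated on this global function instead of `w`.
  have hout : greenForm (𝒢.resOut v) (fOut f) (𝒢.resOut w) =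
      -(𝒢.dnPlus v (𝒢.mkHalf Gm) - 𝒢.dnPlus v (𝒢.mkHalf Gj)) := by
    rw [dnPlus_mkHalf h, dnPlus_mkHalf h, neg_sub_neg, neg_sub, ← map_sub, ← map_sub,
      ← sub_eq_zero, ← map_sub]
    refine (h.restrict 𝒢.Op_subset).greenForm_eq_zero 𝒢.isLipschitzPair_Op ?_
    rw [map_sub, sub_eq_zero, trace_globOut, map_sub, hm, hj]
    exact (sub_sub_cancel _ _).symm
  rw [← greenForm_apply, greenForm_split, hin, hout, dnJump, sub_apply]
  ring

end Geometry

/-! ## The forms at zero -/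

section

variable {d : ℕ} {Ω : Set (Rd d)}

theorem valH1_zero_ae : ∀ᵐ x ∂(volume.restrict Ω), valH1 (0 : H1 Ω) x = 0 :=
  Lp.coeFn_zero ℂ 2 (volume.restrict Ω)

theorem gradH1_zero_ae : ∀ᵐ x ∂(volume.restrict Ω), ∀ i, gradH1 (0 : H1 Ω) i x = 0 :=
  ae_all_iff.mpr fun _ => Lp.coeFn_zero ℂ 2 (volume.restrict Ω)

theorem strain_zero_ae : ∀ᵐ x ∂(volume.restrict Ω), ∀ i j, strain (0 : Fin d → H1 Ω) i j x = 0 := by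
  filter_upwards [gradH1_zero_ae (Ω := Ω)] with x hx i j
  simp only [strain, Pi.zero_apply, hx, add_zero, zero_div]

namespace Material

variable (P : Material Ω)

theorem densityForm_zero_right (u : Fin d → H1 Ω) : P.densityForm u 0 = 0 := by
  refine integral_eq_zero_of_ae ?_
  filter_upwards [valH1_zero_ae (Ω := Ω)] with x hx
  simp only [Pi.zero_apply, hx, mul_zero, Finset.sum_const_zero]

theorem B_zero_right (s : ℂ) (u : Fin d → H1 Ω) (ψ : H1 Ω) : P.B s u ψ 0 0 = 0 := by
  have h1 : P.elasticForm u 0 = 0 := by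
    refine integral_eq_zero_of_ae ?_
    filter_upwards [strain_zero_ae (Ω := Ω)] with x hx
    simp only [hx, mul_zero, Finset.sum_const_zero, Pi.zero_apply]
  have h2 : P.piezoForm ψ 0 = 0 := by
    refine integral_eq_zero_of_ae ?_
    filter_upwards [strain_zero_ae (Ω := Ω)] with x hx
    simp only [hx, mul_zero, Finset.sum_const_zero, Pi.zero_apply]
  have h3 : P.piezoForm 0 u = 0 := by
    refine integral_eq_zero_of_ae ?_
    filter_upwards [gradH1_zero_ae (Ω := Ω)] with x hx
    simp only [hx, mul_zero, Finset.sum_const_zero, zero_mul, Pi.zero_apply]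
  have h4 : P.dielectricForm ψ 0 = 0 := by
    refine integral_eq_zero_of_ae ?_
    filter_upwards [gradH1_zero_ae (Ω := Ω)] with x hx
    simp only [hx, mul_zero, Finset.sum_const_zero, Pi.zero_apply]
  rw [B, b, h1, h2, h3, h4, P.densityForm_zero_right]
  ring

end Material

theorem massForm_smul_left (a : ℂ) (f g : L2 Ω) : massForm (a • f) g = a * massForm f g := by
  rw [massForm, massForm, ← integral_const_mul]
  refine integral_congr_ae ?_
  filter_upwards [Lp.coeFn_smul a f] with x hx
  rw [hx, Pi.smul_apply, smul_eq_mul, mul_assoc]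

end

namespace Geometry

variable {d : ℕ} (𝒢 : Geometry d)

theorem surfPair_zero_right (f : Rd d → ℂ) : 𝒢.surfPair f (0 : L2Surf 𝒢.Γ) = 0 := by
  refine integral_eq_zero_of_ae ?_
  filter_upwards [Lp.coeFn_zero ℂ 2 (surf 𝒢.Γ)] with x hx
  rw [hx, Pi.zero_apply, mul_zero]

theorem surfPair_normalTrace_zero (f : Rd d → ℂ) : 𝒢.surfPair f (𝒢.normalTrace 0) = 0 := by
  refine integral_eq_zero_of_ae ?_
  filter_upwards [Lp.coeFn_zero ℂ 2 (surf 𝒢.Γ)] with x hx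
  simp only [normalTrace, Pi.zero_apply, map_zero, hx, zero_mul, Finset.sum_const_zero, mul_zero]

end Geometry

/-! ## Equivalence of the two problems -/

variable {d : ℕ} {𝒢 : Geometry d} {P : Material 𝒢.Om} {𝒟 : DiscreteSpaces 𝒢} {D : Data 𝒟}
  {c ρf : ℝ} {s : ℂ} {v : H1 𝒢.Γᶜ} {u : Fin d → H1 𝒢.Om} {ψ : H1 𝒢.Om}

theorem memHalf_polar_neg {X : Submodule ℂ 𝒢.HMinusHalf} {g : L2Surf 𝒢.Γ}
    (h : 𝒢.MemHalf g (𝒢.polar X)) : 𝒢.MemHalf (-g) (𝒢.polar X) := by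
  obtain ⟨q, hq, rfl⟩ := h
  exact ⟨-q, fun ξ hξ => by rw [map_neg, hq ξ hξ, neg_zero], map_neg _ _⟩

theorem formL_eq {w : H1 𝒢.Γᶜ} {qm qj : 𝒢.HHalf} (hm : 𝒢.halfToL2 qm = 𝒢.trMinus w)
    (hj : 𝒢.halfToL2 qj = 𝒢.trJump w) (ww : Fin d → H1 𝒢.Om) (φ : 𝒢.H1D) :
    formL P D ρf s w ww φ = -(ρf * D.lam qm)
      - ρf * (D.α qj + s * 𝒢.surfPair D.θ (𝒢.trJump w))
      + s ^ 2 * P.densityForm D.Θ ww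
      - ρf * s * 𝒢.surfPair (𝒢.halfToL2 D.β) (𝒢.normalTrace ww)
      + 𝒢.pairN D.η φ := by
  have h1 : 𝒢.dualPair D.lam (𝒢.trMinus w) = D.lam qm := by
    rw [← hm, 𝒢.dualPair_halfToL2]
  have h2 : 𝒢.dualPair D.α (𝒢.trJump w) = D.α qj := by
    rw [← hj, 𝒢.dualPair_halfToL2]
  rw [formL, h1, h2]

theorem IsTransmissionSolution.isVariationalSolution
    (h : IsTransmissionSolution P 𝒟 D c ρf s v u ψ) :
    IsVariationalSolution P 𝒟 D c ρf s v u ψ := by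
  refine ⟨h.u_mem, h.ψ_mem, h.dirichlet, h.jump_tr,
    neg_neg (𝒢.trMinus v) ▸ memHalf_polar_neg h.polar_X, ?_⟩
  rintro w ⟨⟨qj, hqj, hj⟩, qm, hqm, hm⟩ ww hww φ hφ
  have hG := Geometry.green_formula h.helmholtz hm hj
  rw [massForm_smul_left] at hG
  -- `γ⁻w` lies in the annihilator of `X_h`, so it kills this element of `X_h`.
  have hJ : 𝒢.dnJump v qm + D.lam qm = 0 := hqm _ h.jump_dn
  have hY := h.polar_Y qj hqj
  rw [hj] at hY
  have hS := h.solid ww hww φ hφ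
  rw [formL_eq hm hj, formA]
  linear_combination hS + ρf * hG + ρf * hJ - ρf * hY

/-- The variational equation tested in the fluid only. -/
theorem IsVariationalSolution.fluid_equation (hρf : 0 < ρf)
    (h : IsVariationalSolution P 𝒟 D c ρf s v u ψ) {w : H1 𝒢.Γᶜ} {qm qj : 𝒢.HHalf}
    (hqm : qm ∈ 𝒢.polar 𝒟.X) (hqj : qj ∈ 𝒟.Y) (hm : 𝒢.halfToL2 qm = 𝒢.trMinus w)
    (hj : 𝒢.halfToL2 qj = 𝒢.trJump w) :
    gradForm v w + massForm ((s / c) ^ 2 • valH1 v) (valH1 w)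
      + s * 𝒢.surfPair (𝒢.normalTrace u) (𝒢.trJump w) =
      -D.lam qm - (D.α qj + s * 𝒢.surfPair D.θ (𝒢.trJump w)) := by
  -- Zero tests in the solid remove the form `ℬ` and its data; the common factor `ρf` is cancelled
  -- afterwards.
  have hE := h.equation w ⟨⟨qj, hqj, hj⟩, qm, hqm, hm⟩ 0 𝒟.Vvec.zero_mem 0 𝒟.VD.zero_mem
  have hN : 𝒢.pairN D.η 0 = 0 := map_zero D.η
  rw [formL_eq hm hj, formA, Submodule.coe_zero, P.B_zero_right, P.densityForm_zero_right,
    𝒢.surfPair_normalTrace_zero, 𝒢.surfPair_normalTrace_zero, hN] at hE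
  have hρ : (ρf : ℂ) ≠ 0 := Complex.ofReal_ne_zero.mpr hρf.ne'
  refine mul_left_cancel₀ hρ ?_
  rw [massForm_smul_left]
  linear_combination hE

/-- Test functions on `ℝ^d \ Γ` lie in `V_h^*` and have zero trace from both sides, so all interface
terms drop out. -/
theorem IsVariationalSolution.helmholtz (hρf : 0 < ρf)
    (h : IsVariationalSolution P 𝒟 D c ρf s v u ψ) :
    HasWeakLaplacian v ((s / c) ^ 2 • valH1 v) := by
  intro η hη
  let φ : testFns 𝒢.Γᶜ := ⟨η, hη⟩
  have hm := 𝒢.trMinus_testToH1 φ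
  have hj := 𝒢.trJump_testToH1 φ
  have hE := h.fluid_equation hρf (w := testToH1 _ _ φ) (qm := 0) (qj := 0)
    (fun ξ _ => map_zero ξ) 𝒟.Y.zero_mem ((map_zero _).trans hm.symm) ((map_zero _).trans hj.symm)
  rw [hj, 𝒢.surfPair_zero_right, 𝒢.surfPair_zero_right, map_zero, map_zero,
    ← greenForm_apply, greenForm_testToH1] at hE
  linear_combination -hE

theorem IsVariationalSolution.isTransmissionSolution (hρf : 0 < ρf)
    (h : IsVariationalSolution P 𝒟 D c ρf s v u ψ) :
    IsTransmissionSolution P 𝒟 D c ρf s v u ψ := by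
  refine ⟨h.u_mem, h.ψ_mem, h.helmholtz hρf, h.dirichlet, fun ww hww φ hφ => ?_,
    memHalf_polar_neg h.polar_X, fun χ hχ => ?_, ?_, h.jump_tr⟩
  -- Solid equations: the test with `w = 0`.
  · have hm : 𝒢.halfToL2 0 = 𝒢.trMinus 0 := by rw [map_zero, map_zero]
    have hj : 𝒢.halfToL2 0 = 𝒢.trJump 0 := by rw [map_zero, map_zero]
    have hE := h.equation 0 ⟨⟨0, 𝒟.Y.zero_mem, hj⟩, 0, fun ξ _ => map_zero ξ, hm⟩ ww hww φ hφ
    have hv : valH1 (0 : H1 𝒢.Γᶜ) = 0 := rfl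
    rw [formL_eq hm hj, formA, gradForm_zero_right, hv, massForm_zero_right, ← hj, map_zero,
      map_zero, map_zero, 𝒢.surfPair_zero_right, 𝒢.surfPair_zero_right] at hE
    linear_combination hE
  -- Polar condition on `Y_h`: `γ⁻w = 0` and `⟦γw⟧ = χ`, so Green's formula leaves only `⟨∂_ν⁺ v,
  -- χ⟩`.
  · obtain ⟨G, rfl⟩ := 𝒢.exists_mkHalf_eq χ
    obtain ⟨w, hm, hj⟩ := 𝒢.exists_trJump_eq G
    have hm' : 𝒢.halfToL2 0 = 𝒢.trMinus w := (map_zero _).trans hm.symm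
    have hj' : 𝒢.halfToL2 (𝒢.mkHalf G) = 𝒢.trJump w := hj.symm
    have hE := h.fluid_equation hρf (fun ξ _ => map_zero ξ) hχ hm' hj'
    rw [Geometry.green_formula (h.helmholtz hρf) hm' hj', map_zero, map_zero, ← hj'] at hE
    linear_combination -hE
  -- Membership in `X_h`: for `q ∈ X_h°` a global lift of `q` has no jump, so Green's formula leaves
  -- only `⟨⟦∂_ν v⟧, q⟩`, and the equation says that this equals `-⟨λ_d, q⟩`.
  · refine mem_of_forall_annihilator _ 𝒟.X 𝒟.isClosed_X fun q hq => ?_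
    obtain ⟨G, rfl⟩ := 𝒢.exists_mkHalf_eq q
    have hm : 𝒢.halfToL2 (𝒢.mkHalf G) = 𝒢.trMinus (restrictH1 (subset_univ _) G) :=
      (𝒢.trMinus_restrictH1 G).symm
    have hj : 𝒢.halfToL2 0 = 𝒢.trJump (restrictH1 (subset_univ _) G) :=
      (map_zero _).trans (𝒢.trJump_restrictH1 G).symm
    have hE := h.fluid_equation hρf hq 𝒟.Y.zero_mem hm hj
    rw [Geometry.green_formula (h.helmholtz hρf) hm hj, 𝒢.trJump_restrictH1,
      𝒢.surfPair_zero_right, 𝒢.surfPair_zero_right, map_zero, map_zero] at hE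
    rw [add_apply]
    linear_combination hE

end

end PiezoScattering

theorem proposition4p2 {d : ℕ} (𝒢 : PiezoScattering.Geometry d)
    (P : PiezoScattering.Material 𝒢.Om) (𝒟 : PiezoScattering.DiscreteSpaces 𝒢)
    (D : PiezoScattering.Data 𝒟) (c ρf : ℝ) (hc : 0 < c) (hρf : 0 < ρf)
    (s : ℂ) (hs : 0 < s.re)
    (v : PiezoScattering.H1 (𝒢.Γᶜ)) (u : Fin d → PiezoScattering.H1 𝒢.Om)
    (ψ : PiezoScattering.H1 𝒢.Om) :
    PiezoScattering.IsTransmissionSolution P 𝒟 D c ρf s v u ψ ↔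
      PiezoScattering.IsVariationalSolution P 𝒟 D c ρf s v u ψ :=
  ⟨fun h => h.isVariationalSolution, fun h => h.isTransmissionSolution hρf⟩
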